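/- Let $k$ be a field, $n\ge 0$, $S=k[x_1,\dots,x_n]$, $d\in\mathbb N$ and $b\in\mathbb N^n$. Let $I_{\preceq b}\subseteq S$ be the ideal generated by the monomials $x^a$ of degree $d$ with $a\preceq b$ (that is, $a_i\le b_i$ for all $i$). For $e\in\mathbb N$ let $X_n^e$ be the polyhedral complex obtained by subdividing the Newton polytope $\operatorname{conv}\{a\in\mathbb N^n : |a|=e\}$ by the hyperplanes $\{y\in\mathbb R^n : y_i=j\}$, $1\le i\le n$, $j\ge 0$. Label each vertex $a\in\mathbb N^n$ of it by $x^a$ and each face $F$ by the least common multiple $x^{a_F}$ of the labels of its vertices (the empty face by $1$), and for $c\in\mathbb N^n$ let $X^e_{n,\preceq c}$ be the subcomplex of the faces with $a_F\preceq c$. Orient the cells so that parallel cells are oriented in the same way. The cellular complex of a labelled complex $X$ has as its $p$-th module the free $S$-module on the faces of dimension $p-1$ (including the empty face), with $\partial F=\sum_{G}\operatorname{sign}(G,F)\,x^{a_F-a_G}\,G$, the sum being over the facets $G$ of $F$; its $p$-th syzygy module is the image of $\partial$ in its $p$-th module. For $m\ge 1$ let $F_m$ be the cellular complex of $X_m:=X^{md}_{n,\preceq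 mb}$. As morphisms $F_i\to F_j$, $i\le j$, take the multiplications by the monomials $x^u$ that are products of $j-i$ monomial generators of $I_{\preceq b}$ (the degree-$d$ monomials bounded by $b$; for $i=j$ only the identity), and take no morphisms if $i>j$. The cellular map of the multiplication by $x^u$ is the translation $y\mapsto y+u$; its chain map is the multiplication by $x^u$ in degree $0$, and in positive degrees sends the generator of a cell $F$ to the generator of $F+u$. Let $s_p$ be the representation of this category over $S$ that sends $F_m$ to its $p$-th module and a morphism to the $p$-th component of its chain map. A representation is finitely generated if some finite set of its elements lies in no proper subrepresentation. 1. For every $m\ge1$ the complex $X_m$ supports a cellular resolution of $S/I_{\preceq b}^m$: $X_m$ is finite, $F_m$ is exact in positive degrees, and the image of its first differential in $S$ is $I_{\preceq b}^m$. 2. The multiplications above are morphisms of cellular resolutions: each consists of a cellular map and a chain map that are compatible with each other. 3. There is a $K$ such that for every $m\ge K$ the complex $X_m$ is covered by finitely many $X_j$ with $1\le j<m$, each $F_j$ having a morphism to $F_m$: the images of the cells of these $X_j$ under all the morphisms $F_j\to F_m$ are exactly the cells of $X_m$. 4. For every $p\ge 0$ the $p$-th syzygy modules of the $F_m$ form a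 subrepresentation $\sigma_p$ of $s_p$, and $\sigma_p$ is finitely generated. 5. In particular, let $I_{K_n}=(x_ix_j : 1\le i<j\le n)$ be the edge ideal of the complete graph $K_n$. For $d=2$ and $b=(1,\dots,1)$ the complex $X_m$ supports a cellular resolution of $S/I_{K_n}^m$ for every $m\ge1$, and the syzygy representations $\sigma_p$ of this family are finitely generated for all $p\ge 0$. -/

import Mathlib

namespace CellFamily

/-- The point of `ℝⁿ` given by an exponent vector. -/
noncomputable def toPt {n : ℕ} (a : Fin n → ℕ) : Fin n → ℝ := fun i => (a i : ℝ)

/-- The monomial `x^a` in `k[x_1, …, x_n]`. -/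
noncomputable def mono (k : Type*) [Field k] {n : ℕ} (a : Fin n → ℕ) : MvPolynomial (Fin n) k :=
  MvPolynomial.monomial (Finsupp.equivFunOnFinite.symm a) 1

/-! ### Labelled polyhedral cell complexes and their cellular complexes

A cell complex in `ℝⁿ` is given by its set `X` of nonempty closed cells. A vertex (a `0`-cell) at a
lattice point `a` carries the label `x^a`. -/

/-- The exponent vector of the label of a face: the label is the least common multiple of the labels
of the vertices of the complex lying in that face (so the label of the empty face is `1`). -/
noncomputable def label {n : ℕ} (X : Set (Set (Fin n → ℝ))) (F : Set (Fin n → ℝ)) : Fin n → ℕ :=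
  fun i => sSup {c : ℕ | ∃ a : Fin n → ℕ, {toPt a} ∈ X ∧ toPt a ∈ F ∧ a i = c}

open Classical in
/-- `1 +` the dimension of a face; the empty face has dimension `-1`. -/
noncomputable def faceRank {n : ℕ} (F : Set (Fin n → ℝ)) : ℕ :=
  if F = ∅ then 0 else Module.finrank ℝ (vectorSpan ℝ F) + 1

/-- The faces of dimension `p - 1`, the empty face included. -/
def Face {n : ℕ} (X : Set (Set (Fin n → ℝ))) (p : ℕ) : Type :=
  {F : Set (Fin n → ℝ) // (F = ∅ ∨ F ∈ X) ∧ faceRank F = p}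

/-- The subcomplex `X_{⪯ b}` of the faces whose label divides `x^b`. -/
def bounded {n : ℕ} (X : Set (Set (Fin n → ℝ))) (b : Fin n → ℕ) : Set (Set (Fin n → ℝ)) :=
  {F | F ∈ X ∧ label X F ≤ b}

open Classical in
/-- The coordinates that are not constant on `F`. -/
noncomputable def freeCoords {n : ℕ} (F : Set (Fin n → ℝ)) : Finset (Fin n) :=
  Finset.univ.filter fun i => ∃ y ∈ F, ∃ z ∈ F, y i ≠ z i

open Classical in
/-- The incidence number of a facet `G` of `F`, for cells of the form
`{y | ∑ y = c, y i ∈ [a i, a i + 1] for i ∈ T, y i = a i for i ∉ T}`. Such a cell is oriented by the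
restriction to it of `det (∑_{i ∈ T} e_i, ·, …, ·)` with the coordinates of `T = freeCoords F` in
increasing order (parallel cells are oriented in the same way). The facet `G` is cut out by making
one free coordinate `i` extremal, and the induced sign (with the inner normal vector of `G` put
first) is `(-1)^(position of i in T)` times `1` or `-1` according to whether `i` is maximal or
minimal on `G`; the two endpoints of an edge get opposite signs. The empty face has sign `1` in
every vertex. -/
noncomputable def incidence {n : ℕ} (G F : Set (Fin n → ℝ)) : ℤ :=
  if h : (freeCoords F \ freeCoords G).Nonempty then
    (-1) ^ ((freeCoords F).filter fun j => j < (freeCoords F \ freeCoords G).min' h).card *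
      (if ∀ y ∈ F, ∀ z ∈ G, y ((freeCoords F \ freeCoords G).min' h) ≤
          z ((freeCoords F \ freeCoords G).min' h) then 1 else -1)
  else 1

/-- The `p`-th module of the cellular complex: free on the faces of dimension `p - 1`. -/
abbrev Chain (k : Type*) [Field k] {n : ℕ} (X : Set (Set (Fin n → ℝ))) (p : ℕ) :=
  Face X p →₀ MvPolynomial (Fin n) k

/-- The differential of the cellular complex,
`∂ F = ∑_{G ⊂ F facet} sign(G, F) x^(a_F - a_G) G`. -/
noncomputable def boundary (k : Type*) [Field k] {n : ℕ} (X : Set (Set (Fin n → ℝ))) (p : ℕ) :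
    Chain k X (p + 1) →ₗ[MvPolynomial (Fin n) k] Chain k X p :=
  Finsupp.linearCombination (MvPolynomial (Fin n) k) fun F : Face X (p + 1) =>
    ∑ᶠ G : {G : Face X p // G.1 ⊆ F.1},
      Finsupp.single G.1
        ((incidence G.1.1 F.1 : MvPolynomial (Fin n) k) * mono k (label X F.1 - label X G.1.1))

/-- The empty face. -/
def emptyFace {n : ℕ} (X : Set (Set (Fin n → ℝ))) : Face X 0 :=
  ⟨∅, Or.inl rfl, by simp [faceRank]⟩

/-- `X` is finite and its cellular complex is a resolution of `S / J`: it is exact in positive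
degrees, and the image of `∂` in the degree `0` module `S` (free on the empty face) is `J`. -/
def SupportsResolution (k : Type*) [Field k] {n : ℕ} (X : Set (Set (Fin n → ℝ)))
    (J : Ideal (MvPolynomial (Fin n) k)) : Prop :=
  X.Finite ∧
  (∀ p, Function.Exact (boundary k X (p + 1)) (boundary k X p)) ∧
  Submodule.map (Finsupp.lapply (emptyFace X)) (LinearMap.range (boundary k X 0)) = J

/-- The `p`-th syzygy module of the cellular complex, a submodule of its `p`-th free module. -/
noncomputable def syzygy (k : Type*) [Field k] {n : ℕ} (X : Set (Set (Fin n → ℝ))) (p : ℕ) :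
    Submodule (MvPolynomial (Fin n) k) (Chain k X p) :=
  LinearMap.range (boundary k X p)

/-- The union of the cells of dimension at most `q`. -/
def skeleton {n : ℕ} (X : Set (Set (Fin n → ℝ))) (q : ℕ) : Set (Fin n → ℝ) :=
  {y | ∃ F ∈ X, faceRank F ≤ q + 1 ∧ y ∈ F}

/-- Morphisms of cellular resolutions: `g` is a cellular map, `f` is a chain map, and they are
compatible: `f` sends the generator of a face `F` to a combination of the generators of the faces
that make up `g(F)`, and `f_0` is the map on labels induced by `g`, which sends the label of `F` to
the least common multiple of the labels of the faces that make up `g(F)`. -/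
structure IsCompatiblePair (k : Type*) [Field k] {n : ℕ} (X Y : Set (Set (Fin n → ℝ)))
    (f : ∀ p, Chain k X p →ₗ[MvPolynomial (Fin n) k] Chain k Y p)
    (g : (Fin n → ℝ) → (Fin n → ℝ)) : Prop where
  continuousOn : ContinuousOn g (⋃₀ X)
  cellular : ∀ q, Set.MapsTo g (skeleton X q) (skeleton Y q)
  chainMap : ∀ p, f p ∘ₗ boundary k X p = boundary k Y p ∘ₗ f (p + 1)
  image : ∀ (p : ℕ) (F : Face X (p + 1)),
    g '' F.1 = ⋃ G ∈ (f (p + 1) (Finsupp.single F 1)).support, G.1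
  labels : ∀ (p : ℕ) (F : Face X (p + 1)),
    f 0 (Finsupp.single (emptyFace X) (mono k (label X F.1))) =
      Finsupp.single (emptyFace Y)
        (mono k ((f (p + 1) (Finsupp.single F 1)).support.sup fun G => label Y G.1))

/-! ### The subdivided simplices `X_n^e` -/

/-- The Newton polytope of the `e`-th power of the maximal ideal `(x_1, …, x_n)`. -/
def newton (n e : ℕ) : Set (Fin n → ℝ) :=
  convexHull ℝ {y | ∃ a : Fin n → ℕ, ∑ i, a i = e ∧ y = toPt a}

/-- The smallest closed cell containing `y` in the subdivision of the Newton polytope by the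
hyperplanes `{z | z i = j}`, `j = 0, 1, 2, …`: the intersection of the polytope with all the closed
half spaces bounded by these hyperplanes that contain `y`. -/
def subdivCell (n e : ℕ) (y : Fin n → ℝ) : Set (Fin n → ℝ) :=
  {z | z ∈ newton n e ∧
    ∀ (i : Fin n) (j : ℕ), (y i ≤ (j : ℝ) → z i ≤ (j : ℝ)) ∧ ((j : ℝ) ≤ y i → (j : ℝ) ≤ z i)}

/-- The complex `X_n^e`: the Newton polytope subdivided by the hyperplanes `{z | z i = j}`. -/
def subdividedSimplex (n e : ℕ) : Set (Set (Fin n → ℝ)) :=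
  {F | ∃ y ∈ newton n e, F = subdivCell n e y}

/-! ### Bounded equigenerated ideals and their powers -/

/-- The exponent vectors of the monomials of degree `d` bounded by `b`. -/
def gens (n d : ℕ) (b : Fin n → ℕ) : Set (Fin n → ℕ) := {a | ∑ i, a i = d ∧ a ≤ b}

/-- The ideal `I_{⪯ b}` generated by the monomials of degree `d` bounded by `b`. -/
noncomputable def boundedIdeal (k : Type*) [Field k] (n d : ℕ) (b : Fin n → ℕ) :
    Ideal (MvPolynomial (Fin n) k) :=
  Ideal.span (mono k '' gens n d b)

/-- The edge ideal of a graph on the vertices `1, …, n`. -/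
noncomputable def edgeIdeal (k : Type*) [Field k] {n : ℕ} (G : SimpleGraph (Fin n)) :
    Ideal (MvPolynomial (Fin n) k) :=
  Ideal.span {q | ∃ i j, G.Adj i j ∧ q = MvPolynomial.X i * MvPolynomial.X j}

/-- The complex `X_{n, ⪯ m b}^{m d}`. -/
def powerComplex (n d : ℕ) (b : Fin n → ℕ) (m : ℕ) : Set (Set (Fin n → ℝ)) :=
  bounded (subdividedSimplex n (m * d)) (m • b)

/-- The translate of a cell by an exponent vector. -/
def translate {n : ℕ} (u : Fin n → ℕ) (F : Set (Fin n → ℝ)) : Set (Fin n → ℝ) :=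
  (fun y => y + toPt u) '' F

/-- The objects of the family: the powers `I_{⪯ b}^m`, `m ≥ 1`, with their resolutions on
`X_{n, ⪯ m b}^{m d}`. -/
structure PowerFamily (n d : ℕ) (b : Fin n → ℕ) where
  /-- the exponent -/
  power : ℕ
  one_le : 1 ≤ power

/-- The underlying cell complex of a member of the family. -/
def PowerFamily.complex {n d : ℕ} {b : Fin n → ℕ} (m : PowerFamily n d b) :
    Set (Set (Fin n → ℝ)) := powerComplex n d b m.power

/-- The morphisms of the family from the `i`-th to the `j`-th power: the multiplications by the
monomials `x^u` that are products of `j - i` monomials of degree `d` bounded by `b`. So the maps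
between consecutive members are the multiplications by the generators, and all other maps are their
composites. -/
def PowerFamily.Mult {n d : ℕ} {b : Fin n → ℕ} (i j : PowerFamily n d b) : Type :=
  {u : Fin n → ℕ // ∃ s : Multiset (Fin n → ℕ),
    i.power + s.card = j.power ∧ (∀ w ∈ s, w ∈ gens n d b) ∧ s.sum = u}

instance PowerFamily.category (n d : ℕ) (b : Fin n → ℕ) :
    CategoryTheory.Category (PowerFamily n d b) where
  Hom i j := PowerFamily.Mult i j
  id i := ⟨0, 0, by simp⟩
  comp u v := ⟨u.1 + v.1, by
    obtain ⟨s, hs, hs', hs''⟩ := u.2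
    obtain ⟨t, ht, ht', ht''⟩ := v.2
    refine ⟨s + t, ?_, ?_, ?_⟩
    · rw [Multiset.card_add]; omega
    · intro w hw
      rcases Multiset.mem_add.1 hw with h | h
      · exact hs' w h
      · exact ht' w h
    · rw [Multiset.sum_add, hs'', ht'']⟩
  id_comp u := Subtype.ext (zero_add u.1)
  comp_id u := Subtype.ext (add_zero u.1)
  assoc u v w := Subtype.ext (add_assoc u.1 v.1 w.1)

/-- The exponent vector of the monomial of a morphism. -/
def PowerFamily.shift {n d : ℕ} {b : Fin n → ℕ} {i j : PowerFamily n d b} (u : i ⟶ j) :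
    Fin n → ℕ := Subtype.val (show PowerFamily.Mult i j from u)

/-! Translation by the exponent vector of a morphism maps cells to cells of the same dimension. -/

lemma mem_newton {n e : ℕ} {y : Fin n → ℝ} :
    y ∈ newton n e ↔ (∀ i, 0 ≤ y i) ∧ ∑ i, y i = (e : ℝ) := by
  constructor
  · intro hy
    have hconv : Convex ℝ {y : Fin n → ℝ | (∀ i, 0 ≤ y i) ∧ ∑ i, y i = (e : ℝ)} := by
      intro y hy z hz s t hs ht hst
      refine ⟨fun i => ?_, ?_⟩
      · have h1 := hy.1 i
        have h2 := hz.1 i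
        simp only [Pi.add_apply, Pi.smul_apply, smul_eq_mul]
        positivity
      · simp only [Pi.add_apply, Pi.smul_apply, smul_eq_mul, Finset.sum_add_distrib,
          ← Finset.mul_sum, hy.2, hz.2]
        rw [← add_mul, hst, one_mul]
    refine convexHull_min ?_ hconv hy
    rintro _ ⟨a, ha, rfl⟩
    refine ⟨fun i => Nat.cast_nonneg _, ?_⟩
    simp only [toPt]
    exact_mod_cast ha
  · rintro ⟨h0, h1⟩
    rcases Nat.eq_zero_or_pos e with rfl | he
    · apply subset_convexHull
      refine ⟨0, by simp, ?_⟩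
      funext i
      have h1' : ∑ i, y i = 0 := by simpa using h1
      have := (Finset.sum_eq_zero_iff_of_nonneg (fun i _ => h0 i)).1 h1' i (Finset.mem_univ i)
      simpa [toPt] using this
    · have he' : (0 : ℝ) < e := by exact_mod_cast he
      have hy : y = ∑ i, (y i / e) • toPt (Pi.single i e : Fin n → ℕ) := by
        funext j
        rw [Finset.sum_apply, Finset.sum_eq_single j]
        · simp only [toPt, Pi.smul_apply, smul_eq_mul, Pi.single_eq_same]
          field_simp
        · intro i _ hij
          simp [toPt, Pi.single_eq_of_ne hij.symm]
        · simp
      rw [hy]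
      refine (convex_convexHull ℝ _).sum_mem (fun i _ => div_nonneg (h0 i) he'.le) ?_ ?_
      · rw [← Finset.sum_div, h1, div_self he'.ne']
      · intro i _
        apply subset_convexHull
        exact ⟨Pi.single i e, by simp, rfl⟩

lemma translate_subdivCell {n e e' : ℕ} {u : Fin n → ℕ} (hu : e + ∑ i, u i = e') {y : Fin n → ℝ}
    (hy : y ∈ newton n e) :
    y + toPt u ∈ newton n e' ∧
      translate u (subdivCell n e y) = subdivCell n e' (y + toPt u) := by
  have hu' : (e : ℝ) + ∑ i, (u i : ℝ) = e' := by exact_mod_cast hu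
  have hadd : ∀ z : Fin n → ℝ, z ∈ newton n e → z + toPt u ∈ newton n e' := by
    intro z hz
    rw [mem_newton] at hz ⊢
    refine ⟨fun i => add_nonneg (hz.1 i) (Nat.cast_nonneg _), ?_⟩
    simp only [Pi.add_apply, toPt, Finset.sum_add_distrib, hz.2, hu']
  refine ⟨hadd y hy, ?_⟩
  have hy0 := (mem_newton.1 hy).1
  ext z
  constructor
  · rintro ⟨w, ⟨hw, hw'⟩, rfl⟩
    have hw0 := (mem_newton.1 hw).1
    refine ⟨hadd w hw, fun i j => ?_⟩
    simp only [Pi.add_apply, toPt]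
    rcases le_total (u i) j with h | h
    · obtain ⟨c, rfl⟩ := Nat.exists_eq_add_of_le h
      have := hw' i c
      push_cast
      constructor
      · intro h1
        have := this.1 (by linarith)
        linarith
      · intro h1
        have := this.2 (by linarith)
        linarith
    · have hc : (j : ℝ) ≤ u i := by exact_mod_cast h
      constructor
      · intro h1
        have h2 := hy0 i
        have h3 : y i = 0 := by linarith
        have h4 := (hw' i 0).1 (by simp [h3])
        have h5 : (j : ℝ) = u i := by linarith
        simp only [Nat.cast_zero] at h4
        linarith
      · intro _
        have := hw0 i
        linarith
  · rintro ⟨hz, hz'⟩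
    have hge : ∀ i, (u i : ℝ) ≤ z i := fun i =>
      (hz' i (u i)).2 (by simpa [toPt] using hy0 i)
    refine ⟨z - toPt u, ⟨?_, fun i j => ?_⟩, by simp⟩
    · rw [mem_newton] at hz ⊢
      refine ⟨fun i => sub_nonneg.2 (hge i), ?_⟩
      simp only [Pi.sub_apply, toPt, Finset.sum_sub_distrib, hz.2]
      linarith
    · have := hz' i (j + u i)
      simp only [Pi.add_apply, Pi.sub_apply, toPt, Nat.cast_add] at this ⊢
      constructor
      · intro h1
        have := this.1 (by linarith)
        linarith
      · intro h1
        have := this.2 (by linarith)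
        linarith

lemma translate_mem_subdividedSimplex {n e e' : ℕ} {u : Fin n → ℕ} (hu : e + ∑ i, u i = e')
    {F : Set (Fin n → ℝ)} (hF : F ∈ subdividedSimplex n e) :
    translate u F ∈ subdividedSimplex n e' := by
  obtain ⟨y, hy, rfl⟩ := hF
  obtain ⟨h1, h2⟩ := translate_subdivCell hu hy
  exact ⟨_, h1, h2⟩

lemma singleton_mem_subdividedSimplex {n e : ℕ} {a : Fin n → ℕ} (h : toPt a ∈ newton n e) :
    {toPt a} ∈ subdividedSimplex n e := by
  refine ⟨toPt a, h, ?_⟩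
  ext z
  simp only [Set.mem_singleton_iff]
  constructor
  · rintro rfl
    exact ⟨h, fun i j => ⟨id, id⟩⟩
  · rintro ⟨_, hz⟩
    funext i
    have := hz i (a i)
    exact le_antisymm (this.1 le_rfl) (this.2 le_rfl)

lemma label_translate_le {n e e' : ℕ} {u : Fin n → ℕ}
    {F : Set (Fin n → ℝ)} (hF : F ∈ subdividedSimplex n e) :
    label (subdividedSimplex n e') (translate u F) ≤ label (subdividedSimplex n e) F + u := by
  have hF' : F ⊆ newton n e := by
    obtain ⟨y, _, rfl⟩ := hF
    exact fun z hz => hz.1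
  intro i
  refine csSup_le' ?_
  rintro _ ⟨a, _, ⟨y, hy, hya⟩, rfl⟩
  have hyN := mem_newton.1 (hF' hy)
  have hua : ∀ t, u t ≤ a t := fun t => by
    have h1 : y t + u t = a t := congrFun hya t
    have h2 := hyN.1 t
    have : (u t : ℝ) ≤ a t := by linarith
    exact_mod_cast this
  have hyeq : toPt (a - u) = y := by
    funext t
    have h1 : y t + u t = a t := congrFun hya t
    simp only [toPt, Pi.sub_apply, Nat.cast_sub (hua t)]
    linarith
  have hle : a i - u i ≤ label (subdividedSimplex n e) F i := by
    refine le_csSup ⟨e, ?_⟩ ⟨a - u, ?_, ?_, rfl⟩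
    · rintro _ ⟨c, _, hc, rfl⟩
      have hcN := mem_newton.1 (hF' hc)
      have : (c i : ℝ) ≤ e := by
        rw [← hcN.2]
        exact Finset.single_le_sum (f := toPt c) (fun t _ => hcN.1 t) (Finset.mem_univ i)
      exact_mod_cast this
    · exact singleton_mem_subdividedSimplex (hyeq ▸ hF' hy)
    · exact hyeq ▸ hy
  have := hua i
  simp only [Pi.add_apply]
  omega

open scoped Pointwise in
lemma faceRank_translate {n : ℕ} (u : Fin n → ℕ) (F : Set (Fin n → ℝ)) :
    faceRank (translate u F) = faceRank F := by
  have h : translate u F = (toPt u) +ᵥ F := by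
    ext z
    simp only [translate, Set.mem_image, Set.mem_vadd_set, vadd_eq_add, add_comm (toPt u)]
  simp only [faceRank]
  rw [h, vectorSpan_vadd]
  simp

lemma PowerFamily.translate_mem {n d : ℕ} {b : Fin n → ℕ} {i j : PowerFamily n d b} (u : i ⟶ j)
    {F : Set (Fin n → ℝ)} (hF : F ∈ i.complex) :
    translate (PowerFamily.shift u) F ∈ j.complex := by
  obtain ⟨s, hs, hs', hs''⟩ := (show PowerFamily.Mult i j from u).2
  have key : ∀ s : Multiset (Fin n → ℕ), (∀ w ∈ s, w ∈ gens n d b) →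
      (∑ t, s.sum t = s.card * d ∧ s.sum ≤ s.card • b) := by
    intro s
    induction s using Multiset.induction with
    | empty => intro _; simp
    | cons w s ih =>
      intro h
      obtain ⟨h1, h2⟩ := ih fun v hv => h v (Multiset.mem_cons_of_mem hv)
      obtain ⟨h3, h4⟩ := h w (Multiset.mem_cons_self w s)
      simp only [Multiset.sum_cons, Multiset.card_cons, Pi.add_apply, Finset.sum_add_distrib, h1,
        h3, add_mul, one_mul, add_smul, one_smul]
      exact ⟨add_comm _ _, by rw [add_comm]; exact add_le_add h2 h4⟩
  obtain ⟨h1, h2⟩ := key s hs'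
  rw [hs''] at h1 h2
  have hd : i.power * d + ∑ t, PowerFamily.shift u t = j.power * d := by
    change i.power * d + ∑ t, (show PowerFamily.Mult i j from u).1 t = _
    rw [h1, ← hs, add_mul]
  refine ⟨translate_mem_subdividedSimplex hd hF.1, ?_⟩
  refine (label_translate_le hF.1).trans ?_
  rw [← hs, add_smul]
  exact add_le_add hF.2 h2

/-- The face of the `j`-th complex that a face of the `i`-th complex is mapped to. -/
def PowerFamily.faceMap {n d : ℕ} {b : Fin n → ℕ} {i j : PowerFamily n d b} (u : i ⟶ j) (p : ℕ)
    (F : Face i.complex p) : Face j.complex p :=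
  ⟨translate (PowerFamily.shift u) F.1,
    F.2.1.imp (fun h => by rw [h, translate, Set.image_empty]) (PowerFamily.translate_mem u),
    (faceRank_translate _ _).trans F.2.2⟩

/-- The chain map of the multiplication by `x^u`: on `S`, in degree `0`, it is the multiplication by
`x^u`; in positive degrees it sends the generator of `F` to the generator of `F + u`. -/
noncomputable def PowerFamily.chainMap (k : Type*) [Field k] {n d : ℕ} {b : Fin n → ℕ}
    {i j : PowerFamily n d b} (u : i ⟶ j) (p : ℕ) :
    Chain k i.complex p →ₗ[MvPolynomial (Fin n) k] Chain k j.complex p :=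
  (if p = 0 then mono k (PowerFamily.shift u) else 1) •
    Finsupp.lmapDomain (MvPolynomial (Fin n) k) (MvPolynomial (Fin n) k) (PowerFamily.faceMap u p)

/-! ### Representations of the family -/

/-- The `p`-th module representation `s_p` of the family. -/
noncomputable def moduleRep (k : Type*) [Field k] (n d : ℕ) (b : Fin n → ℕ) (p : ℕ) :
    CategoryTheory.Functor (PowerFamily n d b) (ModuleCat (MvPolynomial (Fin n) k)) where
  obj m := ModuleCat.of _ (Chain k m.complex p)
  map u := ModuleCat.ofHom (PowerFamily.chainMap k u p)
  map_id m := by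
    have h : PowerFamily.faceMap (CategoryTheory.CategoryStruct.id m) p = id := by
      funext F
      apply Subtype.ext
      change (fun y => y + toPt 0) '' F.1 = F.1
      have : (toPt 0 : Fin n → ℝ) = 0 := by funext i; simp [toPt]
      simp [this]
    have h' : PowerFamily.chainMap k (CategoryTheory.CategoryStruct.id m) p = LinearMap.id := by
      rw [PowerFamily.chainMap, h, Finsupp.lmapDomain_id]
      have : mono k (PowerFamily.shift (CategoryTheory.CategoryStruct.id m)) = 1 := by
        change MvPolynomial.monomial (Finsupp.equivFunOnFinite.symm 0) 1 = 1
        have h0 : (Finsupp.equivFunOnFinite.symm (0 : Fin n → ℕ)) = 0 := by ext; rfl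
        rw [h0]
        rfl
      rw [this, ite_self, one_smul]
    rw [h']
    rfl
  map_comp {i j l} u v := by
    have h : PowerFamily.faceMap (CategoryTheory.CategoryStruct.comp u v) p =
        PowerFamily.faceMap v p ∘ PowerFamily.faceMap u p := by
      funext F
      apply Subtype.ext
      change (fun y => y + toPt (PowerFamily.shift u + PowerFamily.shift v)) '' F.1 =
        (fun y => y + toPt (PowerFamily.shift v)) '' ((fun y => y + toPt (PowerFamily.shift u)) ''
          F.1)
      rw [Set.image_image]
      congr 1
      funext y i
      simp [toPt, add_assoc]
    have h' : PowerFamily.chainMap k (CategoryTheory.CategoryStruct.comp u v) p =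
        PowerFamily.chainMap k v p ∘ₗ PowerFamily.chainMap k u p := by
      rw [PowerFamily.chainMap, h, Finsupp.lmapDomain_comp, PowerFamily.chainMap,
        PowerFamily.chainMap, LinearMap.smul_comp, LinearMap.comp_smul, smul_smul]
      congr 1
      split_ifs
      · change mono k (PowerFamily.shift u + PowerFamily.shift v) = _
        rw [mul_comm, mono, mono, mono, MvPolynomial.monomial_mul, one_mul]
        congr 2
        ext
        rfl
      · simp
    rw [h']
    rfl

/-- A subrepresentation of a representation of a category over a ring. -/
structure Subrepresentation {C : Type*} [CategoryTheory.Category C] {R : Type*} [CommRing R]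
    (M : CategoryTheory.Functor C (ModuleCat R)) where
  /-- the submodules -/
  carrier : ∀ c, Submodule R (M.obj c)
  map_mem : ∀ {c c' : C} (f : c ⟶ c') (x : M.obj c), x ∈ carrier c →
    (M.map f).hom x ∈ carrier c'

/-- The representation given by a subrepresentation: the maps are the restrictions. -/
noncomputable def Subrepresentation.toRep {C : Type*} [CategoryTheory.Category C] {R : Type*}
    [CommRing R] {M : CategoryTheory.Functor C (ModuleCat R)} (N : Subrepresentation M) :
    CategoryTheory.Functor C (ModuleCat R) where
  obj c := ModuleCat.of R (N.carrier c)
  map f := ModuleCat.ofHom ((M.map f).hom.restrict (N.map_mem f))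
  map_id c := by
    ext x
    change (M.map (CategoryTheory.CategoryStruct.id c)).hom x.1 = x.1
    rw [M.map_id]
    rfl
  map_comp f g := by
    ext x
    change (M.map (CategoryTheory.CategoryStruct.comp f g)).hom x.1 = _
    rw [M.map_comp]
    rfl

/-- A representation is finitely generated if there is a finite set of elements such that the only
subrepresentation containing it is the whole representation. -/
def FinitelyGenerated {C : Type*} [CategoryTheory.Category C] {R : Type*} [CommRing R]
    (M : CategoryTheory.Functor C (ModuleCat R)) : Prop :=
  ∃ E : Set (Σ c, M.obj c), E.Finite ∧
    ∀ N : Subrepresentation M, (∀ e ∈ E, e.2 ∈ N.carrier e.1) → ∀ c, N.carrier c = ⊤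

/-- The family has finitely generated syzygies: for every `p` the `p`-th syzygy modules form a
subrepresentation `σ_p` of `s_p`, with the restrictions of the chain maps as maps, and `σ_p` is a
finitely generated representation. -/
def HasFGSyzygies (k : Type*) [Field k] (n d : ℕ) (b : Fin n → ℕ) : Prop :=
  ∀ p, ∃ σ : Subrepresentation (moduleRep k n d b p),
    (∀ m, σ.carrier m = syzygy k m.complex p) ∧ FinitelyGenerated σ.toRep

/-- The complex of `m` is covered by finitely many earlier members of the family: every one of them
has a morphism to `m`, and the images of their cells under the morphisms to `m` are exactly all the
cells of the complex of `m`. -/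
def IsCovered {n d : ℕ} {b : Fin n → ℕ} (m : PowerFamily n d b) : Prop :=
  ∃ J : Set (PowerFamily n d b), J.Finite ∧ (∀ j ∈ J, j.power < m.power ∧ Nonempty (j ⟶ m)) ∧
    ⋃ j ∈ J, ⋃ u : j ⟶ m, translate (PowerFamily.shift u) '' j.complex = m.complex

end CellFamily

/-! Every cell is the slice of a lattice cube by the hyperplane `∑ y = e`. The cube is recorded as a
pair (a, T), its lower corner and its free coordinates; either T is empty and |a| = e, or |a| < e <
|a| + |T|. In the second case the slice has dimension |T| - 1, and in both cases its label is the
upper corner of the cube (`mem_subdividedSimplex`, `faceRank_cellSet`, `label_bounded`). Labels,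
faces and signs thereby become combinatorics of cubes.

Exactness: splitting by multidegree (`exact_of_strands`) leaves, for each c, a complex over k formed
by the cells in the box [0, β ⊓ c]. In the cubical chains of this box there are two subcomplexes,
the cubes below and the cubes above the hyperplane. The box and both sides are acyclic, because
coordinates can be contracted one at a time (`exists_cubeBd_eq`), and the sides share only the
vertices on the hyperplane. Up to a shift by one, the cells of positive dimension form the quotient
of the box by the two sides. The map from edges to vertices is the Mayer-Vietoris connecting map
`cubeBd ∘ lower`, and the map from vertices to the empty face is the augmentation. The resulting
diagram chases are `exists_between_of_cycle`, `exists_between_of_edge_cycle` and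
`exists_edges_of_vertices`; `boundary_exact` carries them over to the labelled complex.

Powers and finite generation both rest on the averaging argument `exists_gen_between`: from a pair f
≤ g in the box (m + 1)b, with degrees close enough to (m + 1)d, a generator u ≤ f can be subtracted
so that g - u stays in the box mb. For f = g this identifies the powers of the ideal
(`boundedIdeal_pow`). For the two corners of a cell it shows that, once the exponent m is at least
max n 2, each cell of X_m is a translate by a generator of a cell of X_{m-1} (`exists_step`): the
degrees of the corners differ from md by less than m, as |T| ≤ n. This gives the covering. Since
boundaries commute with translations, the boundaries of the finitely many cells at exponents below
max n 2 generate the syzygies (`hasFGSyzygies`). -/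

namespace CellFamily

/-! ### Cubical chains

The cube with lower corner `a` and free coordinates `T` is the pair `(a, T)`. -/

section Cubical

variable {k : Type*} [Field k] {n : ℕ}

/-- The indicator vector of a set of coordinates. -/
def ind (T : Finset (Fin n)) : Fin n → ℕ := fun i => if i ∈ T then 1 else 0

lemma sum_ind (T : Finset (Fin n)) : ∑ i, ind T i = T.card := by
  simp [ind]

/-- A pair of a lower corner and a set of free coordinates. -/
abbrev Cube (n : ℕ) := (Fin n → ℕ) × Finset (Fin n)

/-- The upper corner of a cube. -/
def Cube.top (c : Cube n) : Fin n → ℕ := c.1 + ind c.2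

/-- The sign `(-1)^(position of i in T)`. -/
def sgn (k : Type*) [Field k] (i : Fin n) (T : Finset (Fin n)) : k :=
  (-1) ^ (T.filter fun j => j < i).card

lemma sgn_mul_self (i : Fin n) (T : Finset (Fin n)) : sgn k i T * sgn k i T = 1 := by
  rw [sgn, ← mul_pow]; simp

lemma sgn_erase_of_lt {i j : Fin n} {T : Finset (Fin n)} (hi : i ∈ T) (hij : i < j) :
    sgn k j (T.erase i) = -sgn k j T := by
  have h : i ∈ T.filter fun l => l < j := Finset.mem_filter.2 ⟨hi, hij⟩
  rw [sgn, sgn, Finset.filter_erase, ← Finset.card_erase_add_one h, pow_succ]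
  simp

lemma sgn_erase_of_le {i j : Fin n} {T : Finset (Fin n)} (hij : j ≤ i) :
    sgn k j (T.erase i) = sgn k j T := by
  rw [sgn, sgn, Finset.filter_erase, Finset.erase_eq_of_notMem]
  simp [hij]

/-- Removing the smaller index shifts the position of the larger one by one; removing the larger
index changes nothing. So exactly one sign flips, which is what makes the boundary square to zero.
-/
lemma sgn_mul_sgn_erase {i j : Fin n} {T : Finset (Fin n)} (hi : i ∈ T) (hj : j ∈ T)
    (hij : i ≠ j) :
    sgn k i T * sgn k j (T.erase i) = -(sgn k j T * sgn k i (T.erase j)) := by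
  rcases lt_or_gt_of_ne hij with h | h
  · rw [sgn_erase_of_lt hi h, sgn_erase_of_le h.le]; ring
  · rw [sgn_erase_of_lt hj h, sgn_erase_of_le h.le]; ring

lemma sgn_insert {i : Fin n} {T : Finset (Fin n)} (hi : i ∉ T) :
    sgn k i (insert i T) = sgn k i T := by
  rw [← sgn_erase_of_le (T := insert i T) (le_refl i), Finset.erase_insert hi]

/-- The exponent vector with its `i`-th coordinate increased by one. -/
def raise (i : Fin n) (a : Fin n → ℕ) : Fin n → ℕ := Function.update a i (a i + 1)

lemma sum_update (i : Fin n) (a : Fin n → ℕ) (l : ℕ) :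
    ∑ j, Function.update a i l j + a i = ∑ j, a j + l := by
  rw [Finset.sum_update_of_mem (Finset.mem_univ i), ← Finset.add_sum_erase _ a (Finset.mem_univ i),
    Finset.sdiff_singleton_eq_erase]
  ring

lemma sum_raise (i : Fin n) (a : Fin n → ℕ) : ∑ j, raise i a j = ∑ j, a j + 1 := by
  have := sum_update i a (a i + 1)
  rw [raise]; omega

lemma raise_comm (i j : Fin n) (a : Fin n → ℕ) : raise i (raise j a) = raise j (raise i a) := by
  rcases eq_or_ne i j with rfl | h
  · rfl
  · simp only [raise, Function.update_of_ne h, Function.update_of_ne h.symm]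
    rw [Function.update_comm h]

lemma raise_update {i j : Fin n} (hij : i ≠ j) (a : Fin n → ℕ) (l : ℕ) :
    raise j (Function.update a i l) = Function.update (raise j a) i l := by
  rw [raise, raise, Function.update_of_ne hij.symm, Function.update_comm hij.symm]

open Finsupp (single)

/-- The part of the cubical boundary on the facets through the lower corner. -/
noncomputable def lower (k : Type*) [Field k] (n : ℕ) : (Cube n →₀ k) →ₗ[k] (Cube n →₀ k) :=
  Finsupp.linearCombination k fun c =>
    ∑ i ∈ c.2, sgn k i c.2 • -single (c.1, c.2.erase i) (1 : k)

/-- The part of the cubical boundary on the facets through the upper corner. -/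
noncomputable def upper (k : Type*) [Field k] (n : ℕ) : (Cube n →₀ k) →ₗ[k] (Cube n →₀ k) :=
  Finsupp.linearCombination k fun c =>
    ∑ i ∈ c.2, sgn k i c.2 • single (raise i c.1, c.2.erase i) (1 : k)

/-- The cubical boundary. -/
noncomputable def cubeBd (k : Type*) [Field k] (n : ℕ) : (Cube n →₀ k) →ₗ[k] (Cube n →₀ k) :=
  upper k n + lower k n

lemma lower_single (a : Fin n → ℕ) (T : Finset (Fin n)) :
    lower k n (single (a, T) 1) = ∑ i ∈ T, sgn k i T • -single (a, T.erase i) (1 : k) := by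
  simp [lower]

lemma upper_single (a : Fin n → ℕ) (T : Finset (Fin n)) :
    upper k n (single (a, T) 1) = ∑ i ∈ T, sgn k i T • single (raise i a, T.erase i) (1 : k) := by
  simp [upper]

lemma cubeBd_single (a : Fin n → ℕ) (T : Finset (Fin n)) :
    cubeBd k n (single (a, T) 1) = ∑ i ∈ T, sgn k i T •
      (single (raise i a, T.erase i) (1 : k) - single (a, T.erase i) 1) := by
  rw [cubeBd, LinearMap.add_apply, lower_single, upper_single, ← Finset.sum_add_distrib]
  exact Finset.sum_congr rfl fun i _ => by rw [← smul_add, sub_eq_add_neg]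

/-- Swapping the two indices pairs off the terms without fixed points. Cancelling in pairs, rather
than showing that twice the sum vanishes, keeps characteristic 2 included. -/
lemma sum_erase_antisymm {ι M : Type*} [DecidableEq ι] [AddCommGroup M] (T : Finset ι)
    (f : ι → ι → M) (hf : ∀ i ∈ T, ∀ j ∈ T, i ≠ j → f i j = -f j i) :
    ∑ i ∈ T, ∑ j ∈ T.erase i, f i j = 0 := by
  rw [Finset.sum_sigma']
  refine Finset.sum_involution (fun x _ => ⟨x.2, x.1⟩) ?_ ?_ ?_ ?_
  · rintro ⟨i, j⟩ h
    simp only [Finset.mem_sigma, Finset.mem_erase] at h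
    rw [hf i h.1 j h.2.2 h.2.1.symm]
    simp
  · rintro ⟨i, j⟩ h _ he
    simp only [Finset.mem_sigma, Finset.mem_erase] at h
    simp only [Sigma.mk.injEq] at he
    exact h.2.1 he.1
  · rintro ⟨i, j⟩ h
    simp only [Finset.mem_sigma, Finset.mem_erase] at h ⊢
    exact ⟨h.2.2, h.2.1.symm, h.1⟩
  · rintro ⟨i, j⟩ _
    rfl

lemma cubeBd_cubeBd (Z : Cube n →₀ k) : cubeBd k n (cubeBd k n Z) = 0 := by
  suffices h : cubeBd k n ∘ₗ cubeBd k n = 0 from LinearMap.congr_fun h Z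
  refine Finsupp.lhom_ext' fun c => LinearMap.ext_ring ?_
  obtain ⟨a, T⟩ := c
  simp only [LinearMap.comp_apply, Finsupp.lsingle_apply, LinearMap.zero_apply, cubeBd_single,
    map_sum, map_smul, map_sub, Finset.smul_sum, smul_sub, ← Finset.sum_sub_distrib, smul_smul]
  refine sum_erase_antisymm T _ fun i hi j hj hij => ?_
  rw [sgn_mul_sgn_erase hi hj hij, raise_comm j i, Finset.erase_right_comm]
  simp only [neg_smul]
  abel

/-- The signed path from `v` to the `i`-th coordinate of `a`. -/
noncomputable def path (k : Type*) [Field k] (i : Fin n) (v : ℕ) (a : Fin n → ℕ)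
    (T : Finset (Fin n)) : Cube n →₀ k :=
  ∑ l ∈ Finset.Ico v (a i), single (Function.update a i l, T) 1 -
    ∑ l ∈ Finset.Ico (a i) v, single (Function.update a i l, T) 1

lemma sum_Ico_sub_sum_Ico {M : Type*} [AddCommGroup M] (f : ℕ → M) (v w : ℕ) :
    ∑ l ∈ Finset.Ico v w, f l - ∑ l ∈ Finset.Ico w v, f l =
      ∑ l ∈ Finset.range w, f l - ∑ l ∈ Finset.range v, f l := by
  rcases le_total v w with h | h
  · rw [Finset.sum_Ico_eq_sub _ h, Finset.Ico_eq_empty_of_le h]; simp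
  · rw [Finset.sum_Ico_eq_sub _ h, Finset.Ico_eq_empty_of_le h]; simp

/-- One of the two intervals in `path` is always empty. The form with ranges telescopes without
distinguishing whether `a i` lies above or below `v`. -/
lemma path_eq (i : Fin n) (v : ℕ) (a : Fin n → ℕ) (T : Finset (Fin n)) :
    path k i v a T = ∑ l ∈ Finset.range (a i), single (Function.update a i l, T) 1 -
      ∑ l ∈ Finset.range v, single (Function.update a i l, T) 1 :=
  sum_Ico_sub_sum_Ico _ _ _

lemma path_raise_sub (i : Fin n) (v : ℕ) (a : Fin n → ℕ) (T : Finset (Fin n)) :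
    path k i v (raise i a) T - path k i v a T = single (a, T) 1 := by
  simp only [path_eq, raise, Function.update_idem, Function.update_self, Finset.sum_range_succ,
    Function.update_eq_self]
  abel

/-- The contraction of the `i`-th coordinate to `v`. -/
noncomputable def contract (k : Type*) [Field k] (i : Fin n) (v : ℕ) :
    (Cube n →₀ k) →ₗ[k] (Cube n →₀ k) :=
  Finsupp.linearCombination k fun c =>
    if i ∈ c.2 then 0 else sgn k i c.2 • path k i v c.1 (insert i c.2)

/-- The projection setting the `i`-th coordinate to `v`. -/
noncomputable def squash (k : Type*) [Field k] (i : Fin n) (v : ℕ) :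
    (Cube n →₀ k) →ₗ[k] (Cube n →₀ k) :=
  Finsupp.linearCombination k fun c =>
    if i ∈ c.2 then 0 else single (Function.update c.1 i v, c.2) 1

/-- The facets in direction `i` telescope along the path to its two ends; every other free direction
contributes the difference of two parallel paths. -/
lemma cubeBd_path {i : Fin n} {T : Finset (Fin n)} (hi : i ∉ T) (v : ℕ) (a : Fin n → ℕ) :
    cubeBd k n (path k i v a (insert i T)) =
      sgn k i T • (single (a, T) 1 - single (Function.update a i v, T) 1) +
      ∑ j ∈ T, sgn k j (insert i T) • (path k i v (raise j a) (insert i (T.erase j)) -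
        path k i v a (insert i (T.erase j))) := by
  have hs : sgn k i (insert i T) = sgn k i T := sgn_insert hi
  have key : ∀ l, cubeBd k n (single (Function.update a i l, insert i T) 1) =
      sgn k i T • (single (Function.update a i (l + 1), T) (1 : k) -
        single (Function.update a i l, T) 1) +
      ∑ j ∈ T, sgn k j (insert i T) •
        (single (Function.update (raise j a) i l, insert i (T.erase j)) (1 : k) -
        single (Function.update a i l, insert i (T.erase j)) 1) := by
    intro l
    rw [cubeBd_single, Finset.sum_insert hi, Finset.erase_insert hi, hs]
    congr 1
    · simp [raise]
    · refine Finset.sum_congr rfl fun j hj => ?_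
      have hij : i ≠ j := fun h => hi (h ▸ hj)
      rw [raise_update hij, Finset.erase_insert_of_ne hij]
  have hj : ∀ j ∈ T, raise j a i = a i := fun j hj =>
    Function.update_of_ne (fun h : i = j => hi (h ▸ hj)) _ _
  have hsum : ∀ m, cubeBd k n
      (∑ l ∈ Finset.range m, single (Function.update a i l, insert i T) 1) =
      sgn k i T • (single (Function.update a i m, T) (1 : k) -
        single (Function.update a i 0, T) 1) +
      ∑ j ∈ T, sgn k j (insert i T) •
        (∑ l ∈ Finset.range m, single (Function.update (raise j a) i l, insert i (T.erase j)) 1 -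
        ∑ l ∈ Finset.range m, single (Function.update a i l, insert i (T.erase j)) (1 : k)) := by
    intro m
    rw [map_sum, Finset.sum_congr rfl fun l _ => key l, Finset.sum_add_distrib, ← Finset.smul_sum,
      Finset.sum_range_sub (fun l => single (Function.update a i l, T) (1 : k)), Finset.sum_comm]
    simp only [← Finset.smul_sum, Finset.sum_sub_distrib]
  rw [path_eq, map_sub, hsum, hsum, Function.update_eq_self, add_sub_add_comm, ← smul_sub,
    ← Finset.sum_sub_distrib]
  congr 1
  · congr 1; abel
  · refine Finset.sum_congr rfl fun j hjT => ?_
    rw [path_eq, path_eq, hj j hjT, ← smul_sub]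
    congr 1
    abel

/-- `contract` is a chain homotopy from the identity to `squash`. If `i` is free in a cube, only its
two facets in direction `i` survive contraction, and the difference of their paths is the cube
itself. If `i` is fixed, the ends of the path give the cube minus its projection, and the terms in
the other directions cancel by the sign rule. -/
lemma cubeBd_contract (i : Fin n) (v : ℕ) (Z : Cube n →₀ k) :
    cubeBd k n (contract k i v Z) + contract k i v (cubeBd k n Z) = Z - squash k i v Z := by
  suffices h : cubeBd k n ∘ₗ contract k i v + contract k i v ∘ₗ cubeBd k n =
      LinearMap.id - squash k i v from LinearMap.congr_fun h Z
  refine Finsupp.lhom_ext' fun c => LinearMap.ext_ring ?_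
  obtain ⟨a, T⟩ := c
  simp only [LinearMap.comp_apply, Finsupp.lsingle_apply, LinearMap.add_apply,
    LinearMap.sub_apply, LinearMap.id_apply, cubeBd_single, map_sum, map_smul, map_sub]
  by_cases hi : i ∈ T
  · rw [Finset.sum_eq_single_of_mem i hi]
    · simp only [contract, squash, Finsupp.linearCombination_single, hi, Finset.notMem_erase,
        if_true, if_false, one_smul, map_zero, zero_add, sub_zero, ← smul_sub, path_raise_sub,
        Finset.insert_erase hi, smul_smul, sgn_erase_of_le le_rfl, one_mul, sgn_mul_self]
    · intro j _ hji
      have : i ∈ T.erase j := Finset.mem_erase.2 ⟨hji.symm, hi⟩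
      simp [contract, this]
  · simp only [contract, squash, Finsupp.linearCombination_single, hi, if_false, one_smul, map_smul,
      cubeBd_path hi, Finset.mem_erase, and_false, smul_add, smul_smul, one_mul, sgn_mul_self, one_smul]
    rw [add_assoc, add_eq_left, Finset.smul_sum, ← Finset.sum_add_distrib]
    refine Finset.sum_eq_zero fun j hj => ?_
    have hij : i ≠ j := fun h => hi (h ▸ hj)
    have h' : sgn k i T * sgn k j (insert i T) = -(sgn k j T * sgn k i (T.erase j)) := by
      have hT := Finset.erase_insert hi
      rcases lt_or_gt_of_ne hij with hlt | hlt
      · have h := sgn_erase_of_lt (k := k) (Finset.mem_insert_self i T) hlt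
        rw [hT] at h
        rw [sgn_erase_of_le hlt.le, h]
        ring
      · have h := sgn_erase_of_le (k := k) (T := insert i T) hlt.le
        rw [hT] at h
        rw [sgn_erase_of_lt hj hlt, h]
        ring
    rw [smul_smul, h', ← smul_sub, smul_smul, ← add_smul, neg_add_cancel, zero_smul]

lemma mem_supported_of_single {f : (Cube n →₀ k) →ₗ[k] (Cube n →₀ k)} {S S' : Set (Cube n)}
    (h : ∀ c ∈ S, f (single c 1) ∈ Finsupp.supported k k S') {Z : Cube n →₀ k}
    (hZ : Z ∈ Finsupp.supported k k S) : f Z ∈ Finsupp.supported k k S' := by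
  rw [Finsupp.supported_eq_span_single] at hZ
  refine (Submodule.span_le (p := (Finsupp.supported k k S').comap f)).2 ?_ hZ
  rintro _ ⟨c, hc, rfl⟩
  exact h c hc

lemma lower_mem_supported {S S' : Set (Cube n)}
    (h : ∀ a T i, (a, T) ∈ S → i ∈ T → (a, T.erase i) ∈ S')
    {Z : Cube n →₀ k} (hZ : Z ∈ Finsupp.supported k k S) :
    lower k n Z ∈ Finsupp.supported k k S' := by
  refine mem_supported_of_single ?_ hZ
  rintro ⟨a, T⟩ hc
  rw [lower_single]
  exact sum_mem fun i hi => Submodule.smul_mem _ _ <| neg_mem <|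
    Finsupp.single_mem_supported k _ (h a T i hc hi)

lemma upper_mem_supported {S S' : Set (Cube n)}
    (h : ∀ a T i, (a, T) ∈ S → i ∈ T → (raise i a, T.erase i) ∈ S')
    {Z : Cube n →₀ k} (hZ : Z ∈ Finsupp.supported k k S) :
    upper k n Z ∈ Finsupp.supported k k S' := by
  refine mem_supported_of_single ?_ hZ
  rintro ⟨a, T⟩ hc
  rw [upper_single]
  exact sum_mem fun i hi => Submodule.smul_mem _ _ <|
    Finsupp.single_mem_supported k _ (h a T i hc hi)

lemma cubeBd_mem_supported {S S' : Set (Cube n)}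
    (h : ∀ a T i, (a, T) ∈ S → i ∈ T → (a, T.erase i) ∈ S' ∧ (raise i a, T.erase i) ∈ S')
    {Z : Cube n →₀ k} (hZ : Z ∈ Finsupp.supported k k S) :
    cubeBd k n Z ∈ Finsupp.supported k k S' :=
  add_mem (upper_mem_supported (fun a T i hc hi => (h a T i hc hi).2) hZ)
    (lower_mem_supported (fun a T i hc hi => (h a T i hc hi).1) hZ)

/-- The sum of the coefficients. -/
noncomputable def augmentation (k : Type*) [Field k] (n : ℕ) : (Cube n →₀ k) →ₗ[k] k :=
  Finsupp.linearCombination k fun _ => 1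

lemma augmentation_single (c : Cube n) : augmentation k n (single c 1) = 1 := by
  simp [augmentation]

lemma augmentation_cubeBd (Z : Cube n →₀ k) : augmentation k n (cubeBd k n Z) = 0 := by
  suffices h : augmentation k n ∘ₗ cubeBd k n = 0 from LinearMap.congr_fun h Z
  refine Finsupp.lhom_ext' fun c => LinearMap.ext_ring ?_
  obtain ⟨a, T⟩ := c
  simp only [LinearMap.comp_apply, Finsupp.lsingle_apply, cubeBd_single, map_sum, map_smul,
    map_sub, augmentation_single, sub_self, smul_zero, Finset.sum_const_zero,
    LinearMap.zero_apply]

/-- A set of cubes that is closed under moving coordinates towards the point `v` is acyclic. -/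
theorem exists_cubeBd_eq (v : Fin n → ℕ) (S : Set (Cube n))
    (hpath : ∀ a T i, (a, T) ∈ S → i ∉ T → ∀ l, v i ≤ l ∧ l < a i ∨ a i ≤ l ∧ l < v i →
      (Function.update a i l, insert i T) ∈ S)
    (hsquash : ∀ a T i, (a, T) ∈ S → i ∉ T → (Function.update a i (v i), T) ∈ S)
    (t : ℕ) {Z : Cube n →₀ k} (hZ : Z ∈ Finsupp.supported k k (S ∩ {c | c.2.card = t}))
    (hD : cubeBd k n Z = 0) (haug : t = 0 → augmentation k n Z = 0) :
    ∃ W ∈ Finsupp.supported k k (S ∩ {c | c.2.card = t + 1}), cubeBd k n W = Z := by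
  -- Coordinates are contracted one after the other: `W` accumulates the homotopies, and the
  -- remainder is constant, equal to `v`, in the coordinates of `s`.
  have key : ∀ s : Finset (Fin n), ∃ W ∈ Finsupp.supported k k (S ∩ {c | c.2.card = t + 1}),
      Z - cubeBd k n W ∈ Finsupp.supported k k
        ((S ∩ {c | c.2.card = t}) ∩ {c | ∀ i ∈ s, i ∉ c.2 ∧ c.1 i = v i}) := by
    intro s
    induction s using Finset.induction with
    | empty => exact ⟨0, zero_mem _, by simpa using hZ⟩
    | insert i s _ ih =>
      obtain ⟨W, hW, hW'⟩ := ih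
      refine ⟨W + contract k i (v i) (Z - cubeBd k n W), add_mem hW ?_, ?_⟩
      · refine mem_supported_of_single ?_ hW'
        rintro ⟨a, T⟩ ⟨⟨haS, haT⟩, -⟩
        simp only [contract, Finsupp.linearCombination_single, one_smul]
        split_ifs with hi
        · exact zero_mem _
        · have hcard : (insert i T).card = t + 1 := by
            rw [Finset.card_insert_of_notMem hi]; exact congrArg (· + 1) haT
          refine Submodule.smul_mem _ _ (sub_mem ?_ ?_)
          · exact sum_mem fun l hl => Finsupp.single_mem_supported k _
              ⟨hpath a T i haS hi l (Or.inl (Finset.mem_Ico.1 hl)), hcard⟩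
          · exact sum_mem fun l hl => Finsupp.single_mem_supported k _
              ⟨hpath a T i haS hi l (Or.inr (Finset.mem_Ico.1 hl)), hcard⟩
      -- The remainder is again a cycle, so the homotopy formula shows that the new remainder is its
      -- projection under `squash`.
      · have h := cubeBd_contract i (v i) (Z - cubeBd k n W)
        rw [map_sub (cubeBd k n), hD, cubeBd_cubeBd, sub_zero, map_zero, add_zero] at h
        rw [map_add, ← sub_sub, h, sub_sub_cancel]
        refine mem_supported_of_single ?_ hW'
        rintro ⟨a, T⟩ ⟨⟨haS, haT⟩, has⟩
        simp only [squash, Finsupp.linearCombination_single, one_smul]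
        split_ifs with hi
        · exact zero_mem _
        · refine Finsupp.single_mem_supported k _ ⟨⟨hsquash a T i haS hi, haT⟩, fun j hj => ?_⟩
          rcases eq_or_ne j i with rfl | hji
          · exact ⟨hi, Function.update_self _ _ _⟩
          · obtain ⟨h1, h2⟩ := has j (Finset.mem_of_mem_insert_of_ne hj hji)
            exact ⟨h1, (Function.update_of_ne hji _ _).trans h2⟩
  obtain ⟨W, hW, hW'⟩ := key Finset.univ
  refine ⟨W, hW, (sub_eq_zero.1 ?_).symm⟩
  -- After all contractions only the vertex `v` can carry a coefficient. For `t > 0` it has the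
  -- wrong dimension; for `t = 0` the coefficient is the augmentation.
  have hsub : (S ∩ {c : Cube n | c.2.card = t}) ∩
      {c | ∀ i ∈ Finset.univ, i ∉ c.2 ∧ c.1 i = v i} ⊆ {c | c = (v, ∅) ∧ t = 0} := by
    rintro ⟨a, T⟩ ⟨⟨-, haT⟩, hv⟩
    have hT : T = ∅ := Finset.eq_empty_of_forall_notMem fun i => (hv i (Finset.mem_univ i)).1
    have ha : a = v := funext fun i => (hv i (Finset.mem_univ i)).2
    subst hT ha
    exact ⟨rfl, haT.symm⟩
  have hW'' := Finsupp.supported_mono hsub hW'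
  rcases Nat.eq_zero_or_pos t with ht | ht
  · have hW3 : Z - cubeBd k n W ∈ Finsupp.supported k k {((v, ∅) : Cube n)} :=
      Finsupp.supported_mono (fun c hc => hc.1) hW''
    have h1 : Z - cubeBd k n W = single (v, ∅) ((Z - cubeBd k n W) (v, ∅)) := by
      rw [Finsupp.mem_supported] at hW3
      exact Finsupp.support_subset_singleton.1 (by exact_mod_cast hW3)
    have h2 : augmentation k n (Z - cubeBd k n W) = 0 := by
      rw [map_sub, haug ht, augmentation_cubeBd, sub_zero]
    rw [h1] at h2
    have h3 : (Z - cubeBd k n W) (v, ∅) = 0 := by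
      simpa [augmentation] using h2
    rw [h1, h3, Finsupp.single_zero]
  · have : {c : Cube n | c = (v, ∅) ∧ t = 0} = ∅ := by
      ext c; simp [ht.ne']
    rw [this, Finsupp.supported_empty] at hW''
    exact hW''

end Cubical

/-! ### Acyclicity of a slice of a box, by Mayer-Vietoris for its two sides -/

section Slices

open Finsupp (single)

variable {k : Type*} [Field k] {n : ℕ}

/-- The cubes in the box `[0, c]`. -/
def box (c : Fin n → ℕ) : Set (Cube n) := {x | x.top ≤ c}

/-- The cubes in the box `[0, c]` below the hyperplane `∑ y = e`. -/
def below (e : ℕ) (c : Fin n → ℕ) : Set (Cube n) := {x | x.top ≤ c ∧ ∑ i, x.1 i + x.2.card ≤ e}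

/-- The cubes in the box `[0, c]` above the hyperplane `∑ y = e`. -/
def above (e : ℕ) (c : Fin n → ℕ) : Set (Cube n) := {x | x.top ≤ c ∧ e ≤ ∑ i, x.1 i}

/-- The cubes in the box `[0, c]` whose interior meets the hyperplane `∑ y = e`. -/
def between (e : ℕ) (c : Fin n → ℕ) : Set (Cube n) :=
  {x | x.top ≤ c ∧ ∑ i, x.1 i < e ∧ e < ∑ i, x.1 i + x.2.card}

/-- The cubes with `t` free coordinates. -/
def ofDim (n t : ℕ) : Set (Cube n) := {x | x.2.card = t}

lemma top_update_insert_le {a c : Fin n → ℕ} {T : Finset (Fin n)} {i : Fin n} {l : ℕ}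
    (h : Cube.top (a, T) ≤ c) (hl : l < c i) :
    Cube.top (Function.update a i l, insert i T) ≤ c := by
  intro j
  rcases eq_or_ne j i with rfl | hj
  · simp [Cube.top, ind]; omega
  · simpa [Cube.top, ind, hj] using h j

lemma top_update_le {a c : Fin n → ℕ} {T : Finset (Fin n)} {i : Fin n} {l : ℕ}
    (h : Cube.top (a, T) ≤ c) (hi : i ∉ T) (hl : l ≤ c i) :
    Cube.top (Function.update a i l, T) ≤ c := by
  intro j
  rcases eq_or_ne j i with rfl | hj
  · simpa [Cube.top, ind, hi] using hl
  · simpa [Cube.top, ind, hj] using h j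

lemma top_erase_le (a : Fin n → ℕ) (T : Finset (Fin n)) (i : Fin n) :
    Cube.top (a, T.erase i) ≤ Cube.top (a, T) := by
  intro j
  simp only [Cube.top, ind, Pi.add_apply, Finset.mem_erase]
  split_ifs <;> simp_all

lemma top_raise_erase {a : Fin n → ℕ} {T : Finset (Fin n)} {i : Fin n} (hi : i ∈ T) :
    Cube.top (raise i a, T.erase i) = Cube.top (a, T) := by
  funext j
  rcases eq_or_ne j i with rfl | hj
  · simp [Cube.top, ind, raise, hi]
  · simp [Cube.top, ind, raise, hj]

lemma le_of_top_le {a c : Fin n → ℕ} {T : Finset (Fin n)} (h : Cube.top (a, T) ≤ c)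
    (i : Fin n) : a i ≤ c i :=
  le_trans (Nat.le_add_right _ _) (h i)

lemma exists_cubeBd_eq_box (c : Fin n → ℕ) (t : ℕ) {Z : Cube n →₀ k}
    (hZ : Z ∈ Finsupp.supported k k (box c ∩ ofDim n t))
    (hD : cubeBd k n Z = 0) (haug : t = 0 → augmentation k n Z = 0) :
    ∃ W ∈ Finsupp.supported k k (box c ∩ ofDim n (t + 1)), cubeBd k n W = Z := by
  refine exists_cubeBd_eq 0 (box c) ?_ ?_ t hZ hD haug
  · intro a T i ha hi l hl
    refine top_update_insert_le ha ?_
    have : a i ≤ c i := le_of_top_le ha i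
    simp only [Pi.zero_apply] at hl
    omega
  · intro a T i ha hi
    exact top_update_le ha hi (Nat.zero_le _)

lemma exists_cubeBd_eq_below (e : ℕ) (c : Fin n → ℕ) (t : ℕ) {Z : Cube n →₀ k}
    (hZ : Z ∈ Finsupp.supported k k (below e c ∩ ofDim n t))
    (hD : cubeBd k n Z = 0) (haug : t = 0 → augmentation k n Z = 0) :
    ∃ W ∈ Finsupp.supported k k (below e c ∩ ofDim n (t + 1)), cubeBd k n W = Z := by
  refine exists_cubeBd_eq 0 (below e c) ?_ ?_ t hZ hD haug
  · intro a T i ha hi l hl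
    simp only [Pi.zero_apply] at hl
    refine ⟨top_update_insert_le ha.1 ?_, ?_⟩
    · have : a i ≤ c i := le_of_top_le ha.1 i
      omega
    · have h1 := ha.2
      have h2 := sum_update i a l
      simp only [Finset.card_insert_of_notMem hi] at h1 ⊢
      omega
  · intro a T i ha hi
    refine ⟨top_update_le ha.1 hi (Nat.zero_le _), ?_⟩
    have h1 := ha.2
    have h2 := sum_update i a 0
    simp only [Pi.zero_apply] at h1 ⊢
    omega

/-- The contraction goes to the upper corner `c`, since only raising coordinates keeps cubes above
the hyperplane. The box and the lower side contract to the origin. -/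
lemma exists_cubeBd_eq_above (e : ℕ) (c : Fin n → ℕ) (t : ℕ) {Z : Cube n →₀ k}
    (hZ : Z ∈ Finsupp.supported k k (above e c ∩ ofDim n t))
    (hD : cubeBd k n Z = 0) (haug : t = 0 → augmentation k n Z = 0) :
    ∃ W ∈ Finsupp.supported k k (above e c ∩ ofDim n (t + 1)), cubeBd k n W = Z := by
  refine exists_cubeBd_eq c (above e c) ?_ ?_ t hZ hD haug
  · intro a T i ha hi l hl
    have h0 : a i ≤ c i := le_of_top_le ha.1 i
    refine ⟨top_update_insert_le ha.1 (by omega), ?_⟩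
    have h1 : e ≤ ∑ j, a j := ha.2
    have h2 := sum_update i a l
    change e ≤ ∑ j, Function.update a i l j
    omega
  · intro a T i ha hi
    refine ⟨top_update_le ha.1 hi le_rfl, ?_⟩
    have h0 : a i ≤ c i := le_of_top_le ha.1 i
    have h1 : e ≤ ∑ j, a j := ha.2
    have h2 := sum_update i a (c i)
    change e ≤ ∑ j, Function.update a i (c i) j
    omega

lemma card_erase_of_mem_ofDim {a : Fin n → ℕ} {T : Finset (Fin n)} {t : ℕ} {i : Fin n}
    (h : (a, T) ∈ ofDim n (t + 1)) (hi : i ∈ T) : (T.erase i).card = t := by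
  have : T.card = t + 1 := h
  rw [Finset.card_erase_of_mem hi]; omega

lemma cubeBd_mem_box {c : Fin n → ℕ} {t : ℕ} {Z : Cube n →₀ k}
    (hZ : Z ∈ Finsupp.supported k k (box c ∩ ofDim n (t + 1))) :
    cubeBd k n Z ∈ Finsupp.supported k k (box c ∩ ofDim n t) := by
  refine cubeBd_mem_supported (fun a T i h hi => ?_) hZ
  have hc := card_erase_of_mem_ofDim h.2 hi
  exact ⟨⟨(top_erase_le a T i).trans h.1, hc⟩, ⟨(top_raise_erase hi).trans_le h.1, hc⟩⟩

lemma cubeBd_mem_below {e : ℕ} {c : Fin n → ℕ} {t : ℕ} {Z : Cube n →₀ k}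
    (hZ : Z ∈ Finsupp.supported k k (below e c ∩ ofDim n (t + 1))) :
    cubeBd k n Z ∈ Finsupp.supported k k (below e c ∩ ofDim n t) := by
  refine cubeBd_mem_supported (fun a T i h hi => ?_) hZ
  have hc := card_erase_of_mem_ofDim h.2 hi
  have hT : T.card = t + 1 := h.2
  have h1 := h.1.2
  have h2 := sum_raise i a
  simp only at h1
  exact ⟨⟨⟨(top_erase_le a T i).trans h.1.1, by simp only; omega⟩, hc⟩,
    ⟨⟨(top_raise_erase hi).trans_le h.1.1, by simp only; omega⟩, hc⟩⟩

lemma cubeBd_mem_above {e : ℕ} {c : Fin n → ℕ} {t : ℕ} {Z : Cube n →₀ k}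
    (hZ : Z ∈ Finsupp.supported k k (above e c ∩ ofDim n (t + 1))) :
    cubeBd k n Z ∈ Finsupp.supported k k (above e c ∩ ofDim n t) := by
  refine cubeBd_mem_supported (fun a T i h hi => ?_) hZ
  have hc := card_erase_of_mem_ofDim h.2 hi
  have h1 := h.1.2
  have h2 := sum_raise i a
  simp only at h1
  exact ⟨⟨⟨(top_erase_le a T i).trans h.1.1, by simp only; omega⟩, hc⟩,
    ⟨⟨(top_raise_erase hi).trans_le h.1.1, by simp only; omega⟩, hc⟩⟩

lemma box_eq (e : ℕ) (c : Fin n → ℕ) : box c = between e c ∪ (below e c ∪ above e c) := by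
  ext x
  simp only [box, between, below, above, Set.mem_union, Set.mem_ofPred_eq, ← and_or_left]
  rw [and_iff_left]
  omega

lemma mem_box_of_between {e : ℕ} {c : Fin n → ℕ} {t : ℕ} {Z : Cube n →₀ k}
    (hZ : Z ∈ Finsupp.supported k k (between e c ∩ ofDim n t)) :
    Z ∈ Finsupp.supported k k (box c ∩ ofDim n t) :=
  Finsupp.supported_mono (Set.inter_subset_inter_left _ fun _ hx => hx.1) hZ

lemma mem_box_of_below {e : ℕ} {c : Fin n → ℕ} {t : ℕ} {Z : Cube n →₀ k}
    (hZ : Z ∈ Finsupp.supported k k (below e c ∩ ofDim n t)) :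
    Z ∈ Finsupp.supported k k (box c ∩ ofDim n t) :=
  Finsupp.supported_mono (Set.inter_subset_inter_left _ fun _ hx => hx.1) hZ

lemma mem_box_of_above {e : ℕ} {c : Fin n → ℕ} {t : ℕ} {Z : Cube n →₀ k}
    (hZ : Z ∈ Finsupp.supported k k (above e c ∩ ofDim n t)) :
    Z ∈ Finsupp.supported k k (box c ∩ ofDim n t) :=
  Finsupp.supported_mono (Set.inter_subset_inter_left _ fun _ hx => hx.1) hZ

lemma exists_decomposition (e : ℕ) {c : Fin n → ℕ} {t : ℕ} {Z : Cube n →₀ k}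
    (hZ : Z ∈ Finsupp.supported k k (box c ∩ ofDim n t)) :
    ∃ M ∈ Finsupp.supported k k (between e c ∩ ofDim n t),
    ∃ A ∈ Finsupp.supported k k (below e c ∩ ofDim n t),
    ∃ B ∈ Finsupp.supported k k (above e c ∩ ofDim n t), Z = M + A + B := by
  rw [box_eq e, Set.union_inter_distrib_right, Set.union_inter_distrib_right,
    Finsupp.supported_union, Finsupp.supported_union] at hZ
  obtain ⟨M, hM, Y, hY, rfl⟩ := Submodule.mem_sup.1 hZ
  obtain ⟨A, hA, B, hB, rfl⟩ := Submodule.mem_sup.1 hY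
  exact ⟨M, hM, A, hA, B, hB, (add_assoc _ _ _).symm⟩

lemma eq_zero_of_mem_supported {S : Set (Cube n)} {Z : Cube n →₀ k} {x : Cube n}
    (hZ : Z ∈ Finsupp.supported k k S) (hx : x ∉ S) : Z x = 0 :=
  Finsupp.notMem_support_iff.1 fun h => hx ((Finsupp.mem_supported k Z).1 hZ h)

/-- A cube (a, T) on both sides satisfies |a| + |T| ≤ e ≤ |a|, so it is a vertex; here the dimension
is positive. -/
lemma eq_zero_of_below_of_above {e : ℕ} {c : Fin n → ℕ} {t : ℕ} {Z : Cube n →₀ k}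
    (hA : Z ∈ Finsupp.supported k k (below e c ∩ ofDim n (t + 1)))
    (hB : Z ∈ Finsupp.supported k k (above e c ∩ ofDim n (t + 1))) : Z = 0 := by
  ext x
  by_cases hx : x ∈ below e c ∩ ofDim n (t + 1)
  · refine eq_zero_of_mem_supported hB fun hx' => ?_
    have h1 := hx.1.2
    have h2 := hx'.1.2
    have h3 : x.2.card = t + 1 := hx.2
    omega
  · exact eq_zero_of_mem_supported hA hx

lemma below_disjoint_between {e : ℕ} {c c' : Fin n → ℕ} {x : Cube n} (hx : x ∈ between e c) :
    x ∉ below e c' := fun h => by have := h.2; have := hx.2; omega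

lemma above_disjoint_between {e : ℕ} {c c' : Fin n → ℕ} {x : Cube n} (hx : x ∈ between e c) :
    x ∉ above e c' := fun h => by have := h.2; have := hx.2; omega

/-- A square cut by the hyperplane has |a| = e - 1. Hence its edges through the lower corner end on
the hyperplane, and the other two start there. This clean separation is special to dimension 2. -/
lemma lower_mem_below {e : ℕ} {c : Fin n → ℕ} {Z : Cube n →₀ k}
    (hZ : Z ∈ Finsupp.supported k k (between e c ∩ ofDim n 2)) :
    lower k n Z ∈ Finsupp.supported k k (below e c ∩ ofDim n 1) := by
  refine lower_mem_supported (fun a T i h hi => ?_) hZ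
  have hc := card_erase_of_mem_ofDim h.2 hi
  have h1 := h.1.2
  simp only at h1
  exact ⟨⟨(top_erase_le a T i).trans h.1.1, by simp only; omega⟩, hc⟩

lemma upper_mem_above {e : ℕ} {c : Fin n → ℕ} {Z : Cube n →₀ k}
    (hZ : Z ∈ Finsupp.supported k k (between e c ∩ ofDim n 2)) :
    upper k n Z ∈ Finsupp.supported k k (above e c ∩ ofDim n 1) := by
  refine upper_mem_supported (fun a T i h hi => ?_) hZ
  have hc := card_erase_of_mem_ofDim h.2 hi
  have hT : T.card = 2 := h.2
  have h1 := h.1.2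
  have h2 := sum_raise i a
  simp only at h1
  exact ⟨⟨(top_raise_erase hi).trans_le h.1.1, by simp only; omega⟩, hc⟩

/-- If the cubical boundary of a chain of cubes that meet the hyperplane splits into two cycles
below and above it, then the chain is a boundary modulo cubes that do not meet the hyperplane. -/
theorem exists_between_of_split {e : ℕ} {c : Fin n → ℕ} {t : ℕ} {Z A B : Cube n →₀ k}
    (hZ : Z ∈ Finsupp.supported k k (between e c ∩ ofDim n (t + 2)))
    (hA : A ∈ Finsupp.supported k k (below e c ∩ ofDim n (t + 1)))
    (hB : B ∈ Finsupp.supported k k (above e c ∩ ofDim n (t + 1)))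
    (h : cubeBd k n Z = A + B) (hA0 : cubeBd k n A = 0) :
    ∃ W ∈ Finsupp.supported k k (between e c ∩ ofDim n (t + 3)),
      ∀ x ∈ between e c, cubeBd k n W x = Z x := by
  have hB0 : cubeBd k n B = 0 := by
    have := cubeBd_cubeBd Z
    rwa [h, map_add, hA0, zero_add] at this
  obtain ⟨A', hA', hA''⟩ := exists_cubeBd_eq_below e c (t + 1) hA hA0 (by simp)
  obtain ⟨B', hB', hB''⟩ := exists_cubeBd_eq_above e c (t + 1) hB hB0 (by simp)
  -- Capping off the boundary of `Z` on both sides produces a cycle of the box. The caps, and the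
  -- parts of its filling that lie on one side, are invisible on `between`.
  have hbox : Z - A' - B' ∈ Finsupp.supported k k (box c ∩ ofDim n (t + 2)) := by
    exact sub_mem (sub_mem (mem_box_of_between hZ) (mem_box_of_below hA')) (mem_box_of_above hB')
  obtain ⟨V, hV, hV'⟩ := exists_cubeBd_eq_box c (t + 2) hbox
    (by rw [map_sub, map_sub, h, hA'', hB'']; abel) (by simp)
  obtain ⟨W, hW, A₁, hA₁, B₁, hB₁, rfl⟩ := exists_decomposition e hV
  refine ⟨W, hW, fun x hx => ?_⟩
  have h1 := eq_zero_of_mem_supported hA' fun h => below_disjoint_between hx h.1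
  have h2 := eq_zero_of_mem_supported hB' fun h => above_disjoint_between hx h.1
  have h3 := eq_zero_of_mem_supported (cubeBd_mem_below hA₁) fun h => below_disjoint_between hx h.1
  have h4 := eq_zero_of_mem_supported (cubeBd_mem_above hB₁) fun h => above_disjoint_between hx h.1
  have h5 := DFunLike.congr_fun hV' x
  simpa [h1, h2, h3, h4] using h5

/-- The boundary of `Z` is a sum A + B of chains on the two sides. As ∂A = -∂B lies on both sides
and has positive dimension, it vanishes, so the boundary splits into cycles. -/
theorem exists_between_of_cycle {e : ℕ} {c : Fin n → ℕ} {t : ℕ} {Z : Cube n →₀ k}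
    (hZ : Z ∈ Finsupp.supported k k (between e c ∩ ofDim n (t + 3)))
    (h : ∀ x ∈ between e c ∩ ofDim n (t + 2), cubeBd k n Z x = 0) :
    ∃ W ∈ Finsupp.supported k k (between e c ∩ ofDim n (t + 4)),
      ∀ x ∈ between e c, cubeBd k n W x = Z x := by
  have hbox : cubeBd k n Z ∈ Finsupp.supported k k (box c ∩ ofDim n (t + 2)) :=
    cubeBd_mem_box (mem_box_of_between hZ)
  obtain ⟨M, hM, A, hA, B, hB, hMAB⟩ := exists_decomposition e hbox
  have hM0 : M = 0 := by
    ext x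
    by_cases hx : x ∈ between e c ∩ ofDim n (t + 2)
    · have h1 := h x hx
      rw [hMAB, Finsupp.add_apply, Finsupp.add_apply,
        eq_zero_of_mem_supported hA fun h => below_disjoint_between hx.1 h.1,
        eq_zero_of_mem_supported hB fun h => above_disjoint_between hx.1 h.1] at h1
      simpa using h1
    · exact eq_zero_of_mem_supported hM hx
  rw [hM0, zero_add] at hMAB
  refine exists_between_of_split hZ hA hB hMAB (eq_zero_of_below_of_above (cubeBd_mem_below hA)
    (?_ : _ ∈ Finsupp.supported k k (above e c ∩ ofDim n (t + 1))))
  have h2 := cubeBd_cubeBd Z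
  rw [hMAB, map_add] at h2
  rw [eq_neg_of_add_eq_zero_left h2]
  exact neg_mem (cubeBd_mem_above hB)

theorem exists_between_of_edge_cycle {e : ℕ} {c : Fin n → ℕ} {Z : Cube n →₀ k}
    (hZ : Z ∈ Finsupp.supported k k (between e c ∩ ofDim n 2))
    (h : cubeBd k n (lower k n Z) = 0) :
    ∃ W ∈ Finsupp.supported k k (between e c ∩ ofDim n 3),
      ∀ x ∈ between e c, cubeBd k n W x = Z x :=
  exists_between_of_split hZ (lower_mem_below hZ) (upper_mem_above hZ) (add_comm _ _) h

/-- Exactness at the vertices: `Z` bounds a chain A below and a chain B above, and the cycle A - B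
bounds in the box. The squares W of that filling which meet the hyperplane satisfy lower W = A -
∂A₁, because the difference of the two chains lies on both sides. -/
theorem exists_edges_of_vertices {e : ℕ} {c : Fin n → ℕ} {Z : Cube n →₀ k}
    (hZ : Z ∈ Finsupp.supported k k (below e c ∩ above e c ∩ ofDim n 0))
    (h : augmentation k n Z = 0) :
    ∃ W ∈ Finsupp.supported k k (between e c ∩ ofDim n 2), cubeBd k n (lower k n W) = Z := by
  have hZA : Z ∈ Finsupp.supported k k (below e c ∩ ofDim n 0) :=
    Finsupp.supported_mono (Set.inter_subset_inter_left _ Set.inter_subset_left) hZ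
  have hZB : Z ∈ Finsupp.supported k k (above e c ∩ ofDim n 0) :=
    Finsupp.supported_mono (Set.inter_subset_inter_left _ Set.inter_subset_right) hZ
  have hZ0 : cubeBd k n Z = 0 := by
    have : cubeBd k n Z ∈ Finsupp.supported k k (∅ : Set (Cube n)) :=
      cubeBd_mem_supported (fun a T i h hi => absurd (Finset.card_eq_zero.1 h.2)
        (Finset.ne_empty_of_mem hi)) hZ
    rw [Finsupp.supported_empty] at this
    exact this
  obtain ⟨A, hA, hA'⟩ := exists_cubeBd_eq_below e c 0 hZA hZ0 fun _ => h
  obtain ⟨B, hB, hB'⟩ := exists_cubeBd_eq_above e c 0 hZB hZ0 fun _ => h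
  have hbox : A - B ∈ Finsupp.supported k k (box c ∩ ofDim n 1) := by
    exact sub_mem (mem_box_of_below hA) (mem_box_of_above hB)
  obtain ⟨V, hV, hV'⟩ := exists_cubeBd_eq_box c 1 hbox (by rw [map_sub, hA', hB', sub_self])
    (by simp)
  obtain ⟨W, hW, A₁, hA₁, B₁, hB₁, rfl⟩ := exists_decomposition e hV
  refine ⟨W, hW, ?_⟩
  have h0 : lower k n W - (A - cubeBd k n A₁) = 0 := by
    refine eq_zero_of_below_of_above (t := 0) (e := e) (c := c)
      (sub_mem (lower_mem_below hW) (sub_mem hA (cubeBd_mem_below hA₁))) ?_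
    have : lower k n W - (A - cubeBd k n A₁) = -(upper k n W) - B - cubeBd k n B₁ := by
      rw [map_add, map_add, cubeBd, LinearMap.add_apply (upper k n) _ W, ← cubeBd] at hV'
      rw [← sub_eq_zero] at hV' ⊢
      rw [← hV']
      abel
    rw [this]
    exact sub_mem (sub_mem (neg_mem (upper_mem_above hW)) hB) (cubeBd_mem_above hB₁)
  rw [sub_eq_zero.1 h0, map_sub, hA', cubeBd_cubeBd, sub_zero]

/-- The boundary of a chain of cubes that meet the hyperplane, up to cubes that do not. -/
theorem exists_trace {e : ℕ} {c : Fin n → ℕ} {t : ℕ} {W M : Cube n →₀ k}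
    (hW : W ∈ Finsupp.supported k k (between e c ∩ ofDim n (t + 1)))
    (hM : M ∈ Finsupp.supported k k (between e c ∩ ofDim n t))
    (h : ∀ x ∈ between e c ∩ ofDim n t, M x = cubeBd k n W x) :
    ∃ A ∈ Finsupp.supported k k (below e c ∩ ofDim n t),
    ∃ B ∈ Finsupp.supported k k (above e c ∩ ofDim n t), cubeBd k n W = M + A + B := by
  have hbox : cubeBd k n W ∈ Finsupp.supported k k (box c ∩ ofDim n t) :=
    cubeBd_mem_box (mem_box_of_between hW)
  obtain ⟨M', hM', A, hA, B, hB, hMAB⟩ := exists_decomposition e hbox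
  refine ⟨A, hA, B, hB, ?_⟩
  rw [hMAB]
  congr 2
  ext x
  by_cases hx : x ∈ between e c ∩ ofDim n t
  · rw [h x hx, hMAB, Finsupp.add_apply, Finsupp.add_apply,
        eq_zero_of_mem_supported hA fun h => below_disjoint_between hx.1 h.1,
        eq_zero_of_mem_supported hB fun h => above_disjoint_between hx.1 h.1]
    simp
  · rw [eq_zero_of_mem_supported hM hx, eq_zero_of_mem_supported hM' hx]

theorem cubeBd_trace_eq_zero {e : ℕ} {c : Fin n → ℕ} {t : ℕ} {W M : Cube n →₀ k}
    (hW : W ∈ Finsupp.supported k k (between e c ∩ ofDim n (t + 2)))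
    (hM : M ∈ Finsupp.supported k k (between e c ∩ ofDim n (t + 1)))
    (h : ∀ x ∈ between e c ∩ ofDim n (t + 1), M x = cubeBd k n W x) :
    ∀ x ∈ between e c, cubeBd k n M x = 0 := by
  obtain ⟨A, hA, B, hB, hMAB⟩ := exists_trace hW hM h
  intro x hx
  have h1 := DFunLike.congr_fun (cubeBd_cubeBd W) x
  rw [hMAB, map_add, map_add, Finsupp.add_apply, Finsupp.add_apply,
    eq_zero_of_mem_supported (cubeBd_mem_below hA) fun h => below_disjoint_between hx h.1,
    eq_zero_of_mem_supported (cubeBd_mem_above hB) fun h => above_disjoint_between hx h.1] at h1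
  simpa using h1

/-- Two consecutive differentials compose to zero where the connecting map takes over. In ∂∂W = 0
the part lower M + ∂A lies below and equals minus a chain above, so it vanishes and lower M is
itself a boundary. -/
theorem cubeBd_lower_trace_eq_zero {e : ℕ} {c : Fin n → ℕ} {W M : Cube n →₀ k}
    (hW : W ∈ Finsupp.supported k k (between e c ∩ ofDim n 3))
    (hM : M ∈ Finsupp.supported k k (between e c ∩ ofDim n 2))
    (h : ∀ x ∈ between e c ∩ ofDim n 2, M x = cubeBd k n W x) :
    cubeBd k n (lower k n M) = 0 := by
  obtain ⟨A, hA, B, hB, hMAB⟩ := exists_trace hW hM h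
  have h0 : lower k n M + cubeBd k n A = 0 := by
    refine eq_zero_of_below_of_above (t := 0) (e := e) (c := c)
      (add_mem (lower_mem_below hM) (cubeBd_mem_below hA)) ?_
    have h1 := cubeBd_cubeBd W
    rw [hMAB, map_add, map_add, cubeBd, LinearMap.add_apply (upper k n) _ M, ← cubeBd] at h1
    have : lower k n M + cubeBd k n A = -(upper k n M + cubeBd k n B) := by
      rw [← sub_eq_zero, ← h1]
      abel
    rw [this]
    exact neg_mem (add_mem (upper_mem_above hM) (cubeBd_mem_above hB))
  rw [eq_neg_of_add_eq_zero_left h0, map_neg, cubeBd_cubeBd, neg_zero]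

end Slices

/-! ### The cells of the subdivided simplices -/

section Geometry

variable {n e : ℕ}

/-- The slice of a cube by the hyperplane `∑ y = e`. -/
def cellSet (e : ℕ) (x : Cube n) : Set (Fin n → ℝ) :=
  {z | ∑ i, z i = e ∧ ∀ i, (x.1 i : ℝ) ≤ z i ∧ z i ≤ x.top i}

/-- The cube is a vertex on the hyperplane `∑ y = e` or its interior meets this hyperplane. -/
def IsCell (e : ℕ) (x : Cube n) : Prop :=
  (x.2 = ∅ ∧ ∑ i, x.1 i = e) ∨ (∑ i, x.1 i < e ∧ e < ∑ i, x.1 i + x.2.card)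

lemma top_of_mem {a : Fin n → ℕ} {T : Finset (Fin n)} {i : Fin n} (hi : i ∈ T) :
    Cube.top (a, T) i = a i + 1 := by simp [Cube.top, ind, hi]

lemma top_of_notMem {a : Fin n → ℕ} {T : Finset (Fin n)} {i : Fin n} (hi : i ∉ T) :
    Cube.top (a, T) i = a i := by simp [Cube.top, ind, hi]

lemma top_empty (a : Fin n → ℕ) : Cube.top (a, ∅) = a := by
  funext i; simp [Cube.top, ind]

lemma sum_top (x : Cube n) : ∑ i, x.top i = ∑ i, x.1 i + x.2.card := by
  simp [Cube.top, Finset.sum_add_distrib, sum_ind]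

lemma toPt_mem_cellSet {x : Cube n} {a : Fin n → ℕ} :
    toPt a ∈ cellSet e x ↔ ∑ i, a i = e ∧ x.1 ≤ a ∧ a ≤ x.top := by
  simp only [cellSet, toPt, Set.mem_ofPred_eq, Nat.cast_le, forall_and, Pi.le_def]
  norm_cast

lemma IsCell.card_le {x : Cube n} (hx : IsCell e x) :
    ∑ i, x.1 i ≤ e ∧ e ≤ ∑ i, x.1 i + x.2.card := by
  rcases hx with ⟨h1, h2⟩ | h
  · simp [h1, h2]
  · omega

/-- A corner of the cube lies on the hyperplane when exactly e - |a| free coordinates are raised.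
The bounds on `P` and `Q` allow some coordinates to be forced up and others to be kept down. -/
lemma exists_vertex {x : Cube n} {P Q : Finset (Fin n)} (hPQ : P ⊆ Q)
    (hQ : Q ⊆ x.2) (h1 : ∑ i, x.1 i + P.card ≤ e) (h2 : e ≤ ∑ i, x.1 i + Q.card) :
    ∃ R : Finset (Fin n), P ⊆ R ∧ R ⊆ Q ∧ toPt (x.1 + ind R) ∈ cellSet e x := by
  obtain ⟨R, h3, h4, h5⟩ := Finset.exists_subsuperset_card_eq hPQ (n := e - ∑ i, x.1 i)
    (by omega) (by omega)
  refine ⟨R, h3, h4, toPt_mem_cellSet.2 ⟨?_, fun i => Nat.le_add_right _ _, fun i => ?_⟩⟩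
  · simp only [Pi.add_apply, Finset.sum_add_distrib, sum_ind, h5]
    omega
  · have : ind R i ≤ ind x.2 i := by
      simp only [ind]
      split_ifs with h6 h7
      · rfl
      · exact absurd (hQ (h4 h6)) h7
      · omega
      · rfl
    simpa [Cube.top] using this

/-- The strict inequality e < |a| + |T| leaves enough free coordinates after `i` is excluded from
those to be raised. -/
lemma IsCell.exists_min {x : Cube n} (hx : IsCell e x) (i : Fin n) :
    ∃ a, toPt a ∈ cellSet e x ∧ a i = x.1 i := by
  have h : e ≤ ∑ i, x.1 i + (x.2.erase i).card := by
    rcases hx with ⟨h1, h2⟩ | h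
    · simp [h1, h2]
    · have := Finset.pred_card_le_card_erase (a := i) (s := x.2)
      omega
  obtain ⟨R, -, hR, hR'⟩ := exists_vertex (Finset.empty_subset _) (Finset.erase_subset i x.2)
    (by simpa using hx.card_le.1) h
  refine ⟨_, hR', ?_⟩
  have : i ∉ R := fun h => Finset.notMem_erase i x.2 (hR h)
  simp [ind, this]

lemma IsCell.exists_max {x : Cube n} (hx : IsCell e x) (i : Fin n) :
    ∃ a, toPt a ∈ cellSet e x ∧ a i = x.top i := by
  by_cases hi : i ∈ x.2
  · have h : ∑ i, x.1 i + ({i} : Finset (Fin n)).card ≤ e := by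
      rcases hx with ⟨h1, -⟩ | h
      · simp [h1] at hi
      · rw [Finset.card_singleton]; omega
    obtain ⟨R, hR, -, hR'⟩ := exists_vertex (Finset.singleton_subset_iff.2 hi) subset_rfl
      h hx.card_le.2
    refine ⟨_, hR', ?_⟩
    have : i ∈ R := hR (Finset.mem_singleton_self i)
    simp [Cube.top, ind, this, hi]
  · obtain ⟨a, ha, ha'⟩ := hx.exists_min i
    exact ⟨a, ha, by simp [ha', Cube.top, ind, hi]⟩

lemma IsCell.nonempty {x : Cube n} (hx : IsCell e x) : (cellSet e x).Nonempty := by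
  obtain ⟨R, -, -, h⟩ := exists_vertex (Finset.empty_subset _) subset_rfl
    (by simpa using hx.card_le.1) hx.card_le.2
  exact ⟨_, h⟩

/-- Each coordinate attains both of its cube bounds at lattice points of the slice, so the slice of
a cell determines its cube. -/
lemma cellSet_subset_iff {x y : Cube n} (hx : IsCell e x) :
    cellSet e x ⊆ cellSet e y ↔ y.1 ≤ x.1 ∧ x.top ≤ y.top := by
  constructor
  · refine fun h => ⟨fun i => ?_, fun i => ?_⟩
    · obtain ⟨a, ha, ha'⟩ := hx.exists_min i
      rw [← ha']
      exact (toPt_mem_cellSet.1 (h ha)).2.1 i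
    · obtain ⟨a, ha, ha'⟩ := hx.exists_max i
      rw [← ha']
      exact (toPt_mem_cellSet.1 (h ha)).2.2 i
  · rintro ⟨h1, h2⟩ z ⟨hz, hz'⟩
    refine ⟨hz, fun i => ⟨le_trans ?_ (hz' i).1, (hz' i).2.trans ?_⟩⟩
    · exact_mod_cast h1 i
    · exact_mod_cast h2 i

lemma ind_injective : Function.Injective (ind (n := n)) := by
  intro S T h
  ext i
  have := congrFun h i
  simp only [ind] at this
  split_ifs at this <;> simp_all

lemma cellSet_injective {x y : Cube n} (hx : IsCell e x) (hy : IsCell e y)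
    (h : cellSet e x = cellSet e y) : x = y := by
  obtain ⟨h1, h2⟩ := (cellSet_subset_iff hx).1 h.subset
  obtain ⟨h3, h4⟩ := (cellSet_subset_iff hy).1 h.symm.subset
  have h5 := le_antisymm h3 h1
  have h6 := le_antisymm h2 h4
  refine Prod.ext h5 (ind_injective ?_)
  rw [Cube.top, Cube.top, h5] at h6
  exact add_left_cancel h6

lemma subdivCell_eq_cellSet {y : Fin n → ℝ} {x : Cube n}
    (h1 : ∀ i ∉ x.2, y i = x.1 i) (h2 : ∀ i ∈ x.2, x.1 i < y i ∧ y i < x.1 i + 1) :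
    subdivCell n e y = cellSet e x := by
  obtain ⟨a, T⟩ := x
  ext z
  constructor
  · rintro ⟨hz, hz'⟩
    refine ⟨(mem_newton.1 hz).2, fun i => ?_⟩
    by_cases hi : i ∈ T
    · rw [top_of_mem hi]
      refine ⟨(hz' i (a i)).2 (h2 i hi).1.le, (hz' i (a i + 1)).1 ?_⟩
      push_cast
      exact (h2 i hi).2.le
    · rw [top_of_notMem hi]
      exact ⟨(hz' i (a i)).2 (h1 i hi).ge, (hz' i (a i)).1 (h1 i hi).le⟩
  · rintro ⟨hz, hz'⟩
    refine ⟨mem_newton.2 ⟨fun i => (Nat.cast_nonneg _).trans (hz' i).1, hz⟩, fun i j => ?_⟩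
    have h := hz' i
    by_cases hi : i ∈ T
    · rw [top_of_mem hi] at h
      obtain ⟨h3, h4⟩ := h2 i hi
      simp only at h h3 h4
      push_cast at h
      constructor
      · intro hj
        have h5 : a i < j := by exact_mod_cast h3.trans_le hj
        have h6 : (a i : ℝ) + 1 ≤ j := by exact_mod_cast h5
        exact h.2.trans h6
      · intro hj
        have h5 : j < a i + 1 := by exact_mod_cast hj.trans_lt h4
        have h6 : (j : ℝ) ≤ a i := by exact_mod_cast Nat.lt_succ_iff.1 h5
        exact h6.trans h.1
    · rw [top_of_notMem hi] at h
      have h3 : z i = y i := (le_antisymm h.2 h.1).trans (h1 i hi).symm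
      rw [h3]
      exact ⟨id, id⟩

/-- The point of a cell whose free coordinates all have the same fractional part. -/
lemma IsCell.exists_interior {x : Cube n} (hx : IsCell e x) :
    ∃ θ : ℝ, 0 < θ ∧ θ < 1 ∧ ∑ i, ((x.1 i : ℝ) + θ * ind x.2 i) = e := by
  have hs : ∀ θ : ℝ, ∑ i, ((x.1 i : ℝ) + θ * ind x.2 i) =
      ((∑ i, x.1 i : ℕ) : ℝ) + θ * (x.2.card : ℕ) := by
    intro θ
    rw [Finset.sum_add_distrib, ← Finset.mul_sum, ← sum_ind]
    push_cast
    rfl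
  simp only [hs]
  rcases hx with ⟨h1, h2⟩ | ⟨h1, h2⟩
  · exact ⟨1 / 2, by norm_num, by norm_num, by simp [h1, h2]⟩
  · have hc : (0 : ℝ) < x.2.card := by
      have : 0 < x.2.card := by omega
      exact_mod_cast this
    have h1' : ((∑ i, x.1 i : ℕ) : ℝ) < e := by exact_mod_cast h1
    have h2' : (e : ℝ) < ((∑ i, x.1 i : ℕ) : ℝ) + (x.2.card : ℕ) := by exact_mod_cast h2
    refine ⟨(e - (∑ i, x.1 i : ℕ)) / x.2.card, ?_, ?_, ?_⟩
    · exact div_pos (by linarith) hc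
    · rw [div_lt_one hc]; linarith
    · rw [div_mul_cancel₀ _ hc.ne']; ring

/-- The smallest cell containing y comes from the cube whose lower corner is the floor of y and
whose free coordinates are those where y is not an integer. Conversely, a cell is recovered from an
interior point of it. -/
lemma mem_subdividedSimplex {F : Set (Fin n → ℝ)} :
    F ∈ subdividedSimplex n e ↔ ∃ x : Cube n, IsCell e x ∧ F = cellSet e x := by
  constructor
  · rintro ⟨y, hy, rfl⟩
    obtain ⟨hy0, hye⟩ := mem_newton.1 hy
    classical
    let a : Fin n → ℕ := fun i => ⌊y i⌋₊
    let T : Finset (Fin n) := Finset.univ.filter fun i => y i ≠ a i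
    have ha : ∀ i, (a i : ℝ) ≤ y i := fun i => Nat.floor_le (hy0 i)
    have ha' : ∀ i, y i < a i + 1 := fun i => Nat.lt_floor_add_one (y i)
    have h1 : ∀ i ∉ T, y i = a i := by
      intro i hi
      simpa [T] using hi
    have h2 : ∀ i ∈ T, (a i : ℝ) < y i ∧ y i < a i + 1 := by
      intro i hi
      have : y i ≠ a i := by simpa [T] using hi
      exact ⟨lt_of_le_of_ne (ha i) this.symm, ha' i⟩
    refine ⟨(a, T), ?_, subdivCell_eq_cellSet h1 h2⟩
    by_cases hT : T = ∅
    · refine Or.inl ⟨hT, ?_⟩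
      have : ((∑ i, a i : ℕ) : ℝ) = e := by
        rw [← hye]
        push_cast
        exact Finset.sum_congr rfl fun i _ => (h1 i (by simp [hT])).symm
      exact_mod_cast this
    · obtain ⟨i, hi⟩ := Finset.nonempty_iff_ne_empty.2 hT
      refine Or.inr ⟨?_, ?_⟩
      · have : ((∑ i, a i : ℕ) : ℝ) < e := by
          rw [← hye]
          push_cast
          exact Finset.sum_lt_sum (fun j _ => ha j) ⟨i, Finset.mem_univ i, (h2 i hi).1⟩
        exact_mod_cast this
      · rw [← sum_top (a, T)]
        have : (e : ℝ) < ((∑ i, Cube.top (a, T) i : ℕ) : ℝ) := by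
          rw [← hye]
          push_cast
          refine Finset.sum_lt_sum (fun j _ => ?_) ⟨i, Finset.mem_univ i, ?_⟩
          · by_cases hj : j ∈ T
            · rw [top_of_mem hj]; push_cast; exact (h2 j hj).2.le
            · rw [top_of_notMem hj]; exact (h1 j hj).le
          · rw [top_of_mem hi]; push_cast; exact (h2 i hi).2
        exact_mod_cast this
  · rintro ⟨x, hx, rfl⟩
    obtain ⟨θ, h0, h1, hs⟩ := hx.exists_interior
    refine ⟨fun i => (x.1 i : ℝ) + θ * ind x.2 i, mem_newton.2 ⟨fun i => by positivity, hs⟩,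
      (subdivCell_eq_cellSet ?_ ?_).symm⟩
    · intro i hi
      simp [ind, hi]
    · intro i hi
      simp [ind, hi, h0, h1]

lemma cellSet_vertex {a : Fin n → ℕ} (ha : ∑ i, a i = e) : cellSet e (a, ∅) = {toPt a} := by
  ext z
  simp only [cellSet, top_empty, Set.mem_ofPred_eq, Set.mem_singleton_iff]
  constructor
  · rintro ⟨-, h⟩
    exact funext fun i => le_antisymm (h i).2 (h i).1
  · rintro rfl
    refine ⟨?_, fun i => ⟨le_rfl, le_rfl⟩⟩
    simp only [toPt]
    exact_mod_cast ha

lemma label_cellSet {X : Set (Set (Fin n → ℝ))} {x : Cube n} (hx : IsCell e x)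
    (hX : ∀ a, toPt a ∈ cellSet e x → {toPt a} ∈ X) : label X (cellSet e x) = x.top := by
  funext i
  refine IsGreatest.csSup_eq ⟨?_, ?_⟩
  · obtain ⟨a, ha, ha'⟩ := hx.exists_max i
    exact ⟨a, hX a ha, ha, ha'⟩
  · rintro _ ⟨a, -, ha, rfl⟩
    exact (toPt_mem_cellSet.1 ha).2.2 i

lemma cellSet_subset_newton (x : Cube n) : cellSet e x ⊆ newton n e := fun _ hz =>
  mem_newton.2 ⟨fun i => (Nat.cast_nonneg _).trans (hz.2 i).1, hz.1⟩

lemma label_subdividedSimplex {x : Cube n} (hx : IsCell e x) :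
    label (subdividedSimplex n e) (cellSet e x) = x.top :=
  label_cellSet hx fun _ ha => singleton_mem_subdividedSimplex (cellSet_subset_newton x ha)

lemma mem_bounded {β : Fin n → ℕ} {F : Set (Fin n → ℝ)} :
    F ∈ bounded (subdividedSimplex n e) β ↔
      ∃ x : Cube n, IsCell e x ∧ x.top ≤ β ∧ F = cellSet e x := by
  constructor
  · rintro ⟨hF, hb⟩
    obtain ⟨x, hx, rfl⟩ := mem_subdividedSimplex.1 hF
    exact ⟨x, hx, label_subdividedSimplex hx ▸ hb, rfl⟩
  · rintro ⟨x, hx, hb, rfl⟩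
    exact ⟨mem_subdividedSimplex.2 ⟨x, hx, rfl⟩, (label_subdividedSimplex hx).trans_le hb⟩

lemma label_bounded {β : Fin n → ℕ} {x : Cube n} (hx : IsCell e x) (hb : x.top ≤ β) :
    label (bounded (subdividedSimplex n e) β) (cellSet e x) = x.top := by
  refine label_cellSet hx fun a ha => ?_
  obtain ⟨h1, h2, h3⟩ := toPt_mem_cellSet.1 ha
  rw [← cellSet_vertex h1]
  exact mem_bounded.2 ⟨(a, ∅), Or.inl ⟨rfl, h1⟩, by rw [top_empty]; exact h3.trans hb, rfl⟩

lemma label_empty (X : Set (Set (Fin n → ℝ))) : label X ∅ = 0 := by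
  funext i
  simp [label]

lemma freeCoords_cellSet {x : Cube n} (hx : IsCell e x) : freeCoords (cellSet e x) = x.2 := by
  ext i
  simp only [freeCoords, Finset.mem_filter, Finset.mem_univ, true_and]
  constructor
  · rintro ⟨y, hy, z, hz, hyz⟩
    by_contra hi
    have h1 := hy.2 i
    have h2 := hz.2 i
    rw [show x.top i = x.1 i from top_of_notMem hi] at h1 h2
    exact hyz ((le_antisymm h1.2 h1.1).trans (le_antisymm h2.1 h2.2))
  · intro hi
    obtain ⟨a, ha, ha'⟩ := hx.exists_min i
    obtain ⟨c, hc, hc'⟩ := hx.exists_max i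
    refine ⟨_, ha, _, hc, ?_⟩
    rw [show x.top i = x.1 i + 1 from top_of_mem hi] at hc'
    simp [toPt, ha', hc']

lemma freeCoords_empty : freeCoords (∅ : Set (Fin n → ℝ)) = ∅ := by
  simp [freeCoords]

/-- The direction of the hyperplane `∑ y = e` in the coordinates of `T`. -/
def directions (T : Finset (Fin n)) : Submodule ℝ (Fin n → ℝ) where
  carrier := {v | (∀ i ∉ T, v i = 0) ∧ ∑ i, v i = 0}
  add_mem' := by
    rintro v w ⟨h1, h2⟩ ⟨h3, h4⟩
    refine ⟨fun i hi => by simp [h1 i hi, h3 i hi], ?_⟩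
    simp [Finset.sum_add_distrib, h2, h4]
  zero_mem' := by simp
  smul_mem' := by
    rintro c v ⟨h1, h2⟩
    refine ⟨fun i hi => by simp [h1 i hi], ?_⟩
    simp [← Finset.mul_sum, h2]

/-- Forgetting one coordinate of `T` is an isomorphism, since that coordinate is determined by the
zero sum. -/
lemma finrank_directions {T : Finset (Fin n)} (hT : T.Nonempty) :
    Module.finrank ℝ (directions T) + 1 = T.card := by
  obtain ⟨i₀, hi₀⟩ := hT
  let r : directions T →ₗ[ℝ] (T.erase i₀ → ℝ) :=
    { toFun := fun v i => v.1 i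
      map_add' := fun _ _ => rfl
      map_smul' := fun _ _ => rfl }
  have hr : Function.Bijective r := by
    constructor
    · rw [← LinearMap.ker_eq_bot, LinearMap.ker_eq_bot']
      rintro ⟨v, h1, h2⟩ hv
      have h3 : ∀ i, i ≠ i₀ → v i = 0 := by
        intro i hi
        by_cases hiT : i ∈ T
        · exact congrFun hv ⟨i, Finset.mem_erase.2 ⟨hi, hiT⟩⟩
        · exact h1 i hiT
      apply Subtype.ext
      funext i
      by_cases hi : i = i₀
      · rw [Finset.sum_eq_single i₀ (fun j _ hj => h3 j hj) (by simp)] at h2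
        rw [hi]; exact h2
      · exact h3 i hi
    · intro w
      let w' : Fin n → ℝ := fun i => if h : i ∈ T.erase i₀ then w ⟨i, h⟩ else 0
      have hw' : ∀ i ∉ T.erase i₀, w' i = 0 := fun i hi => by simp only [w', hi, dite_false]
      refine ⟨⟨w' - Pi.single i₀ (∑ i, w' i), fun i hi => ?_, ?_⟩, ?_⟩
      · have h1 : i ≠ i₀ := fun h => hi (h ▸ hi₀)
        simp [hw' i (fun h => hi (Finset.mem_of_mem_erase h)), h1]
      · simp
      · funext i
        have h1 : i.1 ≠ i₀ := Finset.ne_of_mem_erase i.2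
        change w' i.1 - (Pi.single i₀ (∑ i, w' i) : Fin n → ℝ) i.1 = w i
        have h2 := i.2
        rw [Pi.single_eq_of_ne h1, sub_zero]
        simp only [w', h2, dite_true]
  rw [(LinearEquiv.ofBijective r hr).finrank_eq, Module.finrank_fintype_fun_eq_card,
    Fintype.card_coe, Finset.card_erase_add_one hi₀]

lemma vectorSpan_cellSet {x : Cube n} (hx : IsCell e x) :
    vectorSpan ℝ (cellSet e x) = directions x.2 := by
  apply le_antisymm
  · refine Submodule.span_le.2 ?_
    rintro _ ⟨y, hy, z, hz, rfl⟩
    refine ⟨fun i hi => ?_, ?_⟩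
    · have h1 := hy.2 i
      have h2 := hz.2 i
      rw [show x.top i = x.1 i from top_of_notMem hi] at h1 h2
      simp only [vsub_eq_sub, Pi.sub_apply]
      linarith
    · simp only [vsub_eq_sub, Pi.sub_apply, Finset.sum_sub_distrib, hy.1, hz.1, sub_self]
  · rintro v ⟨hv, hv'⟩
    obtain ⟨θ, h0, h1, hs⟩ := hx.exists_interior
    -- All free coordinates of the interior point have distance at least δ from both bounds of the
    -- cube, and ε rescales v to entries of size at most δ; so v is a multiple of a difference of
    -- two points of the cell.
    set δ := min θ (1 - θ) with hδ
    have hδ0 : 0 < δ := lt_min h0 (by linarith)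
    have hn : 0 < 1 + ‖v‖ := by positivity
    set ε := δ / (1 + ‖v‖) with hε
    have hε0 : 0 < ε := div_pos hδ0 hn
    have hb : ∀ i, |ε * v i| ≤ δ := by
      intro i
      rw [abs_mul, abs_of_pos hε0, hε, div_mul_eq_mul_div, div_le_iff₀ hn]
      have : |v i| ≤ ‖v‖ := norm_le_pi_norm v i
      nlinarith
    have hmem : ∀ t : ℝ, t = 0 ∨ t = 1 →
        (fun i => ((x.1 i : ℝ) + θ * ind x.2 i) + t * (ε * v i)) ∈ cellSet e x := by
      intro t ht
      refine ⟨?_, fun i => ?_⟩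
      · rw [Finset.sum_add_distrib, hs, ← Finset.mul_sum, ← Finset.mul_sum, hv']
        simp
      · have hbi := abs_le.1 (hb i)
        have h2 : δ ≤ θ := min_le_left _ _
        have h3 : δ ≤ 1 - θ := min_le_right _ _
        by_cases hi : i ∈ x.2
        · rw [show x.top i = x.1 i + 1 from top_of_mem hi]
          simp only [ind, hi, if_true, Nat.cast_one, mul_one, Nat.cast_add]
          rcases ht with rfl | rfl
          · constructor <;> linarith
          · constructor <;> linarith
        · rw [show x.top i = x.1 i from top_of_notMem hi]
          simp [ind, hi, hv i hi]
    have h2 := vsub_mem_vectorSpan ℝ (hmem 1 (Or.inr rfl)) (hmem 0 (Or.inl rfl))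
    have h3 : v = ε⁻¹ • ((fun i => ((x.1 i : ℝ) + θ * ind x.2 i) + 1 * (ε * v i)) -ᵥ
        (fun i => ((x.1 i : ℝ) + θ * ind x.2 i) + 0 * (ε * v i))) := by
      funext i
      simp only [vsub_eq_sub, Pi.smul_apply, Pi.sub_apply, smul_eq_mul]
      field_simp
      ring
    rw [h3]
    exact Submodule.smul_mem _ _ h2

/-- The maximum covers vertices, which have no free coordinates but rank 1. -/
lemma faceRank_cellSet {x : Cube n} (hx : IsCell e x) :
    faceRank (cellSet e x) = max 1 x.2.card := by
  rw [faceRank, if_neg hx.nonempty.ne_empty]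
  rcases x.2.eq_empty_or_nonempty with hT | hT
  · rcases hx with ⟨-, h⟩ | h
    · obtain ⟨a, T⟩ := x
      simp only at hT h
      subst hT
      rw [cellSet_vertex h, vectorSpan_singleton]
      simp
    · rw [hT, Finset.card_empty] at h; omega
  · rw [vectorSpan_cellSet hx, finrank_directions hT]
    have := hT.card_pos
    omega

lemma incidence_cellSet {x y : Cube n} (hx : IsCell e x) (hy : IsCell e y)
    (hne : (x.2 \ y.2).Nonempty) :
    incidence (cellSet e y) (cellSet e x) =
      (-1) ^ (x.2.filter fun j => j < (x.2 \ y.2).min' hne).card *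
        if x.1 ((x.2 \ y.2).min' hne) + 1 ≤ y.1 ((x.2 \ y.2).min' hne) then 1 else -1 := by
  have hi := Finset.mem_sdiff.1 ((x.2 \ y.2).min'_mem hne)
  have hiff : (∀ u ∈ cellSet e x, ∀ z ∈ cellSet e y,
      u ((x.2 \ y.2).min' hne) ≤ z ((x.2 \ y.2).min' hne)) ↔
      x.1 ((x.2 \ y.2).min' hne) + 1 ≤ y.1 ((x.2 \ y.2).min' hne) := by
    generalize (x.2 \ y.2).min' hne = i at hi
    constructor
    · intro h
      obtain ⟨a, ha, ha'⟩ := hx.exists_max i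
      obtain ⟨c, hc, hc'⟩ := hy.exists_min i
      have := h _ ha _ hc
      rw [show x.top i = x.1 i + 1 from top_of_mem hi.1] at ha'
      simp only [toPt, ha', hc'] at this
      exact_mod_cast this
    · intro h u hu z hz
      refine (hu.2 i).2.trans (le_trans ?_ (hz.2 i).1)
      rw [show x.top i = x.1 i + 1 from top_of_mem hi.1]
      exact_mod_cast h
  simp only [incidence, freeCoords_cellSet hx, freeCoords_cellSet hy, hne, dite_true, hiff]

lemma incidence_empty_vertex {x : Cube n} (hx : IsCell e x) (h : x.2 = ∅) :
    incidence ∅ (cellSet e x) = 1 := by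
  rw [incidence, dif_neg]
  rw [freeCoords_cellSet hx, h, freeCoords_empty]
  simp

end Geometry

/-! ### Incidence numbers of slices as coefficients of cubical boundaries -/

section Incidence

open Finsupp (single)

variable {k : Type*} [Field k] {n e : ℕ}

/-- A cell in the boundary of another one with one free coordinate less is an upper or a lower
facet of the cube. -/
lemma exists_eq_facet {x y : Cube n} (h1 : x.1 ≤ y.1) (h2 : y.top ≤ x.top)
    (hc : x.2.card = y.2.card + 1) :
    ∃ i ∈ x.2, x.2 \ y.2 = {i} ∧ (y = (raise i x.1, x.2.erase i) ∨ y = (x.1, x.2.erase i)) := by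
  obtain ⟨a, T⟩ := x
  obtain ⟨a', T'⟩ := y
  simp only at h1 hc
  have hsub : T' ⊆ T := by
    intro j hj
    by_contra hj'
    have h3 : Cube.top (a', T') j ≤ Cube.top (a, T) j := h2 j
    have h4 : a j ≤ a' j := h1 j
    rw [top_of_mem hj, top_of_notMem hj'] at h3
    omega
  have hcard : (T \ T').card = 1 := by
    rw [Finset.card_sdiff_of_subset hsub]; omega
  obtain ⟨i, hi⟩ := Finset.card_eq_one.1 hcard
  have hiT : i ∈ T \ T' := by rw [hi]; exact Finset.mem_singleton_self i
  obtain ⟨hiT, hiT'⟩ := Finset.mem_sdiff.1 hiT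
  have hT' : T' = T.erase i := by
    rw [Finset.erase_eq, ← hi, Finset.sdiff_sdiff_eq_self hsub]
  have hne : ∀ j, j ≠ i → a' j = a j := by
    intro j hj
    have h3 : Cube.top (a', T') j ≤ Cube.top (a, T) j := h2 j
    have h4 : a j ≤ a' j := h1 j
    by_cases hjT : j ∈ T
    · have hjT' : j ∈ T' := by rw [hT']; exact Finset.mem_erase.2 ⟨hj, hjT⟩
      rw [top_of_mem hjT, top_of_mem hjT'] at h3
      omega
    · rw [top_of_notMem hjT, top_of_notMem fun h => hjT (hsub h)] at h3
      omega
  refine ⟨i, hiT, hi, ?_⟩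
  have h3 : Cube.top (a', T') i ≤ Cube.top (a, T) i := h2 i
  have h4 : a i ≤ a' i := h1 i
  rw [top_of_mem hiT, top_of_notMem hiT'] at h3
  rcases (show a' i = a i + 1 ∨ a' i = a i by omega) with h5 | h5
  · left
    refine Prod.ext (funext fun j => ?_) hT'
    rcases eq_or_ne j i with rfl | hj
    · simp [raise, h5]
    · simp [raise, hj, hne j hj]
  · right
    refine Prod.ext (funext fun j => ?_) hT'
    rcases eq_or_ne j i with rfl | hj
    · exact h5
    · exact hne j hj

lemma cubeBd_single_apply_of_erase (a a' : Fin n → ℕ) {T : Finset (Fin n)} {i : Fin n}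
    (hi : i ∈ T) : cubeBd k n (single (a, T) 1) (a', T.erase i) =
      sgn k i T * ((if raise i a = a' then 1 else 0) - if a = a' then 1 else 0) := by
  rw [cubeBd_single, Finsupp.finsetSum_apply, Finset.sum_eq_single_of_mem i hi]
  · simp [Finsupp.single_apply]
  · intro j _ hji
    have : T.erase j ≠ T.erase i := fun h =>
      Finset.notMem_erase i T (h ▸ Finset.mem_erase.2 ⟨hji.symm, hi⟩)
    simp [this]

lemma raise_ne (i : Fin n) (a : Fin n → ℕ) : raise i a ≠ a := fun h => by
  have := congrFun h i
  simp [raise] at this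

lemma min'_eq_of_eq_singleton {S : Finset (Fin n)} {i : Fin n} (h : S = {i}) (hne : S.Nonempty) :
    S.min' hne = i := by
  subst h; simp

lemma cubeBd_apply_of_subset {x y : Cube n} (hx : IsCell e x) (hy : IsCell e y)
    (hc : x.2.card = y.2.card + 1) (h : cellSet e y ⊆ cellSet e x) :
    cubeBd k n (single x 1) y = (incidence (cellSet e y) (cellSet e x) : ℤ) := by
  obtain ⟨h1, h2⟩ := (cellSet_subset_iff hy).1 h
  obtain ⟨i, hi, hdiff, hor⟩ := exists_eq_facet h1 h2 hc
  have hne : (x.2 \ y.2).Nonempty := by rw [hdiff]; exact Finset.singleton_nonempty i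
  rw [incidence_cellSet hx hy hne, min'_eq_of_eq_singleton hdiff hne]
  obtain ⟨a, T⟩ := x
  rcases hor with rfl | rfl
  · rw [cubeBd_single_apply_of_erase _ _ hi, if_pos rfl, if_neg (raise_ne i a).symm,
      if_pos (by simp [raise])]
    simp [sgn]
  · rw [cubeBd_single_apply_of_erase _ _ hi, if_neg (raise_ne i a), if_pos rfl, if_neg (by simp)]
    simp [sgn]

lemma raise_top_le {a : Fin n → ℕ} {T : Finset (Fin n)} {i : Fin n} (hi : i ∈ T)
    {U : Finset (Fin n)} (hU : U ⊆ T.erase i) : Cube.top (raise i a, U) ≤ Cube.top (a, T) := by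
  intro j
  have h1 : ind U j ≤ ind (T.erase i) j := by
    simp only [ind]
    split_ifs with h2 h3
    · rfl
    · exact absurd (hU h2) h3
    · omega
    · rfl
  rw [← top_raise_erase hi]
  simpa [Cube.top] using h1

lemma le_raise (i : Fin n) (a : Fin n → ℕ) : a ≤ raise i a := by
  intro j
  rcases eq_or_ne j i with rfl | hj
  · simp [raise]
  · simp [raise, hj]

lemma cubeBd_apply_of_not_subset {x y : Cube n} (hy : IsCell e y)
    (h : ¬ cellSet e y ⊆ cellSet e x) : cubeBd k n (single x 1) y = 0 := by
  rw [cellSet_subset_iff hy] at h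
  obtain ⟨a, T⟩ := x
  rw [cubeBd_single, Finsupp.finsetSum_apply]
  refine Finset.sum_eq_zero fun i hi => ?_
  rw [Finsupp.smul_apply, Finsupp.sub_apply, Finsupp.single_eq_of_ne', Finsupp.single_eq_of_ne']
  · simp
  · rintro rfl
    exact h ⟨le_rfl, top_erase_le a T i⟩
  · rintro rfl
    exact h ⟨le_raise i a, raise_top_le hi subset_rfl⟩

/-- The two lower edges of the square leave the same corner with opposite signs, so the corner
cancels and the two ends of the diagonal remain. -/
lemma cubeBd_lower_pair {a : Fin n → ℕ} {i j : Fin n} (hij : i < j) :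
    cubeBd k n (lower k n (single (a, {i, j}) 1)) =
      single (raise i a, ∅) 1 - single (raise j a, ∅) 1 := by
  have e1 : ({i, j} : Finset (Fin n)).erase i = {j} := by
    rw [Finset.erase_insert]; simpa using hij.ne
  have e2 : ({i, j} : Finset (Fin n)).erase j = {i} := by
    rw [Finset.pair_comm, Finset.erase_insert]; simpa using hij.ne'
  have s1 : sgn k i {i, j} = 1 := by
    simp [sgn, Finset.filter_insert, Finset.filter_singleton, not_lt.2 hij.le]
  have s2 : sgn k j {i, j} = -1 := by
    simp [sgn, Finset.filter_insert, Finset.filter_singleton, hij]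
  have s3 : ∀ l : Fin n, sgn k l {l} = 1 := fun l => by simp [sgn, Finset.filter_singleton]
  have s4 : ∀ l : Fin n, cubeBd k n (single (a, {l}) 1) =
      single (raise l a, ∅) 1 - single (a, ∅) 1 := fun l => by
    rw [cubeBd_single, Finset.sum_singleton, s3, one_smul, Finset.erase_singleton]
  rw [lower_single, Finset.sum_pair hij.ne, e1, e2, s1, s2]
  simp only [one_smul, neg_smul, neg_neg, map_add, map_neg, s4]
  abel

lemma exists_raise_eq {x y : Cube n} (hx : IsCell e x) (hy : IsCell e y) (hcx : x.2.card = 2)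
    (hcy : y.2 = ∅) (h : cellSet e y ⊆ cellSet e x) : ∃ i ∈ x.2, y = (raise i x.1, ∅) := by
  obtain ⟨h1, h2⟩ := (cellSet_subset_iff hy).1 h
  obtain ⟨a, T⟩ := x
  obtain ⟨a', T'⟩ := y
  simp only at h1 hcx hcy
  subst hcy
  have hs' : ∑ i, a' i = e := by
    rcases hy with hy | hy
    · exact hy.2
    · simp only [Finset.card_empty] at hy; omega
  have hs : ∑ i, a i + 1 = e := by
    rcases hx with hx | hx
    · simp [show T = ∅ from hx.1] at hcx
    · simp only at hx; omega
  obtain ⟨i, hi⟩ : ∃ i, a i < a' i := by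
    by_contra hno
    push Not at hno
    have : ∑ i, a' i ≤ ∑ i, a i := Finset.sum_le_sum fun i _ => hno i
    omega
  have h3 : Cube.top (a', ∅) i ≤ Cube.top (a, T) i := h2 i
  rw [top_empty] at h3
  have hiT : i ∈ T := by
    by_contra hiT
    rw [top_of_notMem hiT] at h3
    omega
  rw [top_of_mem hiT] at h3
  refine ⟨i, hiT, Prod.ext ?_ rfl⟩
  -- The sum of `a` is e - 1, so `raise i a` and `a'` have equal sums and a coordinatewise
  -- inequality forces equality.
  have hle : ∀ j ∈ Finset.univ, raise i a j ≤ a' j := by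
    intro j _
    rcases eq_or_ne j i with rfl | hj
    · simp [raise]; omega
    · simpa [raise, hj] using h1 j
  have := (Finset.sum_eq_sum_iff_of_le hle).1 (by rw [sum_raise, hs, hs'])
  exact funext fun j => (this j (Finset.mem_univ j)).symm

lemma raise_injective (a : Fin n → ℕ) : Function.Injective fun i => raise i a := by
  intro i j h
  by_contra hij
  have := congrFun h i
  simp [raise, hij] at this

/-- An edge has two free coordinates and its endpoints none, so `incidence` reads the sign at the
smaller one: it is maximal at one endpoint and minimal at the other. -/
lemma cubeBd_lower_apply_of_subset {x y : Cube n} (hx : IsCell e x) (hy : IsCell e y)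
    (hcx : x.2.card = 2) (hcy : y.2 = ∅) (h : cellSet e y ⊆ cellSet e x) :
    cubeBd k n (lower k n (single x 1)) y = (incidence (cellSet e y) (cellSet e x) : ℤ) := by
  obtain ⟨l, hl, rfl⟩ := exists_raise_eq hx hy hcx hcy h
  obtain ⟨a, T⟩ := x
  obtain ⟨i, j, hij, rfl⟩ : ∃ i j, i < j ∧ T = {i, j} := by
    obtain ⟨i, j, hij, rfl⟩ := Finset.card_eq_two.1 hcx
    rcases lt_or_gt_of_ne hij with h | h
    · exact ⟨i, j, h, rfl⟩
    · exact ⟨j, i, h, Finset.pair_comm i j⟩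
  have hne : (({i, j} : Finset (Fin n)) \ ∅).Nonempty := by simp
  have hmin : (({i, j} : Finset (Fin n)) \ ∅).min' hne = i := by
    refine le_antisymm (Finset.min'_le _ _ (by simp)) (Finset.le_min' _ _ _ fun m hm => ?_)
    simp only [Finset.sdiff_empty, Finset.mem_insert, Finset.mem_singleton] at hm
    rcases hm with rfl | rfl
    · rfl
    · exact hij.le
  have hpos : (Finset.filter (fun m => m < i) ({i, j} : Finset (Fin n))).card = 0 := by
    simp [Finset.filter_insert, Finset.filter_singleton, hij.le]
  rw [incidence_cellSet hx hy hne, hmin, hpos, cubeBd_lower_pair hij]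
  simp only [Finset.mem_insert, Finset.mem_singleton] at hl
  rcases hl with rfl | rfl
  · have : raise j a ≠ raise l a := fun h => hij.ne' (raise_injective a h)
    rw [if_pos (by simp [raise])]
    simp [this]
  · have : raise i a ≠ raise l a := fun h => hij.ne (raise_injective a h)
    rw [if_neg (by simp [raise, hij.ne])]
    simp [this]

lemma cubeBd_lower_apply_of_not_subset {x y : Cube n} (hy : IsCell e y)
    (hcx : x.2.card = 2) (h : ¬ cellSet e y ⊆ cellSet e x) :
    cubeBd k n (lower k n (single x 1)) y = 0 := by
  rw [cellSet_subset_iff hy] at h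
  obtain ⟨a, T⟩ := x
  obtain ⟨i, j, hij, rfl⟩ : ∃ i j, i < j ∧ T = {i, j} := by
    obtain ⟨i, j, hij, rfl⟩ := Finset.card_eq_two.1 hcx
    rcases lt_or_gt_of_ne hij with h | h
    · exact ⟨i, j, h, rfl⟩
    · exact ⟨j, i, h, Finset.pair_comm i j⟩
  rw [cubeBd_lower_pair hij, Finsupp.sub_apply, Finsupp.single_eq_of_ne', Finsupp.single_eq_of_ne',
    sub_zero]
  · rintro rfl
    exact h ⟨le_raise j a, raise_top_le (by simp) (Finset.empty_subset _)⟩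
  · rintro rfl
    exact h ⟨le_raise i a, raise_top_le (by simp) (Finset.empty_subset _)⟩

end Incidence

/-! ### Exactness of labelled complexes -/

section Strands

open Finsupp (single)
open MvPolynomial

variable {k : Type*} [Field k] {σ : Type*}

/-- The homogeneous chain of degree `c` with the given coefficients. -/
noncomputable def homogeneous {ι : Type*} [Fintype ι] (l : ι → σ →₀ ℕ) (c : σ →₀ ℕ) (z : ι → k) :
    ι →₀ MvPolynomial σ k :=
  Finsupp.equivFunOnFinite.symm fun F => monomial (c - l F) (z F)

open Classical in
/-- The coefficients of the component of degree `c` of a chain. -/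
noncomputable def strand {ι : Type*} (l : ι → σ →₀ ℕ) (c : σ →₀ ℕ) (z : ι →₀ MvPolynomial σ k) :
    ι → k :=
  fun F => if l F ≤ c then coeff (c - l F) (z F) else 0

/-- A monomial of exponent m in the coefficient of F has multidegree m + l F, and finitely many such
degrees occur. -/
lemma exists_eq_sum_homogeneous {ι : Type*} [Fintype ι] (l : ι → σ →₀ ℕ)
    (z : ι →₀ MvPolynomial σ k) :
    ∃ D : Finset (σ →₀ ℕ), z = ∑ c ∈ D, homogeneous l c (strand l c z) := by
  classical
  refine ⟨Finset.univ.biUnion fun F => (z F).support.image (· + l F), ?_⟩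
  ext F m
  rw [Finsupp.finsetSum_apply, coeff_sum]
  have h : ∀ c, coeff m (homogeneous l c (strand l c z) F) =
      if c = m + l F then coeff m (z F) else 0 := by
    intro c
    simp only [homogeneous, strand, Finsupp.equivFunOnFinite_symm_apply_apply, coeff_monomial]
    by_cases hc : l F ≤ c
    · rw [if_pos hc]
      by_cases hm : c - l F = m
      · have : c = m + l F := by rw [← hm, tsub_add_cancel_of_le hc]
        rw [if_pos hm, if_pos this, hm]
      · have : c ≠ m + l F := fun h => hm (by rw [h, add_tsub_cancel_right])
        rw [if_neg hm, if_neg this]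
    · have : c ≠ m + l F := fun h => hc (h ▸ le_add_self)
      rw [if_neg hc, if_neg this, ite_self]
  simp only [h]
  rw [Finset.sum_ite_eq']
  split_ifs with hm
  · rfl
  · by_contra h0
    refine hm (Finset.mem_biUnion.2 ⟨F, Finset.mem_univ F, Finset.mem_image.2 ⟨m, ?_, rfl⟩⟩)
    exact mem_support_iff.2 h0

variable {ι₂ ι₁ ι₀ : Type*} [Fintype ι₂] [Fintype ι₁]
  {l₂ : ι₂ → σ →₀ ℕ} {l₁ : ι₁ → σ →₀ ℕ} {l₀ : ι₀ → σ →₀ ℕ}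

lemma linearMap_apply_eq_sum {ι ι' : Type*} [Fintype ι] {R : Type*} [CommRing R]
    (f : (ι →₀ R) →ₗ[R] (ι' →₀ R)) (z : ι →₀ R) (G : ι') :
    f z G = ∑ F, z F * f (single F 1) G := by
  conv_lhs => rw [← Finsupp.univ_sum_single z]
  rw [map_sum, Finsupp.finsetSum_apply]
  refine Finset.sum_congr rfl fun F _ => ?_
  rw [← mul_one (z F), ← smul_eq_mul, ← Finsupp.smul_single, map_smul, Finsupp.smul_apply,
    smul_eq_mul, smul_eq_mul, mul_one]

/-- Exponent subtraction is truncated, so exponents add up correctly only along comparable labels;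
`hA` and `hw` say that no other entries contribute. -/
lemma map_homogeneous {A : ι₂ → ι₁ → k}
    (f : (ι₂ →₀ MvPolynomial σ k) →ₗ[MvPolynomial σ k] (ι₁ →₀ MvPolynomial σ k))
    (hf : ∀ F G, f (single F 1) G = monomial (l₂ F - l₁ G) (A F G))
    (hA : ∀ F G, A F G ≠ 0 → l₁ G ≤ l₂ F) (c : σ →₀ ℕ) (w : ι₂ → k)
    (hw : ∀ F, w F ≠ 0 → l₂ F ≤ c) :
    f (homogeneous l₂ c w) = homogeneous l₁ c fun G => ∑ F, w F * A F G := by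
  ext1 G
  rw [linearMap_apply_eq_sum]
  simp only [homogeneous, Finsupp.equivFunOnFinite_symm_apply_apply, hf, monomial_mul]
  rw [map_sum]
  refine Finset.sum_congr rfl fun F _ => ?_
  by_cases h1 : w F = 0
  · simp [h1]
  by_cases h2 : A F G = 0
  · simp [h2]
  rw [tsub_add_tsub_cancel (hw F h1) (hA F G h2)]

lemma sum_strand_eq_zero {B : ι₁ → ι₀ → k}
    (g : (ι₁ →₀ MvPolynomial σ k) →ₗ[MvPolynomial σ k] (ι₀ →₀ MvPolynomial σ k))
    (hg : ∀ G H, g (single G 1) H = monomial (l₁ G - l₀ H) (B G H))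
    (hB : ∀ G H, B G H ≠ 0 → l₀ H ≤ l₁ G) {z : ι₁ →₀ MvPolynomial σ k} (hz : g z = 0)
    (c : σ →₀ ℕ) (H : ι₀) : ∑ G, strand l₁ c z G * B G H = 0 := by
  by_cases hH : l₀ H ≤ c
  · have h := congrArg (coeff (c - l₀ H)) (DFunLike.congr_fun hz H)
    rw [linearMap_apply_eq_sum, coeff_sum, Finsupp.zero_apply, coeff_zero] at h
    rw [← h]
    refine Finset.sum_congr rfl fun G _ => ?_
    rw [hg, coeff_mul_monomial']
    by_cases h2 : B G H = 0
    · simp [h2]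
    have h3 := hB G H h2
    have h4 : l₁ G - l₀ H ≤ c - l₀ H ↔ l₁ G ≤ c := by
      rw [tsub_le_iff_right, tsub_add_cancel_of_le hH]
    simp only [strand, h4]
    split_ifs with h5
    · rw [tsub_tsub_tsub_cancel_right h3]
    · rw [zero_mul]
  · refine Finset.sum_eq_zero fun G _ => ?_
    by_cases h2 : B G H = 0
    · simp [h2]
    have h5 : ¬ l₁ G ≤ c := fun h => hH ((hB G H h2).trans h)
    simp [strand, h5]

/-- A labelled complex is exact if in every degree `c` the complex over the field of the faces with
labels dividing `c` is exact. -/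
theorem exact_of_strands {A : ι₂ → ι₁ → k} {B : ι₁ → ι₀ → k}
    (f : (ι₂ →₀ MvPolynomial σ k) →ₗ[MvPolynomial σ k] (ι₁ →₀ MvPolynomial σ k))
    (g : (ι₁ →₀ MvPolynomial σ k) →ₗ[MvPolynomial σ k] (ι₀ →₀ MvPolynomial σ k))
    (hf : ∀ F G, f (single F 1) G = monomial (l₂ F - l₁ G) (A F G))
    (hg : ∀ G H, g (single G 1) H = monomial (l₁ G - l₀ H) (B G H))
    (hA : ∀ F G, A F G ≠ 0 → l₁ G ≤ l₂ F) (hB : ∀ G H, B G H ≠ 0 → l₀ H ≤ l₁ G)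
    (hAB : ∀ F H, ∑ G, A F G * B G H = 0)
    (hex : ∀ (c : σ →₀ ℕ) (z : ι₁ → k), (∀ G, z G ≠ 0 → l₁ G ≤ c) →
      (∀ H, ∑ G, z G * B G H = 0) →
      ∃ w : ι₂ → k, (∀ F, w F ≠ 0 → l₂ F ≤ c) ∧ ∀ G, ∑ F, w F * A F G = z G) :
    Function.Exact f g := by
  intro z
  constructor
  · intro hz
    obtain ⟨D, hD⟩ := exists_eq_sum_homogeneous l₁ z
    have hstr : ∀ c G, strand l₁ c z G ≠ 0 → l₁ G ≤ c := by
      intro c G h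
      by_contra hc
      exact h (by simp [strand, hc])
    choose w hw hw' using fun c => hex c (strand l₁ c z) (hstr c) (sum_strand_eq_zero g hg hB hz c)
    refine ⟨∑ c ∈ D, homogeneous l₂ c (w c), ?_⟩
    rw [map_sum]
    conv_rhs => rw [hD]
    refine Finset.sum_congr rfl fun c _ => ?_
    rw [map_homogeneous f hf hA c (w c) (hw c)]
    congr 1
    funext G
    exact hw' c G
  · rintro ⟨w, rfl⟩
    suffices h : g ∘ₗ f = 0 from LinearMap.congr_fun h w
    refine Finsupp.lhom_ext' fun F => LinearMap.ext_ring ?_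
    ext1 H
    simp only [LinearMap.comp_apply, Finsupp.lsingle_apply, LinearMap.zero_apply,
      Finsupp.zero_apply]
    rw [linearMap_apply_eq_sum]
    have : ∀ G, f (single F 1) G * g (single G 1) H =
        monomial (l₂ F - l₀ H) (A F G * B G H) := by
      intro G
      rw [hf, hg, monomial_mul]
      by_cases h1 : A F G = 0
      · simp [h1]
      by_cases h2 : B G H = 0
      · simp [h2]
      rw [tsub_add_tsub_cancel (hA F G h1) (hB G H h2)]
    simp only [this]
    rw [← map_sum, hAB, map_zero]

end Strands

/-! ### The cellular complexes of bounded subdivided simplices -/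

section Resolution

open Finsupp (single)
open MvPolynomial

variable {k : Type*} [Field k] {n e : ℕ} {β : Fin n → ℕ}

lemma finite_bounded (e : ℕ) (β : Fin n → ℕ) : (bounded (subdividedSimplex n e) β).Finite := by
  refine (((Set.finite_Iic β).prod (Set.finite_univ (α := Finset (Fin n)))).image
    (cellSet e)).subset ?_
  intro F hF
  obtain ⟨x, hx, hb, rfl⟩ := mem_bounded.1 hF
  exact ⟨x, ⟨le_trans (fun i => Nat.le_add_right _ _) hb, Set.mem_univ _⟩, rfl⟩

lemma finite_face {X : Set (Set (Fin n → ℝ))} (hX : X.Finite) (p : ℕ) : Finite (Face X p) :=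
  ((hX.insert ∅).subset (t := {F | (F = ∅ ∨ F ∈ X) ∧ faceRank F = p})
    fun _ hF => hF.1).to_subtype

instance (e : ℕ) (β : Fin n → ℕ) (p : ℕ) :
    Finite (Face (bounded (subdividedSimplex n e) β) p) :=
  finite_face (finite_bounded e β) p

noncomputable instance (e : ℕ) (β : Fin n → ℕ) (p : ℕ) :
    Fintype (Face (bounded (subdividedSimplex n e) β) p) :=
  Fintype.ofFinite _

/-! #### Faces and cubes -/

lemma faceRank_empty : faceRank (∅ : Set (Fin n → ℝ)) = 0 := by simp [faceRank]

lemma exists_cube {p : ℕ} (F : Face (bounded (subdividedSimplex n e) β) (p + 1)) :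
    ∃ x : Cube n, IsCell e x ∧ x.top ≤ β ∧ F.1 = cellSet e x ∧ max 1 x.2.card = p + 1 := by
  obtain ⟨F, hF | hF, hr⟩ := F
  · rw [hF, faceRank_empty] at hr
    omega
  · obtain ⟨x, hx, hb, rfl⟩ := mem_bounded.1 hF
    exact ⟨x, hx, hb, rfl, (faceRank_cellSet hx).symm.trans hr⟩

/-- The cube whose slice is the given face. -/
noncomputable def cube {p : ℕ} (F : Face (bounded (subdividedSimplex n e) β) (p + 1)) : Cube n :=
  (exists_cube F).choose

section

variable {p : ℕ} (F : Face (bounded (subdividedSimplex n e) β) (p + 1))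

lemma isCell_cube : IsCell e (cube F) := (exists_cube F).choose_spec.1

lemma top_cube_le : (cube F).top ≤ β := (exists_cube F).choose_spec.2.1

lemma eq_cellSet_cube : F.1 = cellSet e (cube F) := (exists_cube F).choose_spec.2.2.1

lemma max_card_cube : max 1 (cube F).2.card = p + 1 := (exists_cube F).choose_spec.2.2.2

end

/-- No integer lies strictly between |a| and |a| + 1. This gap is why the rank equals |T| in
positive dimension while vertices have T empty. -/
lemma card_ne_one {x : Cube n} (hx : IsCell e x) : x.2.card ≠ 1 := by
  rcases hx with ⟨h, -⟩ | h
  · simp [h]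
  · omega

lemma card_cube {p : ℕ} (F : Face (bounded (subdividedSimplex n e) β) (p + 2)) :
    (cube F).2.card = p + 2 := by
  have := max_card_cube F
  omega

lemma cube_vertex (F : Face (bounded (subdividedSimplex n e) β) 1) : (cube F).2 = ∅ := by
  have h1 := max_card_cube F
  have h2 := card_ne_one (isCell_cube F)
  exact Finset.card_eq_zero.1 (by omega)

lemma label_face {p : ℕ} (F : Face (bounded (subdividedSimplex n e) β) (p + 1)) :
    label (bounded (subdividedSimplex n e) β) F.1 = (cube F).top := by
  rw [eq_cellSet_cube F, label_bounded (isCell_cube F) (top_cube_le F)]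

lemma cube_injective {p : ℕ} :
    Function.Injective (cube : Face (bounded (subdividedSimplex n e) β) (p + 1) → Cube n) :=
  fun F G h => Subtype.ext (by rw [eq_cellSet_cube F, eq_cellSet_cube G, h])

lemma exists_face {p : ℕ} {x : Cube n} (hx : IsCell e x) (hb : x.top ≤ β)
    (hc : max 1 x.2.card = p + 1) :
    ∃ F : Face (bounded (subdividedSimplex n e) β) (p + 1), cube F = x := by
  let F : Face (bounded (subdividedSimplex n e) β) (p + 1) :=
    ⟨cellSet e x, Or.inr (mem_bounded.2 ⟨x, hx, hb, rfl⟩), (faceRank_cellSet hx).trans hc⟩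
  exact ⟨F, cellSet_injective (isCell_cube F) hx (eq_cellSet_cube F).symm⟩

lemma isCell_of_between {c : Fin n → ℕ} {x : Cube n} (hx : x ∈ between e c) : IsCell e x :=
  Or.inr hx.2

lemma cube_mem_between {p : ℕ} (F : Face (bounded (subdividedSimplex n e) β) (p + 2))
    {c : Fin n → ℕ} (hc : (cube F).top ≤ c) : cube F ∈ between e c ∩ ofDim n (p + 2) := by
  refine ⟨⟨hc, ?_⟩, card_cube F⟩
  rcases isCell_cube F with ⟨h, -⟩ | h
  · have := card_cube F
    rw [h, Finset.card_empty] at this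
    omega
  · exact h

lemma exists_face_of_between {p : ℕ} {x : Cube n} (hx : x ∈ between e β ∩ ofDim n (p + 2)) :
    ∃ F : Face (bounded (subdividedSimplex n e) β) (p + 2), cube F = x := by
  have h : x.2.card = p + 2 := hx.2
  exact exists_face (isCell_of_between hx.1) hx.1.1 (by omega)

/-- The chain of cubes of a combination of faces. -/
noncomputable def chainOf {p : ℕ} (z : Face (bounded (subdividedSimplex n e) β) (p + 1) → k) :
    Cube n →₀ k := ∑ F, z F • single (cube F) 1

lemma chainOf_apply {p : ℕ} (z : Face (bounded (subdividedSimplex n e) β) (p + 1) → k)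
    (F : Face (bounded (subdividedSimplex n e) β) (p + 1)) : chainOf z (cube F) = z F := by
  rw [chainOf, Finsupp.finsetSum_apply, Finset.sum_eq_single F]
  · simp
  · intro G _ hG
    have : cube G ≠ cube F := fun h => hG (cube_injective h)
    simp [this]
  · simp

lemma chainOf_mem_supported {p : ℕ} {z : Face (bounded (subdividedSimplex n e) β) (p + 1) → k}
    {S : Set (Cube n)} (h : ∀ F, z F ≠ 0 → cube F ∈ S) :
    chainOf z ∈ Finsupp.supported k k S := by
  refine sum_mem fun F _ => ?_
  by_cases hz : z F = 0
  · rw [hz, zero_smul]; exact zero_mem _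
  · exact Submodule.smul_mem _ _ (Finsupp.single_mem_supported k _ (h F hz))

lemma chainOf_comp_cube {p : ℕ} {w : Cube n →₀ k} {S : Set (Cube n)}
    (hw : w ∈ Finsupp.supported k k S)
    (hS : ∀ x ∈ S, ∃ F : Face (bounded (subdividedSimplex n e) β) (p + 1), cube F = x) :
    chainOf (fun F : Face (bounded (subdividedSimplex n e) β) (p + 1) => w (cube F)) = w := by
  ext x
  by_cases hx : ∃ F : Face (bounded (subdividedSimplex n e) β) (p + 1), cube F = x
  · obtain ⟨F, rfl⟩ := hx
    exact chainOf_apply _ F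
  · rw [eq_zero_of_mem_supported hw fun h => hx (hS x h)]
    exact eq_zero_of_mem_supported (chainOf_mem_supported (S := Set.range cube)
      fun F _ => ⟨F, rfl⟩) hx

lemma map_chainOf_apply {p : ℕ} (φ : (Cube n →₀ k) →ₗ[k] (Cube n →₀ k))
    (z : Face (bounded (subdividedSimplex n e) β) (p + 1) → k) (y : Cube n) :
    φ (chainOf z) y = ∑ F, z F * φ (single (cube F) 1) y := by
  simp only [chainOf, map_sum, map_smul, Finsupp.finsetSum_apply, Finsupp.smul_apply, smul_eq_mul]

/-! #### The matrix of the differential -/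

open Classical in
/-- The incidence numbers of the faces of a complex. -/
noncomputable def incidenceMatrix (k : Type*) [Field k] {X : Set (Set (Fin n → ℝ))} {p : ℕ}
    (F : Face X (p + 1)) (G : Face X p) : k :=
  if G.1 ⊆ F.1 then ((incidence G.1 F.1 : ℤ) : k) else 0

/-- The label of a face as an exponent. -/
noncomputable def exponent {X : Set (Set (Fin n → ℝ))} {p : ℕ} (F : Face X p) : Fin n →₀ ℕ :=
  Finsupp.equivFunOnFinite.symm (label X F.1)

lemma boundary_single (k : Type*) [Field k] {X : Set (Set (Fin n → ℝ))} (p : ℕ)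
    (F : Face X (p + 1)) : boundary k X p (single F 1) =
      ∑ᶠ G : {G : Face X p // G.1 ⊆ F.1}, single G.1
        ((incidence G.1.1 F.1 : MvPolynomial (Fin n) k) *
          mono k (label X F.1 - label X G.1.1)) := by
  rw [boundary, Finsupp.linearCombination_single, one_smul]

lemma boundary_single_apply {X : Set (Set (Fin n → ℝ))} (hX : X.Finite) {p : ℕ}
    (F : Face X (p + 1)) (G : Face X p) :
    boundary k X p (single F 1) G =
      monomial (exponent F - exponent G) (incidenceMatrix k F G) := by
  classical
  have := finite_face hX p
  have : Fintype {G : Face X p // G.1 ⊆ F.1} := Fintype.ofFinite _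
  have hm : ∀ G : Face X p, ((incidence G.1 F.1 : MvPolynomial (Fin n) k) *
      mono k (label X F.1 - label X G.1)) =
      monomial (exponent F - exponent G) ((incidence G.1 F.1 : ℤ) : k) := by
    intro G
    have h1 : Finsupp.equivFunOnFinite.symm (label X F.1 - label X G.1) =
        exponent F - exponent G := by ext; rfl
    rw [mono, h1, ← map_intCast (C : k →+* MvPolynomial (Fin n) k), C_mul_monomial, mul_one]
  rw [boundary_single, finsum_eq_sum_of_fintype, Finsupp.finsetSum_apply]
  by_cases h : G.1 ⊆ F.1
  · rw [Finset.sum_eq_single ⟨G, h⟩]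
    · simp only [Finsupp.single_eq_same, hm, incidenceMatrix, h, if_true]
    · intro G' _ hG'
      exact Finsupp.single_eq_of_ne' fun h' => hG' (Subtype.ext h')
    · simp
  · rw [incidenceMatrix, if_neg h, map_zero]
    refine Finset.sum_eq_zero fun G' _ => Finsupp.single_eq_of_ne' ?_
    rintro rfl
    exact h G'.2

lemma exponent_le_iff {X : Set (Set (Fin n → ℝ))} {p q : ℕ} {F : Face X p} {G : Face X q} :
    exponent G ≤ exponent F ↔ label X G.1 ≤ label X F.1 := Iff.rfl

lemma incidenceMatrix_eq_cubeBd {p : ℕ}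
    (F : Face (bounded (subdividedSimplex n e) β) (p + 3))
    (G : Face (bounded (subdividedSimplex n e) β) (p + 2)) :
    incidenceMatrix k F G = cubeBd k n (single (cube F) 1) (cube G) := by
  rw [incidenceMatrix, eq_cellSet_cube F, eq_cellSet_cube G]
  split_ifs with h
  · rw [cubeBd_apply_of_subset (isCell_cube F) (isCell_cube G) _ h]
    rw [card_cube F, card_cube G]
  · rw [cubeBd_apply_of_not_subset (isCell_cube G) h]

/-- From edges to vertices the number of free coordinates drops by two, so the differential is the
connecting map instead of the cubical boundary. -/
lemma incidenceMatrix_eq_cubeBd_lower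
    (F : Face (bounded (subdividedSimplex n e) β) 2)
    (G : Face (bounded (subdividedSimplex n e) β) 1) :
    incidenceMatrix k F G = cubeBd k n (lower k n (single (cube F) 1)) (cube G) := by
  rw [incidenceMatrix, eq_cellSet_cube F, eq_cellSet_cube G]
  split_ifs with h
  · rw [cubeBd_lower_apply_of_subset (isCell_cube F) (isCell_cube G) (card_cube F)
      (cube_vertex G) h]
  · rw [cubeBd_lower_apply_of_not_subset (isCell_cube G) (card_cube F) h]

lemma faceRank_ne_zero {F : Set (Fin n → ℝ)} (hF : F ∈ bounded (subdividedSimplex n e) β) :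
    faceRank F ≠ 0 := by
  obtain ⟨x, hx, -, rfl⟩ := mem_bounded.1 hF
  rw [faceRank_cellSet hx]
  omega

lemma eq_emptyFace (G : Face (bounded (subdividedSimplex n e) β) 0) :
    G = emptyFace (bounded (subdividedSimplex n e) β) := by
  obtain ⟨G, rfl | hG, hr⟩ := G
  · rfl
  · exact absurd hr (faceRank_ne_zero hG)

lemma incidenceMatrix_vertex (F : Face (bounded (subdividedSimplex n e) β) 1)
    (G : Face (bounded (subdividedSimplex n e) β) 0) : incidenceMatrix k F G = 1 := by
  have hG : G.1 = ∅ := congrArg Subtype.val (eq_emptyFace G)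
  rw [incidenceMatrix, hG, eq_cellSet_cube F, if_pos (Set.empty_subset _),
    incidence_empty_vertex (isCell_cube F) (cube_vertex F),
    Int.cast_one]

lemma label_le_of_incidenceMatrix_ne_zero {p : ℕ}
    {F : Face (bounded (subdividedSimplex n e) β) (p + 1)}
    {G : Face (bounded (subdividedSimplex n e) β) p} (h : incidenceMatrix k F G ≠ 0) :
    exponent G ≤ exponent F := by
  rw [exponent_le_iff]
  rw [incidenceMatrix] at h
  have hs : G.1 ⊆ F.1 := by
    by_contra hs
    exact h (if_neg hs)
  cases p with
  | zero =>
    rw [eq_emptyFace G]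
    change label _ ∅ ≤ _
    rw [label_empty]
    exact fun _ => Nat.zero_le _
  | succ p =>
    rw [label_face, label_face]
    rw [eq_cellSet_cube F, eq_cellSet_cube G] at hs
    exact ((cellSet_subset_iff (isCell_cube G)).1 hs).2

/-- With `exponent_le` this identifies the strand of degree `c` with the cells in the box [0, β ⊓
c]. -/
lemma top_le_inf {p : ℕ} {F : Face (bounded (subdividedSimplex n e) β) (p + 1)}
    {c : Fin n →₀ ℕ} (h : exponent F ≤ c) : (cube F).top ≤ β ⊓ c := by
  refine le_inf (top_cube_le F) ?_
  rw [← label_face]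
  exact h

lemma exponent_le {p : ℕ} {F : Face (bounded (subdividedSimplex n e) β) (p + 1)}
    {c : Fin n →₀ ℕ} (h : (cube F).top ≤ β ⊓ c) : exponent F ≤ c := by
  have h' : label (bounded (subdividedSimplex n e) β) F.1 ≤ (c : Fin n → ℕ) := by
    rw [label_face]
    exact h.trans inf_le_right
  exact h'

lemma between_mono {c c' : Fin n → ℕ} (h : c ≤ c') : between e c ⊆ between e c' :=
  fun _ hx => ⟨hx.1.trans h, hx.2⟩

/-- A chain of cubes of positive dimension in a box comes from a combination of faces. -/
lemma exists_faces {p : ℕ} {c : Fin n →₀ ℕ} {W : Cube n →₀ k}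
    (hW : W ∈ Finsupp.supported k k (between e (β ⊓ c) ∩ ofDim n (p + 2))) :
    ∃ w : Face (bounded (subdividedSimplex n e) β) (p + 2) → k,
      (∀ F, w F ≠ 0 → exponent F ≤ c) ∧ chainOf w = W := by
  refine ⟨fun F => W (cube F), fun F hF => exponent_le ?_, chainOf_comp_cube hW fun x hx =>
    exists_face_of_between ⟨between_mono inf_le_left hx.1, hx.2⟩⟩
  by_contra h
  exact hF (eq_zero_of_mem_supported hW fun hx => h hx.1.1)

lemma chainOf_mem_between {p : ℕ} {c : Fin n →₀ ℕ}
    {z : Face (bounded (subdividedSimplex n e) β) (p + 2) → k}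
    (hz : ∀ F, z F ≠ 0 → exponent F ≤ c) :
    chainOf z ∈ Finsupp.supported k k (between e (β ⊓ c) ∩ ofDim n (p + 2)) :=
  chainOf_mem_supported fun F hF => cube_mem_between F (top_le_inf (hz F hF))

lemma chainOf_mem_between' {p : ℕ} (z : Face (bounded (subdividedSimplex n e) β) (p + 2) → k) :
    chainOf z ∈ Finsupp.supported k k (between e β ∩ ofDim n (p + 2)) :=
  chainOf_mem_supported fun F _ => cube_mem_between F (top_cube_le F)

lemma single_cube_mem_between {p : ℕ} (F : Face (bounded (subdividedSimplex n e) β) (p + 2)) :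
    single (cube F) (1 : k) ∈ Finsupp.supported k k (between e β ∩ ofDim n (p + 2)) :=
  Finsupp.single_mem_supported k _ (cube_mem_between F (top_cube_le F))

lemma chainOf_incidenceMatrix_apply {p : ℕ}
    (F : Face (bounded (subdividedSimplex n e) β) (p + 3)) :
    ∀ x ∈ between e β ∩ ofDim n (p + 2),
      chainOf (incidenceMatrix k F) x = cubeBd k n (single (cube F) 1) x := by
  intro x hx
  obtain ⟨G, rfl⟩ := exists_face_of_between hx
  rw [chainOf_apply, incidenceMatrix_eq_cubeBd]

/-- From ∂∂Z = 0, the boundary of the lower part is minus that of the upper part; so it lies on both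
sides and is supported on vertices of the hyperplane. -/
lemma cubeBd_lower_mem_supported {c : Fin n → ℕ} {Z : Cube n →₀ k}
    (hZ : Z ∈ Finsupp.supported k k (between e c ∩ ofDim n 2)) {x : Cube n}
    (hx : ¬ (x.2 = ∅ ∧ ∑ i, x.1 i = e ∧ x.top ≤ c)) : cubeBd k n (lower k n Z) x = 0 := by
  have hA := cubeBd_mem_below (t := 0) (lower_mem_below hZ)
  have hB : cubeBd k n (lower k n Z) ∈ Finsupp.supported k k (above e c ∩ ofDim n 0) := by
    have h1 := cubeBd_cubeBd Z
    rw [cubeBd, LinearMap.add_apply (upper k n) _ Z, ← cubeBd, map_add] at h1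
    rw [eq_neg_of_add_eq_zero_right h1]
    exact neg_mem (cubeBd_mem_above (upper_mem_above hZ))
  by_cases h1 : x ∈ below e c ∩ ofDim n 0
  · refine eq_zero_of_mem_supported hB fun h2 => hx ⟨Finset.card_eq_zero.1 h1.2, ?_, h1.1.1⟩
    have h3 := h1.1.2
    have h4 := h2.1.2
    omega
  · exact eq_zero_of_mem_supported hA h1

/-- The cases `0`, `1` and `q + 2` are exactness at vertices, at edges and in higher dimension. They
differ in whether augmentation, connecting map or cubical boundary occurs. -/
theorem boundary_exact (k : Type*) [Field k] (e : ℕ) (β : Fin n → ℕ) (p : ℕ) :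
    Function.Exact (boundary k (bounded (subdividedSimplex n e) β) (p + 1))
      (boundary k (bounded (subdividedSimplex n e) β) p) := by
  refine exact_of_strands (l₂ := exponent) (l₁ := exponent) (l₀ := exponent)
    (A := incidenceMatrix k) (B := incidenceMatrix k) _ _
    (boundary_single_apply (finite_bounded e β)) (boundary_single_apply (finite_bounded e β))
    (fun F G => label_le_of_incidenceMatrix_ne_zero)
    (fun F G => label_le_of_incidenceMatrix_ne_zero) ?_ ?_
  · intro F H
    match p with
    | 0 =>
      have h := augmentation_cubeBd (lower k n (single (cube F) (1 : k)))
      have h2 : chainOf (incidenceMatrix k F) = cubeBd k n (lower k n (single (cube F) (1 : k))) := by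
        ext x
        by_cases hx : ∃ G : Face (bounded (subdividedSimplex n e) β) 1, cube G = x
        · obtain ⟨G, rfl⟩ := hx
          rw [chainOf_apply, incidenceMatrix_eq_cubeBd_lower]
        · rw [cubeBd_lower_mem_supported (single_cube_mem_between F)
            fun h => hx (exists_face (Or.inl ⟨h.1, h.2.1⟩) h.2.2 (by simp [h.1]))]
          exact eq_zero_of_mem_supported (chainOf_mem_supported (S := Set.range cube)
            fun F _ => ⟨F, rfl⟩) hx
      rw [← h2] at h
      simpa [chainOf, augmentation, incidenceMatrix_vertex] using h
    | 1 =>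
      have h := cubeBd_lower_trace_eq_zero (single_cube_mem_between F)
        (chainOf_mem_between' (incidenceMatrix k F)) (chainOf_incidenceMatrix_apply F)
      have h1 := DFunLike.congr_fun h (cube H)
      rw [← LinearMap.comp_apply, map_chainOf_apply] at h1
      simpa [incidenceMatrix_eq_cubeBd_lower] using h1
    | q + 2 =>
      have h := cubeBd_trace_eq_zero (single_cube_mem_between F)
        (chainOf_mem_between' (incidenceMatrix k F)) (chainOf_incidenceMatrix_apply F)
        (cube H) (cube_mem_between H (top_cube_le H)).1
      rw [map_chainOf_apply] at h
      simpa [incidenceMatrix_eq_cubeBd] using h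
  · intro c z hz hz0
    match p with
    | 0 =>
      have hsup : chainOf z ∈ Finsupp.supported k k
          (below e (β ⊓ c) ∩ above e (β ⊓ c) ∩ ofDim n 0) := by
        refine chainOf_mem_supported fun F hF => ?_
        have h1 := top_le_inf (hz F hF)
        have h2 := cube_vertex F
        have h3 : ∑ i, (cube F).1 i = e := by
          rcases isCell_cube F with h | h
          · exact h.2
          · rw [h2, Finset.card_empty] at h; omega
        exact ⟨⟨⟨h1, by simp [h2, h3]⟩, ⟨h1, h3.ge⟩⟩, Finset.card_eq_zero.2 h2⟩
      have haug : augmentation k n (chainOf z) = 0 := by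
        have := hz0 (emptyFace _)
        simpa [chainOf, augmentation, incidenceMatrix_vertex] using this
      obtain ⟨W, hW, hW'⟩ := exists_edges_of_vertices hsup haug
      obtain ⟨w, hw, rfl⟩ := exists_faces hW
      refine ⟨w, hw, fun G => ?_⟩
      rw [← chainOf_apply z G, ← hW', ← LinearMap.comp_apply, map_chainOf_apply]
      simp [incidenceMatrix_eq_cubeBd_lower]
    | 1 =>
      have h : cubeBd k n (lower k n (chainOf z)) = 0 := by
        ext x
        by_cases hx : x.2 = ∅ ∧ ∑ i, x.1 i = e ∧ x.top ≤ β
        · obtain ⟨H, rfl⟩ : ∃ H : Face (bounded (subdividedSimplex n e) β) 1, cube H = x :=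
            exists_face (Or.inl ⟨hx.1, hx.2.1⟩) hx.2.2 (by simp [hx.1])
          rw [← LinearMap.comp_apply, map_chainOf_apply, Finsupp.zero_apply, ← hz0 H]
          simp [incidenceMatrix_eq_cubeBd_lower]
        · exact cubeBd_lower_mem_supported (chainOf_mem_between' z) hx
      obtain ⟨W, hW, hW'⟩ := exists_between_of_edge_cycle (chainOf_mem_between hz) h
      obtain ⟨w, hw, rfl⟩ := exists_faces hW
      refine ⟨w, hw, fun G => ?_⟩
      by_cases hG : cube G ∈ between e (β ⊓ c)
      · rw [← chainOf_apply z G, ← hW' _ hG, map_chainOf_apply]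
        simp [incidenceMatrix_eq_cubeBd]
      -- Outside the box of degree `c` both sides vanish: a facet of a face with label dividing `c`
      -- has a label dividing `c` as well.
      · have h0 : z G = 0 := by
          by_contra h0
          exact hG (cube_mem_between G (top_le_inf (hz G h0))).1
        rw [h0]
        refine Finset.sum_eq_zero fun F _ => ?_
        by_contra hF
        have h1 := hw F (left_ne_zero_of_mul hF)
        have h2 := label_le_of_incidenceMatrix_ne_zero (right_ne_zero_of_mul hF)
        exact hG (cube_mem_between G (top_le_inf (h2.trans h1))).1
    | q + 2 =>
      have h : ∀ x ∈ between e (β ⊓ c) ∩ ofDim n (q + 2), cubeBd k n (chainOf z) x = 0 := by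
        intro x hx
        obtain ⟨H, rfl⟩ := exists_face_of_between ⟨between_mono inf_le_left hx.1, hx.2⟩
        rw [map_chainOf_apply, ← hz0 H]
        simp [incidenceMatrix_eq_cubeBd]
      obtain ⟨W, hW, hW'⟩ := exists_between_of_cycle (chainOf_mem_between hz) h
      obtain ⟨w, hw, rfl⟩ := exists_faces hW
      refine ⟨w, hw, fun G => ?_⟩
      by_cases hG : cube G ∈ between e (β ⊓ c)
      · rw [← chainOf_apply z G, ← hW' _ hG, map_chainOf_apply]
        simp [incidenceMatrix_eq_cubeBd]
      · have h0 : z G = 0 := by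
          by_contra h0
          exact hG (cube_mem_between G (top_le_inf (hz G h0))).1
        rw [h0]
        refine Finset.sum_eq_zero fun F _ => ?_
        by_contra hF
        have h1 := hw F (left_ne_zero_of_mul hF)
        have h2 := label_le_of_incidenceMatrix_ne_zero (right_ne_zero_of_mul hF)
        exact hG (cube_mem_between G (top_le_inf (h2.trans h1))).1

end Resolution

/-! ### Powers of bounded ideals -/

section Powers

open Finsupp (single)

variable {n : ℕ}

/-- Starting at `L`, raise one coordinate at a time below `U` until the degree is `d`. -/
lemma exists_between_of_sum (L : Fin n → ℕ) (d : ℕ) (hL : ∑ i, L i ≤ d) :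
    ∀ U : Fin n → ℕ, L ≤ U → d ≤ ∑ i, U i → ∃ u, L ≤ u ∧ u ≤ U ∧ ∑ i, u i = d := by
  obtain ⟨s, rfl⟩ := Nat.exists_eq_add_of_le hL
  clear hL
  induction s with
  | zero => exact fun U hLU _ => ⟨L, le_rfl, hLU, rfl⟩
  | succ s ih =>
    intro U hLU hU
    obtain ⟨u, h1, h2, h3⟩ := ih U hLU (by omega)
    obtain ⟨i, hi⟩ : ∃ i, u i < U i := by
      by_contra hno
      push Not at hno
      have : ∑ i, U i ≤ ∑ i, u i := Finset.sum_le_sum fun i _ => hno i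
      omega
    refine ⟨raise i u, h1.trans (le_raise i u), fun j => ?_, by rw [sum_raise, h3]; rfl⟩
    rcases eq_or_ne j i with rfl | hj
    · simpa [raise] using hi
    · simpa [raise, hj] using h2 j

/-- One generator can be split off from a pair of vectors of nearly the right degree. -/
lemma exists_gen_between {d m : ℕ} {b f g : Fin n → ℕ} (hfg' : f ≤ g) (hg : g ≤ (m + 1) • b)
    (hfg : g ≤ f + m • b) (hf' : (m + 1) * d < ∑ i, f i + (m + 1))
    (hg' : ∑ i, g i < (m + 1) * d + (m + 1)) :
    ∃ u ∈ gens n d b, u ≤ f ∧ g ≤ m • b + u := by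
  have hgi : ∀ i, g i ≤ m * b i + b i := fun i => by
    have : g i ≤ (m + 1) * b i := hg i
    linarith
  have hfgi : ∀ i, g i ≤ f i + m * b i := fun i => hfg i
  -- The conditions on u are max(0, g - mb) ≤ u ≤ min(f, b). Since g ≤ (m + 1)b, the lower bound is
  -- at most g / (m + 1), so its degree is less than d + 1.
  obtain ⟨u, h1, h2, h3⟩ := exists_between_of_sum (fun i => g i - m * b i) d (by
      have h : (m + 1) * ∑ i, (g i - m * b i) ≤ ∑ i, g i := by
        rw [Finset.mul_sum]
        refine Finset.sum_le_sum fun i _ => ?_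
        rcases le_total (g i) (m * b i) with h | h
        · simp [Nat.sub_eq_zero_of_le h]
        · obtain ⟨t, ht⟩ := Nat.exists_eq_add_of_le h
          have h5 := hgi i
          rw [ht, Nat.add_sub_cancel_left]
          have h4 : t ≤ b i := by omega
          nlinarith
      have h' : (m + 1) * ∑ i, (g i - m * b i) < (m + 1) * (d + 1) := by
        rw [mul_add, mul_one]; omega
      have := Nat.lt_of_mul_lt_mul_left h'
      omega)
    -- Since f ≤ g ≤ (m + 1)b, the upper bound is at least f / (m + 1), so its degree exceeds d - 1.
    (fun i => min (f i) (b i)) (by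
      intro i
      have h4 := hgi i
      have h5 := hfgi i
      simp only [le_inf_iff]
      constructor <;> omega) (by
      have h : ∑ i, f i ≤ (m + 1) * ∑ i, min (f i) (b i) := by
        rw [Finset.mul_sum]
        refine Finset.sum_le_sum fun i _ => ?_
        have h4 := hgi i
        have h5 := hfgi i
        rcases le_total (f i) (b i) with h | h
        · rw [min_eq_left h]; nlinarith
        · have h6 : f i ≤ g i := hfg' i
          rw [min_eq_right h]
          linarith
      have h' : (m + 1) * d < (m + 1) * (∑ i, min (f i) (b i) + 1) := by
        rw [mul_add, mul_one]; omega
      have := Nat.lt_of_mul_lt_mul_left h'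
      omega)
  refine ⟨u, ⟨h3, fun i => (h2 i).trans (min_le_right _ _)⟩,
    fun i => (h2 i).trans (min_le_left _ _), fun i => ?_⟩
  have h4 : g i - m * b i ≤ u i := h1 i
  change g i ≤ m * b i + u i
  omega

open Pointwise

variable {k : Type*} [Field k]

lemma mono_add (k : Type*) [Field k] (a c : Fin n → ℕ) : mono k (a + c) = mono k a * mono k c := by
  rw [mono, mono, mono, MvPolynomial.monomial_mul, one_mul]
  congr 2
  ext
  rfl

lemma gens_succ (d m : ℕ) (b : Fin n → ℕ) :
    gens n ((m + 1) * d) ((m + 1) • b) = gens n (m * d) (m • b) + gens n d b := by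
  ext a
  rw [Set.mem_add]
  constructor
  · rintro ⟨h1, h2⟩
    obtain ⟨u, hu, h3, h4⟩ := exists_gen_between (d := d) le_rfl h2 (fun i => Nat.le_add_right _ _)
      (by rw [h1]; omega) (by rw [h1]; omega)
    refine ⟨a - u, ⟨?_, tsub_le_iff_right.2 h4⟩, u, hu, tsub_add_cancel_of_le h3⟩
    have h5 : ∑ i, (a - u) i + ∑ i, u i = ∑ i, a i := by
      rw [← Finset.sum_add_distrib]
      exact Finset.sum_congr rfl fun i _ => congrFun (tsub_add_cancel_of_le h3) i
    rw [h1, hu.1, add_mul, one_mul] at h5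
    exact Nat.add_right_cancel h5
  · rintro ⟨v, ⟨h1, h2⟩, u, ⟨h3, h4⟩, rfl⟩
    refine ⟨?_, ?_⟩
    · simp only [Pi.add_apply, Finset.sum_add_distrib, h1, h3]
      ring
    · rw [add_smul, one_smul]
      exact add_le_add h2 h4

lemma boundedIdeal_pow (k : Type*) [Field k] (n d : ℕ) (b : Fin n → ℕ) (m : ℕ) :
    boundedIdeal k n d b ^ m = boundedIdeal k n (m * d) (m • b) := by
  induction m with
  | zero =>
    have : gens n (0 * d) (0 • b) = {0} := by
      ext a
      simp only [gens, zero_mul, zero_smul, Set.mem_ofPred_eq, Set.mem_singleton_iff]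
      constructor
      · rintro ⟨-, h⟩
        exact le_antisymm h fun _ => Nat.zero_le _
      · rintro rfl
        simp
    have h1 : mono k (0 : Fin n → ℕ) = 1 := by
      have : Finsupp.equivFunOnFinite.symm (0 : Fin n → ℕ) = 0 := by ext; rfl
      rw [mono, this]
      rfl
    rw [pow_zero, boundedIdeal, this, Set.image_singleton, h1, Ideal.span_singleton_one,
      Ideal.one_eq_top]
  | succ m ih =>
    rw [pow_succ, ih, boundedIdeal, boundedIdeal, boundedIdeal, Ideal.span_mul_span', gens_succ]
    congr 1
    ext q
    simp only [Set.mem_mul, Set.mem_add, Set.mem_image]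
    constructor
    · rintro ⟨_, ⟨a, ha, rfl⟩, _, ⟨c, hc, rfl⟩, rfl⟩
      exact ⟨a + c, ⟨a, ha, c, hc, rfl⟩, mono_add k a c⟩
    · rintro ⟨_, ⟨a, ha, c, hc, rfl⟩, rfl⟩
      exact ⟨_, ⟨a, ha, rfl⟩, _, ⟨c, hc, rfl⟩, (mono_add k a c).symm⟩

lemma boundary_single_vertex {e : ℕ} {β : Fin n → ℕ}
    (F : Face (bounded (subdividedSimplex n e) β) 1) :
    boundary k (bounded (subdividedSimplex n e) β) 0 (single F 1) (emptyFace _) =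
      mono k (cube F).1 := by
  rw [boundary_single_apply (finite_bounded e β), incidenceMatrix_vertex]
  have h1 : exponent (emptyFace (bounded (subdividedSimplex n e) β)) = 0 := by
    ext i
    exact congrFun (label_empty _) i
  have h2 : exponent F = Finsupp.equivFunOnFinite.symm (cube F).1 := by
    rw [exponent, label_face, Cube.top, cube_vertex F]
    ext i
    simp [ind]
  rw [h1, h2, tsub_zero, mono]

lemma range_eq_span_single {R ι M : Type*} [CommRing R] [AddCommGroup M] [Module R M]
    (f : (ι →₀ R) →ₗ[R] M) :
    LinearMap.range f = Submodule.span R (Set.range fun i => f (single i 1)) := by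
  rw [← Finsupp.range_linearCombination]
  congr 1
  refine Finsupp.lhom_ext' fun i => LinearMap.ext_ring ?_
  simp

lemma map_range_boundary (k : Type*) [Field k] (e : ℕ) (β : Fin n → ℕ) :
    Submodule.map (Finsupp.lapply (emptyFace (bounded (subdividedSimplex n e) β)))
      (LinearMap.range (boundary k (bounded (subdividedSimplex n e) β) 0)) =
      boundedIdeal k n e β := by
  rw [range_eq_span_single, Submodule.map_span, ← Set.range_comp, boundedIdeal, Ideal.span]
  congr 1
  ext q
  simp only [Set.mem_range, Set.mem_image, Function.comp_apply, Finsupp.lapply_apply,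
    boundary_single_vertex]
  constructor
  · rintro ⟨F, rfl⟩
    refine ⟨_, ⟨?_, (le_of_top_le (T := (cube F).2) (top_cube_le F))⟩, rfl⟩
    rcases isCell_cube F with h | h
    · exact h.2
    · rw [cube_vertex F, Finset.card_empty] at h; omega
  · rintro ⟨a, ⟨h1, h2⟩, rfl⟩
    obtain ⟨F, hF⟩ := exists_face (p := 0) (β := β) (x := (a, ∅)) (Or.inl ⟨rfl, h1⟩)
      (by rw [top_empty]; exact h2) (by simp)
    exact ⟨F, by rw [hF]⟩

theorem supportsResolution_bounded (k : Type*) [Field k] (e : ℕ) (β : Fin n → ℕ) :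
    SupportsResolution k (bounded (subdividedSimplex n e) β) (boundedIdeal k n e β) :=
  ⟨finite_bounded e β, boundary_exact k e β, map_range_boundary k e β⟩

lemma edgeIdeal_top (k : Type*) [Field k] (n : ℕ) :
    edgeIdeal k (⊤ : SimpleGraph (Fin n)) = boundedIdeal k n 2 fun _ => 1 := by
  have hX : ∀ i j : Fin n, i ≠ j →
      (MvPolynomial.X i * MvPolynomial.X j : MvPolynomial (Fin n) k) = mono k (ind {i, j}) := by
    intro i j hij
    rw [MvPolynomial.X, MvPolynomial.X, MvPolynomial.monomial_mul, one_mul, mono]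
    congr 2
    ext l
    simp only [Finsupp.add_apply, Finsupp.single_apply, Finsupp.equivFunOnFinite_symm_apply_apply,
      ind, Finset.mem_insert, Finset.mem_singleton, eq_comm (a := l)]
    split_ifs with h1 h2 h3 <;> simp_all
  rw [edgeIdeal, boundedIdeal]
  congr 1
  ext q
  simp only [SimpleGraph.top_adj, Set.mem_ofPred_eq, Set.mem_image, gens]
  constructor
  · rintro ⟨i, j, hij, rfl⟩
    refine ⟨ind {i, j}, ⟨by rw [sum_ind, Finset.card_pair hij], fun l => ?_⟩, (hX i j hij).symm⟩
    change (if l ∈ ({i, j} : Finset (Fin n)) then 1 else 0) ≤ 1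
    split_ifs
    · exact le_rfl
    · exact Nat.zero_le _
  · rintro ⟨a, ⟨h1, h2⟩, rfl⟩
    have ha : a = ind (Finset.univ.filter fun i => a i = 1) := by
      funext i
      have : a i ≤ 1 := h2 i
      simp only [ind, Finset.mem_filter, Finset.mem_univ, true_and]
      split_ifs <;> omega
    rw [ha, sum_ind] at h1
    obtain ⟨i, j, hij, h3⟩ := Finset.card_eq_two.1 h1
    rw [h3] at ha
    exact ⟨i, j, hij, by rw [hX i j hij, ← ha]⟩

end Powers

/-! ### Translations -/

section Translation

open Finsupp (single)

variable {k : Type*} [Field k] {n e e' : ℕ} {β β' u : Fin n → ℕ}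

lemma top_add (x : Cube n) (u : Fin n → ℕ) : Cube.top (x.1 + u, x.2) = x.top + u := by
  simp only [Cube.top]
  abel

lemma translate_cellSet (hu : e + ∑ i, u i = e') (x : Cube n) :
    translate u (cellSet e x) = cellSet e' (x.1 + u, x.2) := by
  have hu' : (e : ℝ) + ∑ i, (u i : ℝ) = e' := by exact_mod_cast hu
  ext z
  simp only [translate, Set.mem_image, cellSet, top_add, Pi.add_apply, Nat.cast_add,
    Set.mem_ofPred_eq]
  constructor
  · rintro ⟨y, ⟨hy, hy'⟩, rfl⟩
    simp only [toPt, Pi.add_apply, Finset.sum_add_distrib, hy, hu', add_le_add_iff_right]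
    exact ⟨trivial, hy'⟩
  · rintro ⟨hz, hz'⟩
    refine ⟨z - toPt u, ⟨?_, fun i => ?_⟩, sub_add_cancel _ _⟩
    · simp only [toPt, Pi.sub_apply, Finset.sum_sub_distrib, hz]
      linarith
    · simp only [toPt, Pi.sub_apply, le_sub_iff_add_le, sub_le_iff_le_add]
      exact hz' i

lemma isCell_add_iff (hu : e + ∑ i, u i = e') (x : Cube n) :
    IsCell e' (x.1 + u, x.2) ↔ IsCell e x := by
  simp only [IsCell, Pi.add_apply, Finset.sum_add_distrib]
  constructor
  · rintro (⟨h1, h2⟩ | h)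
    · exact Or.inl ⟨h1, by omega⟩
    · exact Or.inr (by omega)
  · rintro (⟨h1, h2⟩ | h)
    · exact Or.inl ⟨h1, by omega⟩
    · exact Or.inr (by omega)

lemma translate_injective (u : Fin n → ℕ) : Function.Injective (translate u) :=
  Set.image_injective.2 (add_left_injective (toPt u))

lemma translate_subset_iff {F G : Set (Fin n → ℝ)} :
    translate u G ⊆ translate u F ↔ G ⊆ F :=
  Set.image_subset_image_iff (add_left_injective (toPt u))

lemma freeCoords_translate (u : Fin n → ℕ) (F : Set (Fin n → ℝ)) :
    freeCoords (translate u F) = freeCoords F := by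
  ext i
  simp only [freeCoords, Finset.mem_filter, Finset.mem_univ, true_and]
  constructor
  · rintro ⟨_, ⟨y, hy, rfl⟩, _, ⟨z, hz, rfl⟩, h⟩
    exact ⟨y, hy, z, hz, fun h' => h (by simp [h'])⟩
  · rintro ⟨y, hy, z, hz, h⟩
    exact ⟨_, ⟨y, hy, rfl⟩, _, ⟨z, hz, rfl⟩, fun h' => h (add_right_cancel h')⟩

open Classical in
lemma incidence_eq {F G : Set (Fin n → ℝ)} {T T' : Finset (Fin n)} (hF : freeCoords F = T)
    (hG : freeCoords G = T') : incidence G F =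
      if h : (T \ T').Nonempty then
        (-1) ^ (T.filter fun j => j < (T \ T').min' h).card *
          (if ∀ y ∈ F, ∀ z ∈ G, y ((T \ T').min' h) ≤ z ((T \ T').min' h) then 1 else -1)
      else 1 := by
  subst hF hG
  rfl

lemma incidence_translate (u : Fin n → ℕ) (F G : Set (Fin n → ℝ)) :
    incidence (translate u G) (translate u F) = incidence G F := by
  classical
  have h : ∀ i, (∀ y ∈ translate u F, ∀ z ∈ translate u G, y i ≤ z i) ↔
      ∀ y ∈ F, ∀ z ∈ G, y i ≤ z i := by
    intro i
    rw [translate, translate, Set.forall_mem_image]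
    refine forall₂_congr fun y _ => ?_
    rw [Set.forall_mem_image]
    exact forall₂_congr fun z _ => add_le_add_iff_right _
  rw [incidence_eq (freeCoords_translate u F) (freeCoords_translate u G), incidence_eq rfl rfl]
  by_cases hne : (freeCoords F \ freeCoords G).Nonempty
  · rw [dif_pos hne, dif_pos hne]
    congr 1
    simp only [if_congr (h ((freeCoords F \ freeCoords G).min' hne)) rfl rfl]
  · rw [dif_neg hne, dif_neg hne]

lemma incidenceMatrix_translate {X Y : Set (Set (Fin n → ℝ))} {p : ℕ} {F : Face X (p + 1)}
    {G : Face X p} {F' : Face Y (p + 1)} {G' : Face Y p} (hF : F'.1 = translate u F.1)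
    (hG : G'.1 = translate u G.1) : incidenceMatrix k F' G' = incidenceMatrix k F G := by
  have h : G'.1 ⊆ F'.1 ↔ G.1 ⊆ F.1 := by rw [hF, hG, translate_subset_iff]
  by_cases hs : G.1 ⊆ F.1
  · rw [incidenceMatrix, incidenceMatrix, if_pos hs, if_pos (h.2 hs), hF, hG, incidence_translate]
  · rw [incidenceMatrix, incidenceMatrix, if_neg hs, if_neg (mt h.1 hs)]

lemma cube_translate (hu : e + ∑ i, u i = e') {p : ℕ}
    {F : Face (bounded (subdividedSimplex n e) β) (p + 1)}
    {F' : Face (bounded (subdividedSimplex n e') β') (p + 1)} (hF : F'.1 = translate u F.1) :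
    cube F' = ((cube F).1 + u, (cube F).2) := by
  refine cellSet_injective (isCell_cube F') ((isCell_add_iff hu _).2 (isCell_cube F)) ?_
  rw [← translate_cellSet hu, ← eq_cellSet_cube, ← eq_cellSet_cube, hF]

lemma exponent_translate (hu : e + ∑ i, u i = e') {p : ℕ}
    {F : Face (bounded (subdividedSimplex n e) β) (p + 1)}
    {F' : Face (bounded (subdividedSimplex n e') β') (p + 1)} (hF : F'.1 = translate u F.1) :
    exponent F' = exponent F + Finsupp.equivFunOnFinite.symm u := by
  have : label (bounded (subdividedSimplex n e') β') F'.1 =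
      label (bounded (subdividedSimplex n e) β) F.1 + u := by
    rw [label_face, label_face, cube_translate hu hF, top_add]
  rw [exponent, this]
  ext
  rfl

/-- The faces of a translate of a cell are translates of its faces. -/
lemma exists_translate_eq (hu : e + ∑ i, u i = e') {p : ℕ}
    {F : Face (bounded (subdividedSimplex n e) β) (p + 2)}
    {F' : Face (bounded (subdividedSimplex n e') β') (p + 2)} (hF : F'.1 = translate u F.1)
    {G' : Face (bounded (subdividedSimplex n e') β') (p + 1)} (hG : G'.1 ⊆ F'.1) :
    ∃ G : Face (bounded (subdividedSimplex n e) β) (p + 1), G'.1 = translate u G.1 := by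
  have hsub := hG
  rw [eq_cellSet_cube F', eq_cellSet_cube G', cellSet_subset_iff (isCell_cube G'),
    cube_translate hu hF, top_add] at hsub
  have h1 : u ≤ (cube G').1 := le_trans (fun i => Nat.le_add_left _ _) hsub.1
  have hx : (((cube G').1 - u) + u, (cube G').2) = cube G' := by rw [tsub_add_cancel_of_le h1]
  have hc := isCell_cube G'
  have ht := hsub.2
  rw [← hx] at hc ht
  rw [isCell_add_iff hu ((cube G').1 - u, (cube G').2)] at hc
  rw [top_add ((cube G').1 - u, (cube G').2)] at ht
  obtain ⟨G, hG⟩ := exists_face hc ((add_le_add_iff_right u).1 ht |>.trans (top_cube_le F))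
    (max_card_cube G')
  refine ⟨G, ?_⟩
  rw [eq_cellSet_cube G', eq_cellSet_cube G, hG, translate_cellSet hu, hx]

variable {φ : ∀ p, Face (bounded (subdividedSimplex n e) β) p →
  Face (bounded (subdividedSimplex n e') β') p}

/-- Translation preserves incidence numbers and shifts both labels by `u`, so the monomial
coefficients agree; no facets of the translate lie outside the image of `φ`. -/
lemma mapDomain_boundary_succ (hu : e + ∑ i, u i = e')
    (hφ : ∀ p F, (φ p F).1 = translate u F.1) (p : ℕ)
    (F : Face (bounded (subdividedSimplex n e) β) (p + 2)) :
    Finsupp.mapDomain (φ (p + 1))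
      (boundary k (bounded (subdividedSimplex n e) β) (p + 1) (single F 1)) =
      boundary k (bounded (subdividedSimplex n e') β') (p + 1) (single (φ (p + 2) F) 1) := by
  have hinj : Function.Injective (φ (p + 1)) := fun F G h => Subtype.ext <|
    translate_injective u (by rw [← hφ, ← hφ, h])
  ext1 G'
  rw [boundary_single_apply (finite_bounded e' β')]
  by_cases hG : ∃ G, φ (p + 1) G = G'
  · obtain ⟨G, rfl⟩ := hG
    rw [Finsupp.mapDomain_apply hinj, boundary_single_apply (finite_bounded e β),
      exponent_translate hu (hφ _ F), exponent_translate hu (hφ _ G), add_tsub_add_eq_tsub_right,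
      incidenceMatrix_translate (hφ _ F) (hφ _ G)]
  · rw [Finsupp.mapDomain_of_notMem_range _ _ hG, incidenceMatrix, if_neg, map_zero]
    intro h
    obtain ⟨G, hG'⟩ := exists_translate_eq hu (hφ _ F) h
    exact hG ⟨G, Subtype.ext (by rw [hφ, hG'])⟩

/-- The empty face keeps the label 1 under translation while vertex labels gain `x^u`; this is why
the chain map multiplies by `x^u` in degree 0 only. -/
lemma mapDomain_boundary_zero (hu : e + ∑ i, u i = e')
    (hφ : ∀ p F, (φ p F).1 = translate u F.1)
    (F : Face (bounded (subdividedSimplex n e) β) 1) :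
    mono k u • Finsupp.mapDomain (φ 0)
      (boundary k (bounded (subdividedSimplex n e) β) 0 (single F 1)) =
      boundary k (bounded (subdividedSimplex n e') β') 0 (single (φ 1 F) 1) := by
  have hinj : Function.Injective (φ 0) := fun F G h => Subtype.ext <|
    translate_injective u (by rw [← hφ, ← hφ, h])
  ext1 G'
  rw [eq_emptyFace G', boundary_single_vertex, cube_translate hu (hφ _ F), mono_add,
    ← eq_emptyFace (φ 0 (emptyFace _)), Finsupp.smul_apply, Finsupp.mapDomain_apply hinj,
    boundary_single_vertex, smul_eq_mul, mul_comm]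

end Translation

/-! ### The family of powers -/

section Family

open Finsupp (single)
open CategoryTheory

variable {n d : ℕ} {b : Fin n → ℕ}

lemma sum_shift {i j : PowerFamily n d b} (u : i ⟶ j) :
    i.power * d + ∑ t, PowerFamily.shift u t = j.power * d := by
  obtain ⟨s, hs, hs', hs''⟩ := (show PowerFamily.Mult i j from u).2
  change i.power * d + ∑ t, (show PowerFamily.Mult i j from u).1 t = _
  rw [← hs'', ← hs, add_mul]
  congr 1
  clear hs hs''
  induction s using Multiset.induction with
  | empty => simp
  | cons w s ih =>
    have h1 := ih fun v hv => hs' v (Multiset.mem_cons_of_mem hv)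
    have h2 := (hs' w (Multiset.mem_cons_self w s)).1
    simp only [Multiset.sum_cons, Multiset.card_cons, Pi.add_apply, Finset.sum_add_distrib, h1, h2]
    ring

lemma chainMap_zero_single (k : Type*) [Field k] {i j : PowerFamily n d b} (u : i ⟶ j)
    (F : Face i.complex 0) (q : MvPolynomial (Fin n) k) :
    PowerFamily.chainMap k u 0 (single F q) =
      single (PowerFamily.faceMap u 0 F) (mono k (PowerFamily.shift u) * q) := by
  rw [PowerFamily.chainMap, if_pos rfl, LinearMap.smul_apply, Finsupp.lmapDomain_apply,
    Finsupp.mapDomain_single, Finsupp.smul_single, smul_eq_mul]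

lemma chainMap_succ (k : Type*) [Field k] {i j : PowerFamily n d b} (u : i ⟶ j) (p : ℕ)
    (z : Chain k i.complex (p + 1)) :
    PowerFamily.chainMap k u (p + 1) z = Finsupp.mapDomain (PowerFamily.faceMap u (p + 1)) z := by
  rw [PowerFamily.chainMap, if_neg p.succ_ne_zero, one_smul, Finsupp.lmapDomain_apply]

lemma chainMap_succ_single (k : Type*) [Field k] {i j : PowerFamily n d b} (u : i ⟶ j) (p : ℕ)
    (F : Face i.complex (p + 1)) :
    PowerFamily.chainMap k u (p + 1) (single F 1) =
      single (PowerFamily.faceMap u (p + 1) F) 1 := by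
  rw [chainMap_succ, Finsupp.mapDomain_single]

lemma chainMap_comp_boundary (k : Type*) [Field k] {i j : PowerFamily n d b} (u : i ⟶ j) (p : ℕ) :
    PowerFamily.chainMap k u p ∘ₗ boundary k i.complex p =
      boundary k j.complex p ∘ₗ PowerFamily.chainMap k u (p + 1) := by
  refine Finsupp.lhom_ext' fun F => LinearMap.ext_ring ?_
  simp only [LinearMap.comp_apply, Finsupp.lsingle_apply]
  rw [chainMap_succ_single]
  cases p with
  | zero =>
    rw [PowerFamily.chainMap, if_pos rfl, LinearMap.smul_apply, Finsupp.lmapDomain_apply]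
    exact mapDomain_boundary_zero (φ := fun p => PowerFamily.faceMap u p) (sum_shift u)
      (fun _ _ => rfl) F
  | succ p =>
    rw [chainMap_succ]
    exact mapDomain_boundary_succ (φ := fun p => PowerFamily.faceMap u p) (sum_shift u)
      (fun _ _ => rfl) p F

lemma label_faceMap {i j : PowerFamily n d b} (u : i ⟶ j) (p : ℕ) (F : Face i.complex (p + 1)) :
    label j.complex (PowerFamily.faceMap u (p + 1) F).1 =
      label i.complex F.1 + PowerFamily.shift u := by
  have h := exponent_translate (β := i.power • b) (β' := j.power • b) (F := F)
    (F' := PowerFamily.faceMap u (p + 1) F) (sum_shift u) rfl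
  exact congrArg (fun f : Fin n →₀ ℕ => (f : Fin n → ℕ)) h

theorem isCompatiblePair_chainMap (k : Type*) [Field k] {i j : PowerFamily n d b} (u : i ⟶ j) :
    IsCompatiblePair k i.complex j.complex (PowerFamily.chainMap k u)
      (fun y => y + toPt (PowerFamily.shift u)) where
  continuousOn := (continuous_id.add continuous_const).continuousOn
  cellular := by
    rintro q y ⟨F, hF, hr, hy⟩
    exact ⟨translate (PowerFamily.shift u) F, PowerFamily.translate_mem u hF,
      (faceRank_translate _ _).trans_le hr, y, hy, rfl⟩
  chainMap := chainMap_comp_boundary k u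
  image := by
    intro p F
    rw [chainMap_succ_single, Finsupp.support_single _ one_ne_zero]
    simp only [Finset.mem_singleton, Set.iUnion_iUnion_eq_left]
    rfl
  labels := by
    intro p F
    rw [chainMap_succ_single, Finsupp.support_single _ one_ne_zero, Finset.sup_singleton,
      label_faceMap, chainMap_zero_single, mono_add, mul_comm]
    congr 1
    exact Subtype.ext (Set.image_empty _)

/-- The elementary morphism given by a generator. -/
def stepHom {i j : PowerFamily n d b} (h : i.power + 1 = j.power) {u : Fin n → ℕ}
    (hu : u ∈ gens n d b) : i ⟶ j :=
  (⟨u, {u}, by simpa using h, by simpa using hu, by simp⟩ : PowerFamily.Mult i j)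

/-- For large exponents every cell is a translate of a cell of the preceding complex. -/
lemma exists_step {m : PowerFamily n d b} (hm : max n 2 ≤ m.power) {F : Set (Fin n → ℝ)}
    (hF : F ∈ m.complex) :
    ∃ (j : PowerFamily n d b) (u : j ⟶ m), j.power + 1 = m.power ∧
      ∃ G ∈ j.complex, F = translate (PowerFamily.shift u) G := by
  obtain ⟨M, hM⟩ : ∃ M, m.power = M + 1 := ⟨m.power - 1, by omega⟩
  obtain ⟨x, hx, hb, rfl⟩ := mem_bounded.1 hF
  have hcard : x.2.card ≤ n := by simpa using Finset.card_le_univ x.2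
  rw [hM] at hb
  -- Here the exponent being at least n enters: both corners differ in degree from that of the cell
  -- by less than |T| ≤ n, or by 0 at a vertex.
  have hsum : (M + 1) * d < ∑ i, x.1 i + (M + 1) ∧ ∑ i, x.top i < (M + 1) * d + (M + 1) := by
    rw [sum_top, ← hM]
    rcases hx with ⟨h1, h2⟩ | ⟨h1, h2⟩
    · rw [h1, h2, Finset.card_empty]; omega
    · omega
  obtain ⟨u, hu, h1, h2⟩ := exists_gen_between (d := d) (b := b) (f := x.1) (g := x.top)
    (fun i => Nat.le_add_right _ _) hb (fun i => by
      have h3 : x.top i ≤ (M + 1) * b i := hb i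
      change x.1 i + ind x.2 i ≤ x.1 i + M * b i
      change x.1 i + ind x.2 i ≤ (M + 1) * b i at h3
      have h4 : ind x.2 i ≤ 1 := by
        simp only [ind]; split_ifs <;> omega
      -- The exponent being at least 2 is needed here: a free coordinate forces `b i ≥ 1`, and then
      -- `M * b i` has room for the edge of length 1.
      have h5 : 1 ≤ M := by omega
      rcases Nat.eq_zero_or_pos (b i) with h6 | h6
      · rw [h6] at h3 ⊢; omega
      · have : 1 * 1 ≤ M * b i := Nat.mul_le_mul h5 h6
        omega) hsum.1 hsum.2
  refine ⟨⟨M, by omega⟩, stepHom hM.symm hu, hM.symm, cellSet (M * d) (x.1 - u, x.2), ?_, ?_⟩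
  · have hu' : M * d + ∑ i, u i = m.power * d := by rw [hu.1, hM]; ring
    refine mem_bounded.2 ⟨_, ?_, ?_, rfl⟩
    · rw [← isCell_add_iff hu', tsub_add_cancel_of_le h1]
      exact hx
    · have h3 := top_add (x.1 - u, x.2) u
      rw [tsub_add_cancel_of_le h1] at h3
      change x.top = _ at h3
      rw [h3] at h2
      exact (add_le_add_iff_right u).1 h2
  · have hu' : M * d + ∑ i, u i = m.power * d := by rw [hu.1, hM]; ring
    change _ = translate u _
    rw [translate_cellSet hu', tsub_add_cancel_of_le h1]

lemma power_injective : Function.Injective (PowerFamily.power : PowerFamily n d b → ℕ) := by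
  rintro ⟨i, hi⟩ ⟨j, hj⟩ rfl
  rfl

/-- The immediate predecessor suffices. Requiring a morphism to `m` makes the covering set empty
when there are no generators, in which case `m` has no cells. -/
theorem isCovered_of_le {m : PowerFamily n d b} (hm : max n 2 ≤ m.power) : IsCovered m := by
  refine ⟨{j | j.power + 1 = m.power ∧ Nonempty (j ⟶ m)}, ?_, ?_, ?_⟩
  · refine Set.Subsingleton.finite fun i hi j hj => power_injective ?_
    have h1 := hi.1
    have h2 := hj.1
    omega
  · rintro j ⟨h1, h2⟩
    exact ⟨by omega, h2⟩
  · ext F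
    simp only [Set.mem_iUnion, Set.mem_image]
    constructor
    · rintro ⟨j, -, u, G, hG, rfl⟩
      exact PowerFamily.translate_mem u hG
    · intro hF
      obtain ⟨j, u, hj, G, hG, rfl⟩ := exists_step hm hF
      exact ⟨j, ⟨hj, ⟨u⟩⟩, u, G, hG, rfl⟩

lemma exists_faceMap_eq {m : PowerFamily n d b} (hm : max n 2 ≤ m.power) (p : ℕ)
    (F : Face m.complex (p + 1)) :
    ∃ (j : PowerFamily n d b) (u : j ⟶ m), j.power < m.power ∧
      ∃ G : Face j.complex (p + 1), PowerFamily.faceMap u (p + 1) G = F := by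
  obtain ⟨F, hF | hF, hr⟩ := F
  · rw [hF, faceRank_empty] at hr
    omega
  · obtain ⟨j, u, hj, G, hG, rfl⟩ := exists_step hm hF
    exact ⟨j, u, by omega, ⟨G, Or.inr hG, (faceRank_translate _ _).symm.trans hr⟩, rfl⟩

/-- The subrepresentation of the syzygy modules. -/
noncomputable def syzygyRep (k : Type*) [Field k] (n d : ℕ) (b : Fin n → ℕ) (p : ℕ) :
    Subrepresentation (moduleRep k n d b p) where
  carrier m := syzygy k m.complex p
  map_mem := by
    rintro i j u _ ⟨z, rfl⟩
    exact ⟨PowerFamily.chainMap k u (p + 1) z,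
      (LinearMap.congr_fun (chainMap_comp_boundary k u p) z).symm⟩

/-- The boundary of a face. -/
noncomputable def faceSyzygy (k : Type*) [Field k] (p : ℕ) (m : PowerFamily n d b)
    (F : Face m.complex (p + 1)) : (syzygyRep k n d b p).toRep.obj m :=
  (⟨boundary k m.complex p (single F 1), _, rfl⟩ : syzygy k m.complex p)

/-- The generators are the boundaries of all faces at exponents below `max n 2`. By strong induction
on the exponent, every later face boundary is the image of an earlier one, and face boundaries span
each syzygy module. -/
theorem hasFGSyzygies (k : Type*) [Field k] (n d : ℕ) (b : Fin n → ℕ) :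
    HasFGSyzygies k n d b := by
  intro p
  refine ⟨syzygyRep k n d b p, fun _ => rfl, ⋃ m ∈ {m : PowerFamily n d b | m.power < max n 2},
    Set.range fun F : Face m.complex (p + 1) => ⟨m, faceSyzygy k p m F⟩, ?_, ?_⟩
  · refine Set.Finite.biUnion ?_ fun m _ => ?_
    · exact (Set.finite_Iio (max n 2)).preimage power_injective.injOn
    · have : Finite (Face m.complex (p + 1)) := finite_face (finite_bounded _ _) _
      exact Set.finite_range _
  · intro N hN
    have key : ∀ (M : ℕ) (m : PowerFamily n d b), m.power = M →
        ∀ F : Face m.complex (p + 1), faceSyzygy k p m F ∈ N.carrier m := by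
      intro M
      induction M using Nat.strong_induction_on with
      | _ M ih =>
        intro m hm F
        by_cases hlt : m.power < max n 2
        · exact hN ⟨m, faceSyzygy k p m F⟩
            (Set.mem_biUnion (show m ∈ {m : PowerFamily n d b | m.power < max n 2} from hlt)
              ⟨F, rfl⟩)
        · obtain ⟨j, u, hj, G, rfl⟩ := exists_faceMap_eq (not_lt.1 hlt) p F
          have h := N.map_mem u _ (ih j.power (hm ▸ hj) j rfl G)
          have h' : ((syzygyRep k n d b p).toRep.map u).hom (faceSyzygy k p j G) =
              faceSyzygy k p m (PowerFamily.faceMap u (p + 1) G) := by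
            refine Subtype.ext ?_
            change PowerFamily.chainMap k u p (boundary k j.complex p (single G 1)) =
              boundary k m.complex p (single (PowerFamily.faceMap u (p + 1) G) 1)
            rw [← chainMap_succ_single]
            exact LinearMap.congr_fun (chainMap_comp_boundary k u p) (single G 1)
          rwa [h'] at h
    intro m
    let N' : Submodule (MvPolynomial (Fin n) k) (syzygy k m.complex p) := N.carrier m
    -- The comparison takes place in the ambient chain module, where the syzygy module is the span
    -- of the face boundaries.
    have htop : syzygy k m.complex p ≤ N'.map (syzygy k m.complex p).subtype := by
      refine (range_eq_span_single (boundary k m.complex p)).le.trans (Submodule.span_le.2 ?_)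
      rintro _ ⟨F, rfl⟩
      exact ⟨_, key m.power m rfl F, rfl⟩
    refine Submodule.eq_top_iff'.2 fun x => ?_
    obtain ⟨y, hy, hyx⟩ := htop (show (x : syzygy k m.complex p).1 ∈ syzygy k m.complex p from
      Subtype.property (p := fun y => y ∈ syzygy k m.complex p) x)
    have : y = (x : syzygy k m.complex p) := Subtype.ext hyx
    exact this ▸ hy

end Family

end CellFamily

theorem proposition5p9 (k : Type*) [Field k] (n : ℕ) :
    (∀ (d : ℕ) (b : Fin n → ℕ),
      (∀ m : CellFamily.PowerFamily n d b,
        CellFamily.SupportsResolution k m.complex (CellFamily.boundedIdeal k n d b ^ m.power)) ∧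
      (∀ (i j : CellFamily.PowerFamily n d b) (u : i ⟶ j),
        CellFamily.IsCompatiblePair k i.complex j.complex
          (CellFamily.PowerFamily.chainMap k u)
          (fun y => y + CellFamily.toPt (CellFamily.PowerFamily.shift u))) ∧
      (∃ K : ℕ, ∀ m : CellFamily.PowerFamily n d b, K ≤ m.power → CellFamily.IsCovered m) ∧
      CellFamily.HasFGSyzygies k n d b) ∧
    ((∀ m : CellFamily.PowerFamily n 2 (fun _ => 1),
        CellFamily.SupportsResolution k m.complex
          (CellFamily.edgeIdeal k (⊤ : SimpleGraph (Fin n)) ^ m.power)) ∧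
      CellFamily.HasFGSyzygies k n 2 (fun _ => 1)) := by
  have h : ∀ (d : ℕ) (b : Fin n → ℕ) (m : CellFamily.PowerFamily n d b),
      CellFamily.SupportsResolution k m.complex (CellFamily.boundedIdeal k n d b ^ m.power) := by
    intro d b m
    rw [CellFamily.boundedIdeal_pow]
    exact CellFamily.supportsResolution_bounded k (m.power * d) (m.power • b)
  refine ⟨fun d b => ⟨h d b, fun i j u => CellFamily.isCompatiblePair_chainMap k u,
    ⟨max n 2, fun m hm => CellFamily.isCovered_of_le hm⟩, CellFamily.hasFGSyzygies k n d b⟩, ?_,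
    CellFamily.hasFGSyzygies k n 2 _⟩
  rw [CellFamily.edgeIdeal_top]
  exact h 2 _
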